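/- Let $k$ be an algebraically closed field of characteristic $0$, let $\mathbb K=\bigcup_{n\ge 1}k((x^{1/n}))$ be the field of Puiseux series with $|a|=|x|^{\operatorname{ord}(a)}$, $|x|=e^{-1}$, and let $\mathbb P^1_{an}=\mathbb P^1_{an}(\mathbb K)$ be the Berkovich projective line over $\mathbb K$: the multiplicative non-Archimedean seminorms on $\mathbb K[y]$ extending $|\cdot|$, together with a point $\infty$, with its usual (compact, uniquely path connected) topology. For $a\in\mathbb K$ and real $r$, $\zeta(a,|x|^r)$ is the norm $\sum_n c_n(y-a)^n\mapsto\max_n|c_n||x|^{rn}$; it is of Type II if $r\in\mathbb Q$. Type I points are $\infty$ and the seminorms $f\mapsto|f(a)|$, $a\in\mathbb K$. $[\alpha,\beta]$ is the path from $\alpha$ to $\beta$, $(\alpha,\beta)=[\alpha,\beta]\setminus\{\alpha,\beta\}$, and $\alpha\prec\beta$ means $\beta\in[\alpha,\infty]$ and $\beta\neq\alpha$. The multiplicity $\mathfrak m(\xi)\in\{1,2,\dots,\infty\}$ is the size of the orbit of $\xi$ under $\mathrm{Gal}(\mathbb K/k((x)))$, and $\mathfrak m(U)=\min_{\xi\in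 U}\mathfrak m(\xi)$. The generic multiplicity $\mathfrak g(\xi)$ is $\mathfrak m(\xi)$ at Type I points, $\operatorname{lcm}(\mathfrak m(\xi),q)$ at a Type II point $\xi=\zeta(a,|x|^{p/q})$ with $p/q$ in lowest terms, and $\infty$ at all other points. A Type II point $\zeta$ restricts to a norm on $k(x,y)$ which is equivalent to a normalised discrete valuation $\operatorname{ord}_E$; put $\mathfrak b(\zeta)=\operatorname{ord}_E(x)$ and $\mathfrak a(\zeta)=\operatorname{ord}_E(dx\wedge dy)-\operatorname{ord}_E(x)+1$. At points $\xi$ not of Type II put $\mathfrak b(\xi)=\mathfrak g(\xi)$. Divisibility in $\{1,2,\dots,\infty\}$ has the convention that everything divides $\infty$. Let $\Gamma\subset\mathbb P^1_{an}$ be a finite set of Type II points. A $\Gamma$-domain is a connected component $U$ of $\mathbb P^1_{an}\setminus\Gamma$; it is a $\Gamma$-disk bounded by $\zeta$ if its boundary is $\{\zeta\}$, and a $\Gamma$-annulus bounded by $\alpha\ne\beta$ if its boundary is $\{\alpha,\beta\}$. A disk $U$ bounded by $\zeta$ is Farey if $\mathfrak m(U)=\mathfrak g(\zeta)$; an annulus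 $U$ bounded by $\alpha,\beta$ is Farey if $\mathfrak g(\xi)>\max(\mathfrak g(\alpha),\mathfrak g(\beta))$ for all $\xi\in U$. **Theorem.** (a) If $U$ is a $\Gamma$-disk bounded by $\zeta$, then $U$ is Farey if and only if $\mathfrak b(\zeta)=\min_{\xi\in U}\mathfrak m(\xi)$, and in that case $\mathfrak b(\zeta)\mid\mathfrak m(\xi)\mid\mathfrak b(\xi)$ for every $\xi\in U$. (b) If $U$ is a $\Gamma$-annulus bounded by $\alpha$ and $\beta$, the following are equivalent: (i) $U$ is Farey; equivalently, $\min_{\xi\in U}\mathfrak b(\xi)>\max(\mathfrak b(\alpha),\mathfrak b(\beta))$; (ii) $\mathfrak b(\xi)>\max(\mathfrak b(\alpha),\mathfrak b(\beta))$ for every $\xi\in(\alpha,\beta)$; (iii) every finite generic multiplicity $\mathfrak g(\xi)$, $\xi\in U$, lies in $\mathbb N^+\langle\mathfrak b(\alpha),\mathfrak b(\beta)\rangle=\{s\,\mathfrak b(\alpha)+t\,\mathfrak b(\beta): s,t\in\mathbb Z_{\ge1}\}$; (iv) $\alpha\prec\beta$ and $\mathfrak a(\alpha)\mathfrak b(\beta)-\mathfrak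 b(\alpha)\mathfrak a(\beta)=\mathfrak m(\alpha)=\gcd(\mathfrak b(\alpha),\mathfrak b(\beta))$, or the same with $\alpha$ and $\beta$ exchanged. -/

import Mathlib

open Polynomial Topology

noncomputable section

namespace FareyTree

/-! ## Puiseux series -/

section Field

variable (k : Type*) [Field k]

/-- The embedding `k((x)) → k((x^ℚ))`, `x ↦ x^(1/n)`, for `n ≥ 1` (written `n + 1` below). -/
def rootHom (n : ℕ) : HahnSeries ℤ k →+* HahnSeries ℚ k :=
  HahnSeries.embDomainRingHom
    ((AddMonoidHom.mulRight (((n : ℚ) + 1)⁻¹)).comp (Int.castAddHom ℚ))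
    (by
      intro a b h
      have hn : ((n : ℚ) + 1)⁻¹ ≠ 0 := by positivity
      have h' : (a : ℚ) * ((n : ℚ) + 1)⁻¹ = (b : ℚ) * ((n : ℚ) + 1)⁻¹ := h
      exact_mod_cast mul_right_cancel₀ hn h')
    (by
      intro a b
      have hn : (0 : ℚ) < ((n : ℚ) + 1)⁻¹ := by positivity
      change (a : ℚ) * ((n : ℚ) + 1)⁻¹ ≤ (b : ℚ) * ((n : ℚ) + 1)⁻¹ ↔ a ≤ b
      rw [mul_le_mul_iff_left₀ hn]
      exact Int.cast_le)

theorem mem_range_rootHom (n : ℕ) (f : HahnSeries ℚ k) :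
    f ∈ (rootHom k n).fieldRange ↔
      ∀ q ∈ f.support, ∃ m : ℤ, q = (m : ℚ) * ((n : ℚ) + 1)⁻¹ := by
  constructor
  · rintro ⟨g, rfl⟩ q hq
    have := HahnSeries.support_embDomain_subset hq
    obtain ⟨m, -, hm⟩ := this
    exact ⟨m, hm.symm⟩
  · intro h
    have hn : (0 : ℚ) < ((n : ℚ) + 1)⁻¹ := by positivity
    let e : ℤ ↪o ℚ := OrderEmbedding.ofMapLEIff
      (fun a : ℤ => (a : ℚ) * ((n : ℚ) + 1)⁻¹) (by
        intro a b
        rw [mul_le_mul_iff_left₀ hn]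
        exact Int.cast_le)
    have hpwo : (Function.support fun m : ℤ => f.coeff (e m)).IsPWO := by
      have hs : Set.IsPWO f.support := f.isPWO_support
      rw [Set.isPWO_iff_isWF] at hs ⊢
      rw [Set.isWF_iff_no_descending_seq] at hs ⊢
      intro g hg hmem
      exact hs (fun i => e (g i)) (fun a b hab => e.strictMono (hg hab)) (fun i => hmem i)
    refine ⟨⟨fun m => f.coeff (e m), hpwo⟩, ?_⟩
    ext q
    by_cases hq : q ∈ f.support
    · obtain ⟨m, rfl⟩ := h q hq
      exact HahnSeries.embDomain_coeff (f := e)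
    · have hz : f.coeff q = 0 := by simpa using hq
      rw [hz]
      by_cases hr : q ∈ Set.range e
      · obtain ⟨m, rfl⟩ := hr
        exact (HahnSeries.embDomain_coeff (f := e)).trans hz
      · exact HahnSeries.embDomain_of_notMem_range hr

theorem exists_common_root {f g : HahnSeries ℚ k}
    (hf : ∃ n : ℕ, ∀ q ∈ f.support, ∃ m : ℤ, q = (m : ℚ) * ((n : ℚ) + 1)⁻¹)
    (hg : ∃ n : ℕ, ∀ q ∈ g.support, ∃ m : ℤ, q = (m : ℚ) * ((n : ℚ) + 1)⁻¹) :
    ∃ n : ℕ, f ∈ (rootHom k n).fieldRange ∧ g ∈ (rootHom k n).fieldRange := by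
  obtain ⟨n, hn⟩ := hf
  obtain ⟨l, hl⟩ := hg
  refine ⟨n * l + n + l, ?_, ?_⟩
  · rw [mem_range_rootHom]
    intro q hq
    obtain ⟨m, rfl⟩ := hn q hq
    refine ⟨m * (l + 1), ?_⟩
    have h1 : ((n : ℚ) + 1) ≠ 0 := by positivity
    have h2 : (((n * l + n + l : ℕ) : ℚ) + 1) ≠ 0 := by positivity
    push_cast at h2 ⊢
    field_simp
    ring
  · rw [mem_range_rootHom]
    intro q hq
    obtain ⟨m, rfl⟩ := hl q hq
    refine ⟨m * (n + 1), ?_⟩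
    have h1 : ((l : ℚ) + 1) ≠ 0 := by positivity
    have h2 : (((n * l + n + l : ℕ) : ℚ) + 1) ≠ 0 := by positivity
    push_cast at h2 ⊢
    field_simp
    ring

/-- The field of Puiseux series `⋃ₙ k((x^(1/n)))`, as a subfield of the Hahn series with rational
exponents: the series all of whose exponents have a common denominator. -/
def puiseuxSubfield : Subfield (HahnSeries ℚ k) where
  carrier := {f | ∃ n : ℕ, ∀ q ∈ f.support, ∃ m : ℤ, q = (m : ℚ) * ((n : ℚ) + 1)⁻¹}
  mul_mem' := by
    intro f g hf hg
    obtain ⟨n, h1, h2⟩ := exists_common_root k hf hg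
    exact ⟨n, (mem_range_rootHom k n _).1 (mul_mem h1 h2)⟩
  one_mem' := ⟨0, (mem_range_rootHom k 0 _).1 (one_mem _)⟩
  add_mem' := by
    intro f g hf hg
    obtain ⟨n, h1, h2⟩ := exists_common_root k hf hg
    exact ⟨n, (mem_range_rootHom k n _).1 (add_mem h1 h2)⟩
  zero_mem' := ⟨0, (mem_range_rootHom k 0 _).1 (zero_mem _)⟩
  neg_mem' := by
    rintro f ⟨n, hn⟩
    exact ⟨n, (mem_range_rootHom k n _).1 (neg_mem ((mem_range_rootHom k n _).2 hn))⟩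
  inv_mem' := by
    rintro f ⟨n, hn⟩
    exact ⟨n, (mem_range_rootHom k n _).1 (inv_mem ((mem_range_rootHom k n _).2 hn))⟩

/-- The field `𝕂` of Puiseux series over `k`. -/
abbrev Puiseux : Type _ := puiseuxSubfield k

/-- The inclusion `k((x)) → 𝕂`. -/
def laurentToPuiseux : LaurentSeries k →+* Puiseux k :=
  (rootHom k 0).codRestrict (puiseuxSubfield k)
    (fun f => ⟨0, (mem_range_rootHom k 0 _).1 ⟨f, rfl⟩⟩)

instance : Algebra (LaurentSeries k) (Puiseux k) := (laurentToPuiseux k).toAlgebra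

open Classical in
/-- The absolute value on `𝕂`, normalised by `|x| = e⁻¹`:  `|a| = |x| ^ ord(a)`. -/
def puiseuxAbs : AbsoluteValue (Puiseux k) ℝ where
  toFun a := if a = 0 then 0 else Real.exp (-((a : HahnSeries ℚ k).order : ℝ))
  map_mul' a b := by
    by_cases ha : a = 0
    · simp [ha]
    by_cases hb : b = 0
    · simp [hb]
    have ha' : (a : HahnSeries ℚ k) ≠ 0 := fun h => ha (Subtype.ext h)
    have hb' : (b : HahnSeries ℚ k) ≠ 0 := fun h => hb (Subtype.ext h)
    have hab : a * b ≠ 0 := mul_ne_zero ha hb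
    simp only [ha, hb, hab, if_false]
    rw [← Real.exp_add]
    congr 1
    have : ((a * b : Puiseux k) : HahnSeries ℚ k).order
        = (a : HahnSeries ℚ k).order + (b : HahnSeries ℚ k).order := HahnSeries.order_mul ha' hb'
    rw [this]
    push_cast
    ring
  nonneg' a := by
    split_ifs
    · exact le_rfl
    · exact (Real.exp_pos _).le
  eq_zero' a := by
    split_ifs with h
    · simp [h]
    · simp [h, (Real.exp_pos _).ne']
  add_le' a b := by
    by_cases ha : a = 0
    · simp [ha]
    by_cases hb : b = 0
    · simp [hb]
    by_cases hab : a + b = 0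
    · simp only [hab, if_true, ha, hb, if_false]
      positivity
    have hab' : (a : HahnSeries ℚ k) + (b : HahnSeries ℚ k) ≠ 0 := fun h => hab (Subtype.ext h)
    simp only [ha, hb, hab, if_false]
    have h := HahnSeries.min_order_le_order_add hab'
    have h2 : ((a + b : Puiseux k) : HahnSeries ℚ k).order
        = ((a : HahnSeries ℚ k) + (b : HahnSeries ℚ k)).order := rfl
    rw [h2]
    rcases min_le_iff.1 h with h | h
    · have h3 : ((a : HahnSeries ℚ k).order : ℝ)
          ≤ (((a : HahnSeries ℚ k) + (b : HahnSeries ℚ k)).order : ℝ) := by exact_mod_cast h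
      have := Real.exp_le_exp.2 (neg_le_neg h3)
      have := (Real.exp_pos (-((b : HahnSeries ℚ k).order : ℝ))).le
      linarith
    · have h3 : ((b : HahnSeries ℚ k).order : ℝ)
          ≤ (((a : HahnSeries ℚ k) + (b : HahnSeries ℚ k)).order : ℝ) := by exact_mod_cast h
      have := Real.exp_le_exp.2 (neg_le_neg h3)
      have := (Real.exp_pos (-((a : HahnSeries ℚ k).order : ℝ))).le
      linarith

open Classical in
theorem puiseuxAbs_nonarch : IsNonarchimedean (puiseuxAbs k) := by
  intro a b
  by_cases ha : a = 0
  · simp [ha]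
  by_cases hb : b = 0
  · simp [hb]
  by_cases hab : a + b = 0
  · rw [hab, map_zero]
    exact le_max_of_le_left ((puiseuxAbs k).nonneg a)
  have hab' : (a : HahnSeries ℚ k) + (b : HahnSeries ℚ k) ≠ 0 := fun h => hab (Subtype.ext h)
  have h := HahnSeries.min_order_le_order_add hab'
  change (if a + b = 0 then (0 : ℝ) else
      Real.exp (-((((a : HahnSeries ℚ k) + (b : HahnSeries ℚ k)).order : ℚ) : ℝ))) ≤
    max (if a = 0 then (0 : ℝ) else Real.exp (-((a : HahnSeries ℚ k).order : ℝ)))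
      (if b = 0 then (0 : ℝ) else Real.exp (-((b : HahnSeries ℚ k).order : ℝ)))
  simp only [ha, hb, hab, if_false]
  rcases min_le_iff.1 h with h | h
  · refine le_max_of_le_left (Real.exp_le_exp.2 (neg_le_neg ?_))
    exact_mod_cast h
  · refine le_max_of_le_right (Real.exp_le_exp.2 (neg_le_neg ?_))
    exact_mod_cast h

end Field

/-! ## The Berkovich projective line over the Puiseux series -/

section Berkovich

variable (k : Type*) [Field k]

/-- The Berkovich affine line over `𝕂`: the multiplicative non-Archimedean seminorms on `𝕂[y]`
that extend the absolute value of `𝕂`. -/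
def BerkA1 : Type _ :=
  {v : MulRingSeminorm (Puiseux k)[X] //
    IsNonarchimedean v ∧ ∀ a : Puiseux k, v (C a) = puiseuxAbs k a}

/-- The coarsest topology for which every `ζ ↦ ‖f‖_ζ` is continuous. -/
instance : TopologicalSpace (BerkA1 k) :=
  TopologicalSpace.induced
    (fun (ζ : BerkA1 k) (f : (Puiseux k)[X]) => ζ.1 f) inferInstance

/-- The Berkovich projective line over `𝕂`: the affine line together with the point `∞`. The affine
line is locally compact Hausdorff and the projective line is compact Hausdorff, so its topology is
that of the one-point compactification. -/
abbrev BerkP1 : Type _ := OnePoint (BerkA1 k)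

variable {k}

/-- The point `ζ(a, |x|^r)` of the affine line:
`‖∑ cₙ (y - a)ⁿ‖ = maxₙ |cₙ| |x|^(r n)`. -/
def zetaA (a : Puiseux k) (r : ℝ) : BerkA1 k :=
  ⟨{ toFun := fun f => (taylor a f).gaussNorm (puiseuxAbs k) (Real.exp (-r))
     map_zero' := by simp
     add_le' := fun f g => by
       have hn := isNonarchimedean_gaussNorm (puiseuxAbs k) (puiseuxAbs_nonarch k)
         (Real.exp_pos (-r)).le (taylor a f) (taylor a g)
       have h1 := gaussNorm_nonneg (puiseuxAbs k) (taylor a f) (Real.exp_pos (-r)).le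
       have h2 := gaussNorm_nonneg (puiseuxAbs k) (taylor a g) (Real.exp_pos (-r)).le
       rw [map_add]
       refine hn.trans (max_le ?_ ?_) <;> linarith
     neg' := fun f => by
       rw [map_neg]
       have h := gaussNorm_mul (puiseuxAbs_nonarch k) (Real.exp_pos (-r)) (C (-1)) (taylor a f)
       rw [gaussNorm_C] at h
       simpa using h
     map_one' := by
       rw [taylor_one, gaussNorm_C, map_one]
     map_mul' := fun f g => by
       rw [taylor_mul]
       exact gaussNorm_mul (puiseuxAbs_nonarch k) (Real.exp_pos (-r)) _ _ },
    by
      intro f g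
      have hn := isNonarchimedean_gaussNorm (puiseuxAbs k) (puiseuxAbs_nonarch k)
         (Real.exp_pos (-r)).le (taylor a f) (taylor a g)
      change (taylor a (f + g)).gaussNorm (puiseuxAbs k) (Real.exp (-r)) ≤ _
      rw [map_add]
      exact hn,
    by
      intro c
      change (taylor a (C c)).gaussNorm (puiseuxAbs k) (Real.exp (-r)) = _
      rw [taylor_C, gaussNorm_C]⟩

/-- The Type II points `ζ(a, |x|^r)` with `a ∈ 𝕂` and `r` rational. -/
def IsTypeII (ζ : BerkP1 k) : Prop :=
  ∃ (a : Puiseux k) (r : ℚ), ζ = (zetaA a (r : ℝ) : BerkA1 k)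

/-- The Type I points: `∞` and the evaluation seminorms `f ↦ |f(a)|` with `a ∈ 𝕂`. -/
def IsTypeI (ζ : BerkP1 k) : Prop :=
  ζ = OnePoint.infty ∨
    ∃ z : BerkA1 k, ζ = z ∧ ∃ a : Puiseux k, ∀ f : (Puiseux k)[X], z.1 f = puiseuxAbs k (f.eval a)

/-- The closed interval `[α, β]` in the (uniquely path connected) projective line: the points that
every path from `α` to `β` passes through. -/
def closedInterval (α β : BerkP1 k) : Set (BerkP1 k) :=
  {ξ | ∀ p : Path α β, ξ ∈ Set.range p}

/-- The open interval `(α, β)`. -/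
def openInterval (α β : BerkP1 k) : Set (BerkP1 k) :=
  closedInterval α β \ {α, β}

/-- The order: `ζ ≺ ξ` if and only if `ξ ∈ (ζ, ∞]`. -/
def Prec (ζ ξ : BerkP1 k) : Prop :=
  ξ ∈ closedInterval ζ OnePoint.infty ∧ ξ ≠ ζ

/-! ## Multiplicity and generic multiplicity -/

/-- `ξ` is the image of `ζ` under an element of the Galois group of `𝕂` over `k((x))`. -/
def GaloisConj (ζ ξ : BerkP1 k) : Prop :=
  (ζ = OnePoint.infty ∧ ξ = OnePoint.infty) ∨
    ∃ z w : BerkA1 k, ζ = z ∧ ξ = w ∧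
      ∃ σ : Puiseux k ≃ₐ[LaurentSeries k] Puiseux k,
        ∀ f : (Puiseux k)[X], w.1 f = z.1 (f.map (σ : Puiseux k →+* Puiseux k))

/-- The multiplicity `𝔪(ζ)`: the size of the Galois orbit of `ζ`. -/
def mult (ζ : BerkP1 k) : ℕ∞ := Set.encard {ξ | GaloisConj ζ ξ}

/-- The multiplicity of a set: the minimum of the multiplicities of its points. -/
def multSet (U : Set (BerkP1 k)) : ℕ∞ := ⨅ ξ ∈ U, mult ξ

open Classical in
/-- The generic multiplicity `𝔤(ζ)`: it is `𝔪(ζ)` at a Type I point, `lcm(𝔪(ζ), q)` at a Type II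
point `ζ(a, |x|^(p/q))` with `p/q` in lowest terms, and `∞` at all other points. -/
def genMult (ζ : BerkP1 k) : ℕ∞ :=
  if h : ∃ (r : ℚ) (a : Puiseux k), ζ = (zetaA a (r : ℝ) : BerkA1 k) then
    ((Nat.lcm (mult ζ).toNat h.choose.den : ℕ) : ℕ∞)
  else if IsTypeI ζ then mult ζ
  else ⊤

/-! ## Divisorial valuations and the Farey parameters -/

variable (k) in
/-- The function field `k(x, y)` of the surface. -/
abbrev FunField : Type _ := FractionRing k[X][X]

variable (k) in
/-- The function `x` on the surface. -/
def fx : FunField k := algebraMap k[X][X] (FunField k) (C X)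

variable (k) in
/-- The function `y` on the surface. -/
def fy : FunField k := algebraMap k[X][X] (FunField k) X

variable (k) in
/-- The inclusion `k[x][y] → 𝕂[y]`. -/
def toPuiseuxPoly : k[X][X] →+* (Puiseux k)[X] :=
  mapRingHom ((laurentToPuiseux k).comp
    ((HahnSeries.ofPowerSeries ℤ k).comp Polynomial.coeToPowerSeries.ringHom))

/-- The norm `‖g / h‖_ζ = ‖g‖_ζ / ‖h‖_ζ` on `k(x, y)` (meant for `ζ` of Type II). -/
def ratNorm (ζ : BerkA1 k) (f : FunField k) : ℝ :=
  ζ.1 (toPuiseuxPoly k (IsLocalization.sec (nonZeroDivisors k[X][X]) f).1) /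
    ζ.1 (toPuiseuxPoly k (IsLocalization.sec (nonZeroDivisors k[X][X]) f).2)

/-- The norm of a uniformiser of the discrete valuation ring `{f ∈ k(x, y) | ‖f‖_ζ ≤ 1}` attached
to a Type II point `ζ`: the largest value of the norm below `1`. -/
def unifNorm (ζ : BerkA1 k) : ℝ := sSup {t | t < 1 ∧ ∃ f : FunField k, ratNorm ζ f = t}

/-- The order of vanishing `ord_E(f)` along the divisor `E` attached to the Type II point `ζ`, i.e.
the normalised discrete valuation on `k(x, y)` equivalent to `‖·‖_ζ`: the largest power of the
maximal ideal that contains `f`. -/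
def divOrd (ζ : BerkA1 k) (f : FunField k) : ℤ :=
  sSup {n : ℤ | ratNorm ζ f ≤ unifNorm ζ ^ n}

/-- The rational `2`-form `df ∧ dg` on the surface. -/
def wedge (f g : FunField k) : ⋀[FunField k]^2 (Ω[FunField k⁄k]) :=
  exteriorPower.ιMulti (FunField k) 2
    ![KaehlerDifferential.D k (FunField k) f, KaehlerDifferential.D k (FunField k) g]

/-- The order of vanishing of a rational `2`-form along the divisor attached to the Type II
point `ζ`: the largest `n` for which the form lies in `𝔪ⁿ ⋅ Ω²`, where `Ω²` consists of the sums of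
`u df ∧ dg` with `u`, `f`, `g` in the valuation ring and `𝔪` is the maximal ideal. -/
def formOrd (ζ : BerkA1 k) (ω : ⋀[FunField k]^2 (Ω[FunField k⁄k])) : ℤ :=
  sSup {n : ℤ | ω ∈ AddSubgroup.closure
    {η | ∃ u f g : FunField k, ratNorm ζ u ≤ unifNorm ζ ^ n ∧ ratNorm ζ f ≤ 1 ∧
      ratNorm ζ g ≤ 1 ∧ η = u • wedge f g}}

/-- `ord_E(x)`, for the divisor `E` attached to the Type II point `ζ`. -/
def fareyB (ζ : BerkP1 k) : ℤ := ζ.elim 0 (fun z => divOrd z (fx k))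

/-- The log discrepancy `𝔞(E) = ord_E(dx ∧ dy) - ord_E(x) + 1`, for the divisor `E` attached to the
Type II point `ζ`. -/
def fareyA (ζ : BerkP1 k) : ℤ :=
  ζ.elim 0 (fun z => formOrd z (wedge (fx k) (fy k)) - divOrd z (fx k) + 1)

open Classical in
/-- The invariant `𝔟` of a point: `ord_E(x)` at a Type II point, and the generic multiplicity at all
other points. -/
def bMult (ζ : BerkP1 k) : ℕ∞ :=
  if IsTypeII ζ then ((fareyB ζ).toNat : ℕ∞) else genMult ζ

/-! ## Domains and the Farey condition -/

/-- `U` is a `Γ`-domain: a connected component of the complement of `Γ`. -/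
def IsGammaDomain (Γ U : Set (BerkP1 k)) : Prop :=
  IsOpen U ∧ ∃ ξ ∈ Γᶜ, U = connectedComponentIn Γᶜ ξ

/-- `U` is a `Γ`-disk bounded by `ζ ∈ Γ`: a `Γ`-domain whose only boundary point is `ζ`. -/
def IsGammaDisk (Γ U : Set (BerkP1 k)) (ζ : BerkP1 k) : Prop :=
  IsGammaDomain Γ U ∧ ζ ∈ Γ ∧ frontier U = {ζ}

/-- `U` is a `Γ`-annulus bounded by `α, β ∈ Γ`: a `Γ`-domain with exactly two boundary points, `α`
and `β`. -/
def IsGammaAnnulus (Γ U : Set (BerkP1 k)) (α β : BerkP1 k) : Prop :=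
  IsGammaDomain Γ U ∧ α ∈ Γ ∧ β ∈ Γ ∧ α ≠ β ∧ frontier U = {α, β}

/-- A connected open set `U` bounded by Type II points is Farey if either it is a disk with boundary
point `ζ` and `𝔪(U) = 𝔤(ζ)`, or it is an annulus with boundary points `α`, `β` and
`𝔤(ξ) > max(𝔤(α), 𝔤(β))` for all `ξ ∈ U`. -/
def IsFarey (U : Set (BerkP1 k)) : Prop :=
  IsOpen U ∧ IsConnected U ∧
    ((∃ ζ, IsTypeII ζ ∧ frontier U = {ζ} ∧ multSet U = genMult ζ) ∨
      (∃ α β, IsTypeII α ∧ IsTypeII β ∧ α ≠ β ∧ frontier U = {α, β} ∧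
        ∀ ξ ∈ U, max (genMult α) (genMult β) < genMult ξ))

/-- The semigroup `ℕ⁺⟨a, b⟩ = {s a + t b | s, t ≥ 1}`. -/
def posSemigroup (a b : ℕ∞) : Set ℕ∞ :=
  {n | ∃ s t : ℕ, 0 < s ∧ 0 < t ∧ n = s * a + t * b}

/-- The ordered adjacency condition: `α ≺ β` and
`𝔞(α) 𝔟(β) - 𝔟(α) 𝔞(β) = 𝔪(α) = gcd(𝔟(α), 𝔟(β))`. -/
def FareyAdjacent (α β : BerkP1 k) : Prop :=
  Prec α β ∧
    fareyA α * fareyB β - fareyB α * fareyA β = (Int.gcd (fareyB α) (fareyB β) : ℤ) ∧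
    mult α = (Int.gcd (fareyB α) (fareyB β) : ℕ∞)

end Berkovich

end FareyTree

end

open Polynomial Topology

noncomputable section

namespace FareyTree

/-! ### Absolute values, monomials and truncations of Puiseux series -/

section FieldBasics

variable {k : Type*} [Field k]

/-! The theorem is the classical theory of Farey neighbours transported to the Berkovich line. A
Type II point is written `ζ(a, |x|^r)` with `a` truncated below `r`. If `m = per a` is the number of
Galois conjugates of `a`, equivalently the least common denominator of its exponents, then `𝔪 = m`
and `𝔤 = lcm(m, den r) = m · den(m r)` (`mult_zetaA`, `genMult_zetaA`, `lcm_den`).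

The divisorial invariants are `𝔟 = 𝔤` and `𝔞 = 𝔤 r` (`bMult_eq_genMult`, `fareyA_zetaA`). For `𝔟`,
the values of the norm on `k(x,y)` are powers of `|x|^(1/𝔤)`, and the generator occurs: a monomial
`x^c (y-a)^l` of weight `1/𝔤` is approximated by a trace from `k((x^(1/m)))[y]` to `k((x))[y]`. For
`𝔞`, Jacobians are computed with `∂/∂y` and a derivation `D` extending `x d/dx` with `D(y-a) =
r(y-a)`. The monomials `x^q (y-a)^n` are eigenvectors of `D`, with their weights as eigenvalues. So
`D` lowers the norm of a function of weight zero and multiplies a uniformiser by `1/𝔤` up to smaller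
terms, while `∂/∂y` enlarges norms by at most `|x|^(-r)`.

Disks (`multSet_dvd`): a disk without `∞` lies in an open disk `D(b, r)` with exponents of `b` at
most `r`. The conjugate disks are disjoint and permuted transitively, so `per b` divides every
multiplicity in it (`per_dvd_mult`), and `per b` is attained just inside the boundary.

Annuli: all conditions are compared with `AdjacentData`: `α = ζ(a,|x|^r)` and `β = ζ(a,|x|^s)` with
the exponents of `a` at most `s < r`, and `m r`, `m s` Farey neighbours. If the points separating
`α` from `β` have large `𝔤`, neither end can branch off and no exponent of `a` lies strictly between
`s` and `r`, so the data exist (`exists_adjacentData`). The separating points lie both in the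
annulus and in `(α, β)`, which treats conditions (i) and (ii) alike. Conversely, mediants give `𝔤`
on the path as a positive combination of the two ends, and `𝔤` off the path is a multiple of such a
value (`AdjacentData.genMult_mem`). The determinant condition is `𝔤(α) 𝔤(β) (r - s) = m`.

Algebraic closedness of the Puiseux field is proved along the way. It lets every seminorm be
recovered from its values on the linear polynomials `y - c`. -/

theorem puiseuxAbs_of_ne_zero {a : Puiseux k} (ha : a ≠ 0) :
    puiseuxAbs k a = Real.exp (-((a : HahnSeries ℚ k).order : ℝ)) := by
  classical
  exact if_neg ha

theorem puiseuxAbs_le_iff (a : Puiseux k) (r : ℝ) :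
    puiseuxAbs k a ≤ Real.exp (-r) ↔ ∀ q : ℚ, (q : ℝ) < r → a.1.coeff q = 0 := by
  by_cases ha : a = 0
  · subst ha
    simp [(Real.exp_pos _).le]
  have ha' : a.1 ≠ 0 := fun h => ha (Subtype.ext h)
  rw [puiseuxAbs_of_ne_zero ha, Real.exp_le_exp, neg_le_neg_iff]
  constructor
  · intro h q hq
    exact HahnSeries.coeff_eq_zero_of_lt_order (by exact_mod_cast hq.trans_le h)
  · intro h
    by_contra hlt
    exact HahnSeries.coeff_order_eq_zero.not.2 ha' (h _ (not_le.1 hlt))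

theorem puiseuxAbs_lt_iff (a : Puiseux k) (r : ℝ) :
    puiseuxAbs k a < Real.exp (-r) ↔ ∀ q : ℚ, (q : ℝ) ≤ r → a.1.coeff q = 0 := by
  by_cases ha : a = 0
  · subst ha
    simp [Real.exp_pos]
  have ha' : a.1 ≠ 0 := fun h => ha (Subtype.ext h)
  rw [puiseuxAbs_of_ne_zero ha, Real.exp_lt_exp, neg_lt_neg_iff]
  constructor
  · intro h q hq
    exact HahnSeries.coeff_eq_zero_of_lt_order (by exact_mod_cast hq.trans_lt h)
  · intro h
    by_contra hlt
    exact HahnSeries.coeff_order_eq_zero.not.2 ha' (h _ (not_lt.1 hlt))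

theorem exists_puiseuxAbs_eq {a : Puiseux k} (ha : a ≠ 0) :
    ∃ q : ℚ, a.1.coeff q ≠ 0 ∧ puiseuxAbs k a = Real.exp (-(q : ℝ)) ∧
      ∀ p < q, a.1.coeff p = 0 :=
  ⟨a.1.order, HahnSeries.coeff_order_eq_zero.not.2 fun h => ha (Subtype.ext h),
    puiseuxAbs_of_ne_zero ha, fun _ hp => HahnSeries.coeff_eq_zero_of_lt_order hp⟩

theorem puiseuxAbs_eq_of_coeff {a : Puiseux k} {q : ℚ} (h1 : a.1.coeff q ≠ 0)
    (h2 : ∀ p < q, a.1.coeff p = 0) : puiseuxAbs k a = Real.exp (-(q : ℝ)) := by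
  refine le_antisymm ((puiseuxAbs_le_iff a q).2 fun p hp => h2 p (by exact_mod_cast hp)) ?_
  by_contra h
  exact h1 ((puiseuxAbs_lt_iff a q).1 (not_le.1 h) q le_rfl)

/-- The monomial `c x^q`. -/
def mono (q : ℚ) (c : k) : Puiseux k :=
  ⟨HahnSeries.single q c, q.den - 1, by
    intro p hp
    obtain rfl : p = q := HahnSeries.support_single_subset hp
    refine ⟨p.num, ?_⟩
    have h1 : ((p.den - 1 : ℕ) : ℚ) + 1 = p.den := by
      rw [Nat.cast_sub p.den_pos]; simp
    rw [h1, ← div_eq_mul_inv, Rat.num_div_den]⟩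

@[simp] theorem mono_val (q : ℚ) (c : k) : (mono q c).1 = HahnSeries.single q c := rfl

theorem mono_mul (p q : ℚ) (c d : k) : mono p c * mono q d = mono (p + q) (c * d) :=
  Subtype.ext (HahnSeries.single_mul_single)

theorem mono_zero_one : mono (0 : ℚ) (1 : k) = 1 := rfl

theorem mono_pow (q : ℚ) (n : ℕ) : (mono q (1 : k)) ^ n = mono (n * q) 1 := by
  induction n with
  | zero => simp [mono_zero_one]
  | succ n ih =>
    rw [pow_succ, ih, mono_mul]
    congr 1
    · push_cast; ring
    · simp

theorem puiseuxAbs_mono (q : ℚ) {c : k} (hc : c ≠ 0) :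
    puiseuxAbs k (mono q c) = Real.exp (-(q : ℝ)) := by
  refine puiseuxAbs_eq_of_coeff (by simpa using hc) fun p hp => ?_
  rw [mono_val, HahnSeries.coeff_single_of_ne hp.ne]

open Classical in
/-- The part of a Puiseux series with exponents satisfying `P`. -/
def restr (P : ℚ → Prop) (a : Puiseux k) : Puiseux k :=
  ⟨⟨fun q => if P q then a.1.coeff q else 0, a.1.isPWO_support.mono fun q hq => by
      simp only [Function.mem_support] at hq
      intro h
      exact hq (by rw [h, ite_self])⟩, by
    obtain ⟨n, hn⟩ := a.2
    refine ⟨n, fun q hq => hn q ?_⟩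
    intro h
    exact hq (by change (if P q then a.1.coeff q else 0) = 0; rw [h, ite_self])⟩

theorem restr_coeff_of {P : ℚ → Prop} {q : ℚ} (h : P q) (a : Puiseux k) :
    (restr P a).1.coeff q = a.1.coeff q := if_pos h

theorem restr_coeff_of_not {P : ℚ → Prop} {q : ℚ} (h : ¬ P q) (a : Puiseux k) :
    (restr P a).1.coeff q = 0 := if_neg h

@[simp] theorem coeff_sub' (a b : Puiseux k) (q : ℚ) :
    (a - b).1.coeff q = a.1.coeff q - b.1.coeff q := rfl

@[simp] theorem coeff_add' (a b : Puiseux k) (q : ℚ) :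
    (a + b).1.coeff q = a.1.coeff q + b.1.coeff q := rfl

end FieldBasics

/-! ### The Newton–Puiseux theorem -/

section NewtonPuiseux

open IsLocalRing in
-- Weierstrass preparation extracts from `f` the factor carrying the roots that reduce to zero. Its
-- degree is the order of the reduction, which is positive because of `h0` and at most `i`. The
-- factorisation takes place among power series; uniqueness of Weierstrass division makes it
-- polynomial.
theorem exists_monic_dvd_of_residue {A : Type*} [CommRing A] [IsLocalRing A]
    [IsAdicComplete (maximalIdeal A) A] (f : A[X]) 
    (h0 : f.coeff 0 ∈ maximalIdeal A) {i : ℕ} (hi : i < f.natDegree)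
    (hne : f.coeff i ∉ maximalIdeal A) :
    ∃ g : A[X], g.Monic ∧ 0 < g.natDegree ∧ g.natDegree < f.natDegree ∧ g ∣ f := by
  have hci : PowerSeries.coeff i ((f : PowerSeries A).map (residue A)) ≠ 0 := by
    rw [PowerSeries.coeff_map, Polynomial.coeff_coe]
    exact fun h => hne ((residue_eq_zero_iff _).1 h)
  have hF : (f : PowerSeries A).map (residue A) ≠ 0 := by
    intro h
    exact hci (by rw [h]; simp)
  obtain ⟨g, h, H⟩ := PowerSeries.exists_isWeierstrassFactorization hF
  have hdeg := H.natDegree_eq_toNat_order_map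
  have hgm := H.isDistinguishedAt.monic
  have hgne : (g : PowerSeries A).map (residue A) ≠ 0 := by
    intro h'
    have := congrArg (PowerSeries.coeff g.natDegree) h'
    simp [hgm] at this
  -- Two Weierstrass divisions of `f` by `g` are compared: the factorisation, with remainder zero,
  -- and ordinary division by a monic polynomial. Their remainders agree.
  have hdiv1 : (f : PowerSeries A).IsWeierstrassDivision g h 0 := by
    refine ⟨?_, by simpa using H.eq_mul⟩
    rw [degree_zero]
    exact WithBot.bot_lt_coe _
  have hgord' : (g.natDegree : ℕ∞) = ((g : PowerSeries A).map (residue A)).order :=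
    H.isDistinguishedAt.coe_natDegree_eq_order_map g 1
      (by rw [PowerSeries.constantCoeff_one, ← Ideal.ne_top_iff_one]
          exact Ideal.IsMaximal.ne_top inferInstance) (by simp)
  have hgord : g.natDegree = ((g : PowerSeries A).map (residue A)).order.toNat := by
    rw [← hgord', ENat.toNat_natCast]
  have hdiv2 : (f : PowerSeries A).IsWeierstrassDivision g ((f /ₘ g : A[X]) : PowerSeries A)
      (f %ₘ g) := by
    refine ⟨?_, ?_⟩
    · refine (degree_modByMonic_lt f hgm).trans_eq ?_
      rw [degree_eq_natDegree hgm.ne_zero, hgord]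
      rfl
    · conv_lhs => rw [← modByMonic_add_div f g]
      push_cast
      ring
  have hmod := (hdiv1.elim hgne hdiv2).2
  have hord : ((f : PowerSeries A).map (residue A)).order ≤ i := PowerSeries.order_le _ hci
  refine ⟨g, hgm, ?_, ?_, (modByMonic_eq_zero_iff_dvd hgm).1 hmod.symm⟩
  · rw [hdeg, Nat.pos_iff_ne_zero]
    intro h'
    rw [ENat.toNat_eq_zero] at h'
    rcases h' with h' | h'
    · have := PowerSeries.coeff_order hF
      rw [h'] at this
      apply this
      rw [ENat.toNat_zero, PowerSeries.coeff_map, Polynomial.coeff_coe]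
      exact (residue_eq_zero_iff _).2 h0
    · rw [h'] at hord
      simp at hord
  · rw [hdeg]
    refine lt_of_le_of_lt ?_ hi
    exact ENat.toNat_le_of_le_natCast hord

variable {k : Type*} [Field k]

instance : IsAdicComplete (IsLocalRing.maximalIdeal (PowerSeries k)) (PowerSeries k) := by
  rw [PowerSeries.maximalIdeal_eq_span_X]
  infer_instance

/-- The embedding `k⟦t⟧ → 𝕂`, `t ↦ x^(1/(n+1))`. -/
def powerSeriesRoot (n : ℕ) : PowerSeries k →+* Puiseux k :=
  ((rootHom k n).comp (HahnSeries.ofPowerSeries ℤ k)).codRestrict (puiseuxSubfield k)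
    (fun _ => ⟨n, (mem_range_rootHom k n _).1 ⟨_, rfl⟩⟩)

theorem rootHom_coeff (n : ℕ) (f : HahnSeries ℤ k) (m : ℤ) :
    (rootHom k n f).coeff ((m : ℚ) * ((n : ℚ) + 1)⁻¹) = f.coeff m :=
  HahnSeries.embDomain_coeff (f := OrderEmbedding.ofMapLEIff
      (fun a : ℤ => (a : ℚ) * ((n : ℚ) + 1)⁻¹) _)

theorem powerSeriesRoot_coeff_zero (n : ℕ) (f : PowerSeries k) :
    (powerSeriesRoot n f).1.coeff 0 = PowerSeries.constantCoeff f := by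
  have h := rootHom_coeff n (HahnSeries.ofPowerSeries ℤ k f) 0
  rw [Int.cast_zero, zero_mul] at h
  refine h.trans ?_
  rw [← PowerSeries.coeff_zero_eq_constantCoeff_apply]
  exact HahnSeries.ofPowerSeries_apply_coeff f 0

theorem exists_powerSeriesRoot {n : ℕ} {a : Puiseux k} (h : a.1 ∈ (rootHom k n).fieldRange)
    (h0 : ∀ q < 0, a.1.coeff q = 0) : ∃ f : PowerSeries k, powerSeriesRoot n f = a := by
  obtain ⟨g, hg⟩ := h
  refine ⟨PowerSeries.mk fun i => g.coeff i, Subtype.ext ?_⟩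
  change rootHom k n _ = _
  rw [← hg]
  congr 1
  ext m
  by_cases hm : 0 ≤ m
  · lift m to ℕ using hm
    rw [HahnSeries.ofPowerSeries_apply_coeff, PowerSeries.coeff_mk]
  · rw [not_le] at hm
    have h1 : g.coeff m = 0 := by
      rw [← rootHom_coeff n g m, hg]
      apply h0
      have : (m : ℚ) < 0 := by exact_mod_cast hm
      have hn : (0 : ℚ) < ((n : ℚ) + 1)⁻¹ := by positivity
      exact mul_neg_of_neg_of_pos this hn
    rw [h1, HahnSeries.ofPowerSeries_apply]
    refine HahnSeries.embDomain_of_notMem_range ?_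
    rintro ⟨i, hi⟩
    have : (i : ℤ) = m := hi
    omega

theorem rootHom_fieldRange_mono {n l : ℕ} (h : (n + 1) ∣ (l + 1)) :
    (rootHom k n).fieldRange ≤ (rootHom k l).fieldRange := by
  intro f hf
  rw [mem_range_rootHom] at hf ⊢
  intro q hq
  obtain ⟨m, rfl⟩ := hf q hq
  obtain ⟨c, hc⟩ := h
  refine ⟨m * c, ?_⟩
  have h1 : ((n : ℚ) + 1) ≠ 0 := by positivity
  have h2 : ((l : ℚ) + 1) = (n + 1) * c := by exact_mod_cast hc
  have h3 : (c : ℚ) ≠ 0 := by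
    intro h
    rw [h, mul_zero] at h2
    have : (0 : ℚ) < (l : ℚ) + 1 := by positivity
    exact this.ne' h2
  rw [h2]
  push_cast
  field_simp

theorem exists_common_rootHom (s : Finset (Puiseux k)) :
    ∃ n : ℕ, ∀ a ∈ s, a.1 ∈ (rootHom k n).fieldRange := by
  classical
  induction s using Finset.induction_on with
  | empty => exact ⟨0, by simp⟩
  | insert a s _ ih =>
    obtain ⟨n, hn⟩ := ih
    obtain ⟨l, hl⟩ := a.2
    refine ⟨(n + 1) * (l + 1) - 1, ?_⟩
    have he : (n + 1) * (l + 1) - 1 + 1 = (n + 1) * (l + 1) :=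
      Nat.sub_add_cancel (Nat.mul_pos n.succ_pos l.succ_pos)
    intro b hb
    rcases Finset.mem_insert.1 hb with rfl | hb
    · exact rootHom_fieldRange_mono (by rw [he]; exact dvd_mul_left _ _)
        ((mem_range_rootHom k l _).2 hl)
    · exact rootHom_fieldRange_mono (by rw [he]; exact dvd_mul_right _ _) (hn b hb)

theorem monic_taylor {R : Type*} [CommRing R] {f : R[X]} (hf : f.Monic) (r : R) :
    (taylor r f).Monic :=
  (leadingCoeff_taylor r f).trans hf

theorem taylor_coeff_pred {R : Type*} [CommRing R] {f : R[X]} (hf : f.Monic) {d : ℕ}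
    (hd : f.natDegree = d + 1) (r : R) :
    (taylor r f).coeff d = f.coeff d + (d + 1 : ℕ) * r := by
  rw [taylor_coeff]
  have h1 : (hasseDeriv d f).natDegree ≤ 1 := by
    refine (natDegree_hasseDeriv_le f d).trans ?_
    omega
  have hl : f.coeff (d + 1) = 1 := by rw [← hd]; exact hf
  rw [eq_X_add_C_of_natDegree_le_one h1, hasseDeriv_coeff, hasseDeriv_coeff, zero_add, add_comm 1 d,
    hl]
  simp
  ring

instance [CharZero k] : CharZero (Puiseux k) := by
  have h1 : CharZero (HahnSeries ℚ k) :=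
    charZero_of_injective_ringHom (HahnSeries.C_injective (Γ := ℚ) (R := k))
  exact (puiseuxSubfield k).subtype.charZero

/-- Induction on the degree. After translation and scaling, the polynomial is integral over some
`k⟦x^(1/n)⟧` and its reduction is not a `d`-th power of a linear polynomial, so Weierstrass
preparation either ends at degree one with no proper splitting needed or yields a proper factor. -/
theorem exists_root_of_monic [IsAlgClosed k] [CharZero k] (d : ℕ) :
    ∀ f : (Puiseux k)[X], f.Monic → f.natDegree = d → 0 < d → ∃ a, f.eval a = 0 := by
  classical
  induction d using Nat.strong_induction_on with
  | _ d ih =>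
  -- A translation removes the subleading coefficient; this divides by the degree and uses
  -- characteristic zero.
  suffices H : ∀ f : (Puiseux k)[X], f.Monic → f.natDegree = d → 0 < d → f.coeff (d - 1) = 0 →
      ∃ a, f.eval a = 0 by
    intro f hf hd h0
    obtain ⟨e, rfl⟩ : ∃ e, d = e + 1 := ⟨d - 1, by omega⟩
    have hne : ((e + 1 : ℕ) : Puiseux k) ≠ 0 := Nat.cast_ne_zero.2 e.succ_ne_zero
    obtain ⟨a, ha⟩ := H (taylor (-f.coeff e / (e + 1 : ℕ)) f) (monic_taylor hf _)
      (by rw [natDegree_taylor, hd]) h0 (by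
        rw [Nat.add_sub_cancel, taylor_coeff_pred hf hd]
        field_simp
        ring)
    exact ⟨_, by rwa [taylor_eval] at ha⟩
  intro f hf hd h0 hpred
  by_cases hz : ∀ i < d, f.coeff i = 0
  · refine ⟨0, ?_⟩
    rw [← coeff_zero_eq_eval_zero]
    exact hz 0 h0
  push Not at hz
  obtain ⟨j, hj, hjne⟩ := hz
  -- The minimal slope of the Newton polygon. Scaling the roots by `x^(-s)` makes all coefficients
  -- integral and makes coefficient `i₀` a unit.
  obtain ⟨i₀, hi₀, hmin⟩ := Finset.exists_min_image ((Finset.range d).filter (f.coeff · ≠ 0))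
    (fun i => (f.coeff i).1.order / ((d - i : ℕ) : ℚ)) ⟨j, by simp [hj, hjne]⟩
  rw [Finset.mem_filter, Finset.mem_range] at hi₀
  set s : ℚ := (f.coeff i₀).1.order / ((d - i₀ : ℕ) : ℚ) with hs
  set f1 := scaleRoots f (mono (-s) 1) with hf1
  have hf1m : f1.Monic := (monic_scaleRoots_iff _).2 hf
  have hf1d : f1.natDegree = d := by rw [hf1, natDegree_scaleRoots, hd]
  have hcoeff : ∀ i, f1.coeff i = f.coeff i * mono (((d - i : ℕ) : ℚ) * -s) 1 := by
    intro i
    rw [hf1, coeff_scaleRoots, hd, mono_pow]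
  have hval : ∀ i q, (f1.coeff i).1.coeff q = (f.coeff i).1.coeff (q + ((d - i : ℕ) : ℚ) * s) := by
    intro i q
    rw [hcoeff]
    have := HahnSeries.coeff_mul_single_add (r := (1 : k)) (x := (f.coeff i).1)
      (a := q + ((d - i : ℕ) : ℚ) * s) (b := ((d - i : ℕ) : ℚ) * -s)
    rw [mul_one] at this
    rw [← this]
    congr 1
    ring
  have hpos : ∀ i, ∀ q < 0, (f1.coeff i).1.coeff q = 0 := by
    intro i q hq
    by_cases hid : i < d
    · by_cases hi : f.coeff i = 0
      · rw [hcoeff, hi, zero_mul]; rfl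
      rw [hval]
      apply HahnSeries.coeff_eq_zero_of_lt_order
      have := hmin i (by simp [hid, hi])
      have hdi : (0 : ℚ) < ((d - i : ℕ) : ℚ) := by
        exact_mod_cast Nat.sub_pos_of_lt hid
      rw [le_div_iff₀ hdi] at this
      linarith
    · rcases (not_lt.1 hid).eq_or_lt with rfl | hlt
      · have : f1.coeff d = 1 := by rw [← hf1d]; exact hf1m
        rw [this]
        exact HahnSeries.coeff_one.trans (if_neg hq.ne)
      · rw [coeff_eq_zero_of_natDegree_lt (by rwa [hf1d])]; rfl
  have hi₀ne : (f1.coeff i₀).1.coeff 0 ≠ 0 := by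
    have hdi : ((d - i₀ : ℕ) : ℚ) ≠ 0 := by
      exact_mod_cast (Nat.sub_pos_of_lt hi₀.1).ne'
    rw [hval, zero_add, hs, mul_div_cancel₀ _ hdi]
    exact HahnSeries.coeff_order_eq_zero.not.2 fun h => hi₀.2 (Subtype.ext h)
  obtain ⟨n, hn⟩ := exists_common_rootHom (f1.support.image f1.coeff)
  have hlift : f1 ∈ lifts (powerSeriesRoot (k := k) n) := by
    rw [lifts_iff_coeff_lifts]
    intro i
    by_cases hi : f1.coeff i = 0
    · exact ⟨0, by rw [hi, map_zero]⟩
    · exact exists_powerSeriesRoot (hn _ (Finset.mem_image_of_mem _ (mem_support_iff.2 hi)))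
        (hpos i)
  obtain ⟨f2, hf2, hf2d, hf2m⟩ := lifts_and_natDegree_eq_and_monic hlift hf1m
  rw [hf1d] at hf2d
  set fb := f2.map (PowerSeries.constantCoeff (R := k)) with hfb
  have hfbm : fb.Monic := hf2m.map _
  have hfbd : fb.natDegree = d := by rw [hfb, hf2m.natDegree_map, hf2d]
  have hfbc : ∀ i, fb.coeff i = (f1.coeff i).1.coeff 0 := by
    intro i
    rw [hfb, coeff_map, ← hf2, coeff_map, powerSeriesRoot_coeff_zero]
  obtain ⟨l, hl⟩ := IsAlgClosed.exists_root fb (by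
    rw [degree_eq_natDegree hfbm.ne_zero, hfbd]; exact_mod_cast h0.ne')
  set f3 := taylor (PowerSeries.C l) f2 with hf3
  have hf3m : f3.Monic := monic_taylor hf2m _
  have hf3d : f3.natDegree = d := by rw [hf3, natDegree_taylor, hf2d]
  have hf3b : f3.map (PowerSeries.constantCoeff (R := k)) = taylor l fb := by
    rw [hf3, map_taylor, hfb]; simp
  have hmem : ∀ i, f3.coeff i ∈ IsLocalRing.maximalIdeal (PowerSeries k) ↔
      (taylor l fb).coeff i = 0 := by
    intro i
    rw [← PowerSeries.ker_coeff_eq_max_ideal, RingHom.mem_ker, ← hf3b, coeff_map]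
  -- Otherwise the reduction is `(X - l)^d`. Its vanishing subleading coefficient forces `d l = 0`,
  -- so `l = 0`, against the nonzero coefficient at `i₀`.
  obtain ⟨i, hi, hine⟩ : ∃ i < f3.natDegree, f3.coeff i ∉ IsLocalRing.maximalIdeal _ := by
    by_contra hcon
    push Not at hcon
    simp only [hmem, hf3d] at hcon
    obtain ⟨e, rfl⟩ : ∃ e, d = e + 1 := ⟨d - 1, by omega⟩
    have h1 := hcon e (by omega)
    rw [taylor_coeff_pred hfbm hfbd, hfbc, hval, ] at h1
    rw [Nat.add_sub_cancel] at hpred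
    rw [hpred] at h1
    have h2 : l = 0 := by
      have : ((e + 1 : ℕ) : k) * l = 0 := by simpa using h1
      exact (mul_eq_zero.1 this).resolve_left (Nat.cast_ne_zero.2 e.succ_ne_zero)
    have h3 := hcon i₀ hi₀.1
    rw [h2, taylor_zero, hfbc] at h3
    exact hi₀ne h3
  have hc0 : f3.coeff 0 ∈ IsLocalRing.maximalIdeal (PowerSeries k) := by
    rw [hmem, taylor_coeff_zero]; exact hl
  obtain ⟨g, hgm, hg0, hgd, hdvd⟩ := exists_monic_dvd_of_residue f3 hc0 hi hine
  obtain ⟨b, hb⟩ := ih g.natDegree (hf3d ▸ hgd) (g.map (powerSeriesRoot n)) (hgm.map _)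
    (hgm.natDegree_map _) hg0
  obtain ⟨h, hgh⟩ := hdvd
  have hb3 : (f3.map (powerSeriesRoot n)).eval b = 0 := by
    rw [hgh, Polynomial.map_mul, eval_mul, hb, zero_mul]
  rw [hf3, map_taylor, hf2, taylor_eval] at hb3
  have hb4 := scaleRoots_eval₂_eq_zero (f := RingHom.id _) (s := mono s (1 : k)) hb3
  rw [hf1, ← scaleRoots_mul, mono_mul] at hb4
  simp only [neg_add_cancel, mul_one, mono_zero_one, scaleRoots_one] at hb4
  exact ⟨_, hb4⟩

instance [IsAlgClosed k] [CharZero k] : IsAlgClosed (Puiseux k) := by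
  refine IsAlgClosed.of_exists_root _ fun p hp hirr => ?_
  obtain ⟨a, ha⟩ := exists_root_of_monic _ p hp rfl hirr.natDegree_pos
  exact ⟨a, ha⟩

end NewtonPuiseux

/-! ### Points and topology of the Berkovich line -/

section BerkovichLine

variable {k : Type*} [Field k]

theorem BerkA1.nonneg (ξ : BerkA1 k) (f : (Puiseux k)[X]) : 0 ≤ ξ.1 f := apply_nonneg ξ.1 f

theorem BerkA1.linear_le (ξ : BerkA1 k) (a c : Puiseux k) :
    ξ.1 (X - C c) ≤ max (ξ.1 (X - C a)) (puiseuxAbs k (a - c)) := by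
  have h := ξ.2.1 (X - C a) (C (a - c))
  rw [ξ.2.2] at h
  rwa [show X - C a + C (a - c) = X - C c by rw [C_sub]; ring] at h

theorem BerkA1.linear_eq (ξ : BerkA1 k) {a c : Puiseux k}
    (h : ξ.1 (X - C a) < puiseuxAbs k (a - c)) : ξ.1 (X - C c) = puiseuxAbs k (a - c) := by
  refine le_antisymm ((ξ.linear_le a c).trans (max_le h.le le_rfl)) ?_
  have h2 := ξ.2.1 (X - C c) (-(X - C a))
  rw [map_neg_eq_map, show X - C c + -(X - C a) = C (a - c) by rw [C_sub]; ring, ξ.2.2] at h2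
  rcases le_max_iff.1 h2 with h3 | h3
  · exact h3
  · exact absurd h3 (not_le.2 h)

theorem zetaA_linear (a : Puiseux k) (r : ℝ) (c : Puiseux k) :
    (zetaA a r).1 (X - C c) = max (Real.exp (-r)) (puiseuxAbs k (a - c)) := by
  have h0 : taylor a (X - C c) = X + C (a - c) := by
    rw [map_sub, taylor_X, taylor_C, C_sub]; ring
  change (taylor a (X - C c)).gaussNorm (puiseuxAbs k) (Real.exp (-r)) = _
  rw [h0]
  have hp := (Real.exp_pos (-r)).le
  have hX : (X : (Puiseux k)[X]).gaussNorm (puiseuxAbs k) (Real.exp (-r)) = Real.exp (-r) := by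
    rw [← monomial_one_one_eq_X, gaussNorm_monomial]; simp
  apply le_antisymm
  · refine (isNonarchimedean_gaussNorm (puiseuxAbs k) (puiseuxAbs_nonarch k) hp _ _).trans ?_
    rw [gaussNorm_C, hX]
  · apply max_le
    · have h := le_gaussNorm (puiseuxAbs k) (X + C (a - c)) hp 1
      rwa [coeff_add, coeff_X_one, coeff_C_of_ne_zero one_ne_zero, add_zero, map_one, one_mul,
        pow_one] at h
    · have h := le_gaussNorm (puiseuxAbs k) (X + C (a - c)) hp 0
      rwa [coeff_add, coeff_X_zero, coeff_C_zero, zero_add, pow_zero, mul_one] at h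

theorem zetaA_inj {a b : Puiseux k} {r s : ℝ} (h : zetaA a r = zetaA b s) :
    r = s ∧ puiseuxAbs k (a - b) ≤ Real.exp (-r) := by
  have h1 := zetaA_linear a r a
  rw [h, zetaA_linear] at h1
  have h2 := zetaA_linear a r b
  rw [h, zetaA_linear] at h2
  simp only [sub_self, map_zero] at h1 h2
  rw [max_eq_left (Real.exp_pos _).le] at h1 h2
  have h3 : Real.exp (-s) = Real.exp (-r) :=
    le_antisymm ((le_max_left _ _).trans_eq h1) ((le_max_left _ _).trans_eq h2.symm)
  refine ⟨by simpa using h3.symm, ?_⟩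
  rw [← h3, h2]
  exact le_max_right _ _

variable [IsAlgClosed k] [CharZero k]

theorem BerkA1.apply_eq_prod (ξ : BerkA1 k) (f : (Puiseux k)[X]) :
    ξ.1 f = puiseuxAbs k f.leadingCoeff * (f.roots.map fun c => ξ.1 (X - C c)).prod := by
  conv_lhs => rw [(IsAlgClosed.splits f).eq_prod_roots]
  rw [map_mul, ξ.2.2, map_multiset_prod, Multiset.map_map]
  rfl

/-- Every polynomial over the Puiseux field splits, and the seminorms are multiplicative. Later
identities between points are therefore checked only on linear polynomials. -/
theorem BerkA1.ext_linear {ξ η : BerkA1 k} (h : ∀ c, ξ.1 (X - C c) = η.1 (X - C c)) : ξ = η := by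
  refine Subtype.ext (DFunLike.ext _ _ fun f => ?_)
  rw [ξ.apply_eq_prod, η.apply_eq_prod]
  simp only [h]

theorem zetaA_eq {a b : Puiseux k} {r : ℝ} (h : puiseuxAbs k (a - b) ≤ Real.exp (-r)) :
    zetaA a r = zetaA b r := by
  refine BerkA1.ext_linear fun c => ?_
  have key : ∀ a b : Puiseux k, puiseuxAbs k (a - b) ≤ Real.exp (-r) →
      (zetaA a r).1 (X - C c) ≤ (zetaA b r).1 (X - C c) := by
    intro a b h
    rw [zetaA_linear, zetaA_linear]
    refine max_le (le_max_left _ _) ?_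
    have := puiseuxAbs_nonarch k (a - b) (b - c)
    rw [sub_add_sub_cancel] at this
    exact this.trans (max_le_max_right _ h)
  exact le_antisymm (key a b h) (key b a (by rwa [(puiseuxAbs k).map_sub]))

theorem BerkA1.le_zetaA {ξ : BerkA1 k} {a : Puiseux k} {r : ℝ}
    (h : ξ.1 (X - C a) ≤ Real.exp (-r)) (f : (Puiseux k)[X]) : ξ.1 f ≤ (zetaA a r).1 f := by
  rw [ξ.apply_eq_prod, (zetaA a r).apply_eq_prod]
  refine mul_le_mul_of_nonneg_left ?_ ((puiseuxAbs k).nonneg _)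
  refine Multiset.prod_map_le_prod_map₀ _ _ (fun c _ => ξ.nonneg _) fun c _ => ?_
  rw [zetaA_linear]
  exact (ξ.linear_le a c).trans (max_le_max_right _ h)

/-- If no residue disk contained `ξ`, the ultrametric inequality would determine `ξ` on every linear
polynomial, and it would be the Gauss point of the closed disk. -/
theorem BerkA1.exists_linear_lt {ξ : BerkA1 k} {a : Puiseux k} {r : ℝ}
    (h : ξ.1 (X - C a) ≤ Real.exp (-r)) (hne : ξ ≠ zetaA a r) :
    ∃ c, ξ.1 (X - C c) < Real.exp (-r) := by
  by_contra! hcon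
  refine hne (BerkA1.ext_linear fun c => ?_)
  rw [zetaA_linear]
  rcases le_or_gt (puiseuxAbs k (a - c)) (Real.exp (-r)) with hc | hc
  · rw [max_eq_left hc]
    exact le_antisymm ((ξ.linear_le a c).trans (max_le h hc)) (hcon c)
  · rw [max_eq_right hc.le]
    exact ξ.linear_eq (h.trans_lt hc)

/-! ### Topology -/

omit [IsAlgClosed k] [CharZero k] in
theorem continuous_eval_point (f : (Puiseux k)[X]) : Continuous fun ξ : BerkA1 k => ξ.1 f :=
  (continuous_apply f).comp continuous_induced_dom

/-- Tychonoff: on the disk each value `ξ(f)` lies between zero and the Gauss norm of `f`, and the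
seminorm axioms are closed conditions in the product. -/
theorem isCompact_closedDisk (a : Puiseux k) (r : ℝ) :
    IsCompact {ξ : BerkA1 k | ξ.1 (X - C a) ≤ Real.exp (-r)} := by
  have hind : IsInducing fun (ζ : BerkA1 k) (f : (Puiseux k)[X]) => ζ.1 f := ⟨rfl⟩
  rw [hind.isCompact_iff]
  have hbox : IsCompact (Set.pi Set.univ fun f : (Puiseux k)[X] =>
      Set.Icc 0 ((zetaA a r).1 f)) := isCompact_univ_pi fun f => isCompact_Icc
  refine hbox.of_isClosed_subset ?_ ?_
  · have himg : (fun (ζ : BerkA1 k) (f : (Puiseux k)[X]) => ζ.1 f) ''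
        {ξ | ξ.1 (X - C a) ≤ Real.exp (-r)} =
        {φ | (∀ f g, φ (f * g) = φ f * φ g) ∧ (∀ f g, φ (f + g) ≤ max (φ f) (φ g)) ∧
          (∀ f, φ (-f) = φ f) ∧ (∀ f, 0 ≤ φ f) ∧ (∀ c, φ (C c) = puiseuxAbs k c) ∧
          φ (X - C a) ≤ Real.exp (-r)} := by
      ext φ
      constructor
      · rintro ⟨ξ, hξ, rfl⟩
        exact ⟨fun f g => map_mul ξ.1 f g, ξ.2.1, fun f => map_neg_eq_map ξ.1 f, ξ.nonneg, ξ.2.2, hξ⟩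
      · rintro ⟨h1, h2, h3, h4, h5, h6⟩
        have h0 : φ 0 = 0 := by
          have := h5 0
          simpa using this
        have h7 : φ 1 = 1 := by
          have := h5 1
          simpa using this
        refine ⟨⟨{ toFun := φ, map_zero' := h0, add_le' := ?_, neg' := h3, map_one' := h7,
                   map_mul' := h1 }, h2, h5⟩, h6, rfl⟩
        intro f g
        refine (h2 f g).trans (max_le ?_ ?_)
        · linarith [h4 g]
        · linarith [h4 f]
    rw [himg]
    simp only [Set.ofPred_and, Set.ofPred_forall]
    refine IsClosed.inter ?_ (IsClosed.inter ?_ (IsClosed.inter ?_ (IsClosed.inter ?_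
      (IsClosed.inter ?_ ?_))))
    · exact isClosed_iInter fun f => isClosed_iInter fun g =>
        isClosed_eq (continuous_apply _) ((continuous_apply f).mul (continuous_apply g))
    · exact isClosed_iInter fun f => isClosed_iInter fun g =>
        isClosed_le (continuous_apply _) ((continuous_apply f).max (continuous_apply g))
    · exact isClosed_iInter fun f => isClosed_eq (continuous_apply _) (continuous_apply _)
    · exact isClosed_iInter fun f => isClosed_le continuous_const (continuous_apply _)
    · exact isClosed_iInter fun f => isClosed_eq (continuous_apply _) continuous_const
    · exact isClosed_le (continuous_apply _) continuous_const
  · rintro _ ⟨ξ, hξ, rfl⟩ f -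
    exact ⟨ξ.nonneg f, BerkA1.le_zetaA hξ f⟩

/-- The open disk of radius `|x|^r` about `a`, as a subset of the projective line. -/
def disk (a : Puiseux k) (r : ℝ) : Set (BerkP1 k) :=
  (↑) '' {ξ : BerkA1 k | ξ.1 (X - C a) < Real.exp (-r)}

omit [IsAlgClosed k] [CharZero k] in
@[simp] theorem coe_mem_disk {a : Puiseux k} {r : ℝ} {ξ : BerkA1 k} :
    (ξ : BerkP1 k) ∈ disk a r ↔ ξ.1 (X - C a) < Real.exp (-r) := by
  simp [disk]

omit [IsAlgClosed k] [CharZero k] in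
@[simp] theorem infty_notMem_disk {a : Puiseux k} {r : ℝ} :
    (OnePoint.infty : BerkP1 k) ∉ disk a r := by
  simp [disk]

omit [IsAlgClosed k] [CharZero k] in
theorem isOpen_disk (a : Puiseux k) (r : ℝ) : IsOpen (disk a r) :=
  OnePoint.isOpen_image_coe.2 (isOpen_lt (continuous_eval_point _) continuous_const)

omit [IsAlgClosed k] [CharZero k] in
theorem zetaA_notMem_disk (a : Puiseux k) (r : ℝ) : (zetaA a r : BerkP1 k) ∉ disk a r := by
  rw [coe_mem_disk, zetaA_linear]
  exact not_lt.2 (le_max_left _ _)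

/-- A point of the complement is either outside the closed disk or in another residue disk, and both
regions are open. Closedness in the one-point compactification also needs compactness, inherited
from the closed disk. With `isOpen_disk`, this says that `ζ(a, |x|^r)` cuts the open disk off from
the rest of the line; all later connectedness arguments rest on it. -/
theorem isClosed_insert_disk (a : Puiseux k) (r : ℝ) :
    IsClosed (insert (zetaA a r : BerkP1 k) (disk a r)) := by
  rw [disk, ← Set.image_insert_eq, OnePoint.isClosed_image_coe]
  have hcl : IsClosed (insert (zetaA a r) {ξ : BerkA1 k | ξ.1 (X - C a) < Real.exp (-r)}) := by
    rw [← isOpen_compl_iff, isOpen_iff_mem_nhds]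
    intro ξ hξ
    simp only [Set.mem_compl_iff, Set.mem_insert_iff, Set.mem_ofPred_eq, not_or, not_lt] at hξ
    rcases hξ.2.lt_or_eq with hlt | heq
    · refine Filter.mem_of_superset
        ((isOpen_lt continuous_const (continuous_eval_point (X - C a))).mem_nhds hlt) ?_
      intro η hη
      simp only [Set.mem_ofPred_eq] at hη
      simp only [Set.mem_compl_iff, Set.mem_insert_iff, Set.mem_ofPred_eq, not_or, not_lt]
      refine ⟨?_, hη.le⟩
      rintro rfl
      rw [zetaA_linear, sub_self, map_zero, max_eq_left (Real.exp_pos _).le] at hη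
      exact lt_irrefl _ hη
    · obtain ⟨c, hc⟩ := BerkA1.exists_linear_lt heq.symm.le hξ.1
      refine Filter.mem_of_superset
        ((isOpen_lt (continuous_eval_point (X - C c)) continuous_const).mem_nhds hc) ?_
      intro η hη
      simp only [Set.mem_ofPred_eq] at hη
      simp only [Set.mem_compl_iff, Set.mem_insert_iff, Set.mem_ofPred_eq, not_or, not_lt]
      constructor
      · rintro rfl
        rw [zetaA_linear] at hη
        exact absurd hη (not_lt.2 (le_max_left _ _))
      · have hca : Real.exp (-r) ≤ puiseuxAbs k (c - a) := by
          have := ξ.linear_le c a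
          rw [← heq] at this
          exact (le_max_iff.1 this).resolve_left (not_le.2 hc)
        rw [η.linear_eq (hη.trans_le hca)]
        exact hca
  refine ⟨hcl, (isCompact_closedDisk a r).of_isClosed_subset hcl ?_⟩
  rintro ξ (rfl | hξ)
  · simp only [Set.mem_ofPred_eq]
    rw [zetaA_linear, sub_self, map_zero, max_eq_left (Real.exp_pos _).le]
  · exact (show ξ.1 (X - C a) < Real.exp (-r) from hξ).le

theorem continuous_zetaA (a : Puiseux k) : Continuous fun r : ℝ => zetaA a r := by
  rw [continuous_induced_rng, continuous_pi_iff]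
  intro f
  have h : ∀ r : ℝ, (zetaA a r).1 f = puiseuxAbs k f.leadingCoeff *
      (f.roots.map fun c => max (Real.exp (-r)) (puiseuxAbs k (a - c))).prod := by
    intro r
    rw [(zetaA a r).apply_eq_prod]
    simp only [zetaA_linear]
  refine (continuous_congr h).2 (continuous_const.mul ?_)
  exact continuous_multiset_prod _ fun c _ => by fun_prop

omit [IsAlgClosed k] [CharZero k] in
theorem tendsto_zetaA_atBot (a : Puiseux k) :
    Filter.Tendsto (fun r : ℝ => (zetaA a r : BerkP1 k)) Filter.atBot (𝓝 OnePoint.infty) := by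
  refine OnePoint.tendsto_coe_infty.comp
    (Filter.hasBasis_coclosedCompact.tendsto_right_iff.2 fun s hs => ?_)
  obtain ⟨B, hB⟩ := hs.2.bddAbove_image (continuous_eval_point (X - C a)).continuousOn
  have h1 : Filter.Tendsto (fun r : ℝ => Real.exp (-r)) Filter.atBot Filter.atTop :=
    Real.tendsto_exp_atTop.comp Filter.tendsto_neg_atBot_atTop
  filter_upwards [h1.eventually_gt_atTop B] with r hr hmem
  have h2 := hB ⟨_, hmem, rfl⟩
  simp only [zetaA_linear, sub_self, map_zero] at h2
  exact absurd ((le_max_left _ _).trans h2) (not_le.2 hr)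

end BerkovichLine

/-! ### Separation and paths -/

section Intervals

variable {k : Type*} [Field k]

/-- A path missing `ξ` would pull `D` back to a clopen subset of the unit interval containing
exactly one of the two endpoints. -/
theorem mem_closedInterval_of_sep {D : Set (BerkP1 k)} {α β ξ : BerkP1 k} (hD : IsOpen D)
    (hc : IsClosed (insert ξ D)) (hα : α ∈ D) (hβ : β ∉ D) : ξ ∈ closedInterval α β := by
  intro p
  by_contra hξ
  have h1 : p ⁻¹' D = p ⁻¹' (insert ξ D) := by
    ext t
    simp only [Set.mem_preimage, Set.mem_insert_iff]
    exact ⟨Or.inr, fun h => h.resolve_left fun h => hξ ⟨t, h⟩⟩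
  have h2 : IsClopen (p ⁻¹' D) :=
    ⟨by rw [h1]; exact hc.preimage p.continuous, hD.preimage p.continuous⟩
  rcases isClopen_iff.1 h2 with h | h
  · have : (0 : unitInterval) ∈ p ⁻¹' D := by simpa using hα
    rw [h] at this
    exact this
  · have : (1 : unitInterval) ∈ p ⁻¹' D := by rw [h]; trivial
    exact hβ (by simpa using this)

theorem subset_or_disjoint_of_sep {D U : Set (BerkP1 k)} {ξ : BerkP1 k} (hD : IsOpen D)
    (hc : IsClosed (insert ξ D)) (hU : IsPreconnected U) (hξ : ξ ∉ U) : U ⊆ D ∨ Disjoint U D := by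
  have h := isPreconnected_iff_subset_of_disjoint.1 hU D (insert ξ D)ᶜ hD hc.isOpen_compl
    (fun x hx => by
      by_cases h : x ∈ D
      · exact Or.inl h
      · refine Or.inr fun h' => ?_
        rcases h' with rfl | h'
        · exact hξ hx
        · exact h h')
    (by
      rw [Set.eq_empty_iff_forall_notMem]
      rintro x ⟨-, h1, h2⟩
      exact h2 (Or.inr h1))
  refine h.imp id fun h => Set.disjoint_left.2 fun x hx hxD => h hx (Or.inr hxD)

/-- The analogue of the path statement for a connected set that merely accumulates at the two
points. It is applied with `α`, `β` on the boundary of a domain. -/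
theorem mem_of_sep {D U : Set (BerkP1 k)} {α β ξ : BerkP1 k} (hD : IsOpen D)
    (hc : IsClosed (insert ξ D)) (hU : IsPreconnected U) (hα : α ∈ D) (hβ : β ∉ insert ξ D)
    (hα' : α ∈ closure U) (hβ' : β ∈ closure U) : ξ ∈ U := by
  by_contra hξ
  rcases subset_or_disjoint_of_sep hD hc hU hξ with h | h
  · exact hβ (closure_minimal (h.trans (Set.subset_insert _ _)) hc hβ')
  · obtain ⟨x, hx1, hx2⟩ := mem_closure_iff.1 hα' D hD hα
    exact Set.disjoint_left.1 h hx2 hx1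

theorem closedInterval_symm (α β : BerkP1 k) : closedInterval α β = closedInterval β α := by
  have key : ∀ α β : BerkP1 k, closedInterval α β ⊆ closedInterval β α := by
    intro α β ξ h p
    have := h p.symm
    rwa [Path.symm_range] at this
  exact (key α β).antisymm (key β α)

theorem openInterval_symm (α β : BerkP1 k) : openInterval α β = openInterval β α := by
  rw [openInterval, openInterval, closedInterval_symm, Set.pair_comm]

variable [IsAlgClosed k] [CharZero k]

/-- Since the interval is an intersection over all paths, one explicit path, varying the radius
about `a`, bounds it from above. -/
theorem closedInterval_subset (a : Puiseux k) {r s : ℝ} (h : s ≤ r) {ξ : BerkP1 k}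
    (hξ : ξ ∈ closedInterval (zetaA a r : BerkP1 k) (zetaA a s : BerkP1 k)) :
    ∃ t, s ≤ t ∧ t ≤ r ∧ ξ = (zetaA a t : BerkP1 k) := by
  let p : Path (zetaA a r : BerkP1 k) (zetaA a s : BerkP1 k) :=
    { toFun := fun u => (zetaA a (r + u * (s - r)) : BerkP1 k)
      continuous_toFun := OnePoint.continuous_coe.comp
        ((continuous_zetaA a).comp (by fun_prop))
      source' := by simp
      target' := by simp }
  obtain ⟨u, hu⟩ := hξ p
  refine ⟨r + u * (s - r), ?_, ?_, hu.symm⟩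
  · nlinarith [u.2.1, u.2.2]
  · nlinarith [u.2.1, u.2.2]

theorem closedInterval_infty_subset (a : Puiseux k) (r : ℝ) {ξ : BerkP1 k}
    (hξ : ξ ∈ closedInterval (zetaA a r : BerkP1 k) OnePoint.infty) (hne : ξ ≠ OnePoint.infty) :
    ∃ t, t ≤ r ∧ ξ = (zetaA a t : BerkP1 k) := by
  -- The exponent equals `r` at `u = 0` and tends to `-∞` as `u` tends to `1`, where the path is
  -- completed by `∞`.
  let g : unitInterval → BerkP1 k := fun u => (zetaA a (r + 1 - (1 - (u : ℝ))⁻¹) : BerkA1 k)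
  have hg : Continuous (Function.update g 1 OnePoint.infty) := by
    rw [continuous_iff_continuousAt]
    intro u
    by_cases hu : u = 1
    · subst hu
      rw [continuousAt_update_same]
      refine (tendsto_zetaA_atBot a).comp ?_
      have h1 : Filter.Tendsto (fun u : unitInterval => 1 - (u : ℝ)) (𝓝[≠] 1) (𝓝[>] 0) := by
        refine tendsto_nhdsWithin_iff.2 ⟨?_, ?_⟩
        · have : Continuous fun u : unitInterval => 1 - (u : ℝ) := by fun_prop
          have h2 := (this.tendsto 1).mono_left (nhdsWithin_le_nhds (s := {1}ᶜ))
          simpa using h2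
        · filter_upwards [self_mem_nhdsWithin] with u hu
          have : (u : ℝ) ≠ 1 := fun h => hu (Subtype.ext h)
          exact sub_pos.2 (lt_of_le_of_ne u.2.2 this)
      exact Filter.tendsto_atBot_add_const_left _ _
        (Filter.tendsto_neg_atTop_atBot.comp h1.inv_tendsto_nhdsGT_zero)
    · rw [continuousAt_update_of_ne hu]
      have hne : 1 - (u : ℝ) ≠ 0 := fun h => hu (Subtype.ext (sub_eq_zero.1 h).symm)
      refine ContinuousAt.comp (OnePoint.continuous_coe.continuousAt)
        ((continuous_zetaA a).continuousAt.comp ?_)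
      exact continuousAt_const.sub
        ((continuousAt_const.sub continuous_subtype_val.continuousAt).inv₀ hne)
  let p : Path (zetaA a r : BerkP1 k) (OnePoint.infty : BerkP1 k) :=
    { toFun := Function.update g 1 OnePoint.infty
      continuous_toFun := hg
      source' := by
        rw [Function.update_of_ne zero_ne_one]
        simp [g]
      target' := Function.update_self _ _ _ }
  obtain ⟨u, hu⟩ := hξ p
  have hu1 : u ≠ 1 := by
    rintro rfl
    have h1 : p 1 = OnePoint.infty := p.target
    exact hne (hu.symm.trans h1)
  have hu2 : g u = ξ := (Function.update_of_ne hu1 _ _).symm.trans hu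
  refine ⟨_, ?_, hu2.symm⟩
  have hpos : 0 < 1 - (u : ℝ) :=
    sub_pos.2 (lt_of_le_of_ne u.2.2 fun h => hu1 (Subtype.ext h))
  have : 1 ≤ (1 - (u : ℝ))⁻¹ := one_le_inv_iff₀.2 ⟨hpos, by linarith [u.2.1]⟩
  linarith

end Intervals

/-! ### The Galois action and multiplicities -/

section Galois

/-- The character `q ↦ exp(2πiq)` takes values in the roots of unity, hence in the algebraic closure
of `ℚ` in `ℂ`, and this field embeds in `k`. -/
theorem exists_addChar_rat (k : Type*) [Field k] [IsAlgClosed k] [CharZero k] :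
    ∃ χ : AddChar ℚ k, ∀ q : ℚ, χ q = 1 ↔ ∃ m : ℤ, q = m := by
  let e : ℚ → ℂ := fun q => Complex.exp (2 * Real.pi * Complex.I * q)
  have he0 : e 0 = 1 := by simp [e]
  have headd : ∀ p q, e (p + q) = e p * e q := by
    intro p q
    simp only [e]
    rw [← Complex.exp_add]
    congr 1
    push_cast
    ring
  have he1 : ∀ q, e q = 1 ↔ ∃ m : ℤ, q = m := by
    intro q
    have hpi : (2 * Real.pi * Complex.I : ℂ) ≠ 0 := Complex.two_pi_I_ne_zero
    simp only [e]
    rw [Complex.exp_eq_one_iff]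
    refine exists_congr fun m => ?_
    rw [mul_comm (m : ℂ), mul_right_inj' hpi]
    exact_mod_cast Iff.rfl
  have hepow : ∀ (n : ℕ) q, e (n * q) = e q ^ n := by
    intro n q
    induction n with
    | zero => simp [he0]
    | succ n ih =>
      rw [pow_succ, ← ih, ← headd]
      congr 1
      push_cast
      ring
  have halg : ∀ q, e q ∈ algebraicClosure ℚ ℂ := by
    intro q
    rw [mem_algebraicClosure_iff]
    refine IsIntegral.isAlgebraic (IsIntegral.of_pow q.den_pos (x := e q) ?_)
    rw [← hepow, (he1 _).2 ⟨q.num, by rw [mul_comm]; exact Rat.mul_den_eq_num q⟩]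
    exact isIntegral_one
  -- The two `ℚ`-algebra structures on this field are identified before transferring algebraicity.
  have : Algebra.IsAlgebraic ℚ (algebraicClosure ℚ ℂ) := by
    have h : (algebraicClosure ℚ ℂ).algebra' = (DivisionRing.toRatAlgebra :
      Algebra ℚ (algebraicClosure ℚ ℂ)) := Subsingleton.elim _ _
    have h2 := algebraicClosure.isAlgebraic ℚ ℂ
    rw [h] at h2
    exact h2
  let φ : algebraicClosure ℚ ℂ →ₐ[ℚ] k := IsAlgClosed.lift
  refine ⟨⟨fun q => φ ⟨e q, halg q⟩, ?_, ?_⟩, fun q => ?_⟩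
  · rw [← map_one φ]
    congr 1
    exact Subtype.ext he0
  · intro p q
    rw [← map_mul]
    congr 1
    exact Subtype.ext (headd p q)
  · change φ ⟨e q, halg q⟩ = 1 ↔ _
    rw [← he1, ← map_one φ]
    exact ⟨fun h => congrArg Subtype.val (φ.toRingHom.injective h),
      fun h => congrArg φ (Subtype.ext h)⟩

variable {k : Type*} [Field k]

/-- The series obtained by multiplying the coefficient of `x^q` by `χ q`. -/
def twistFun (χ : AddChar ℚ k) (f : HahnSeries ℚ k) : HahnSeries ℚ k :=
  ⟨fun q => χ q * f.coeff q, f.isPWO_support.mono fun q hq => by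
    simp only [Function.mem_support] at hq
    exact right_ne_zero_of_mul hq⟩

theorem addChar_ne_zero (χ : AddChar ℚ k) (q : ℚ) : χ q ≠ 0 := by
  intro h
  have h1 := χ.map_add_eq_mul q (-q)
  rw [h, zero_mul, add_neg_cancel, χ.map_zero_eq_one] at h1
  exact one_ne_zero h1

theorem twistFun_support (χ : AddChar ℚ k) (f : HahnSeries ℚ k) :
    (twistFun χ f).support = f.support := by
  ext q
  simp [twistFun, addChar_ne_zero]

/-- The ring endomorphism of `𝕂` multiplying the coefficient of `x^q` by `χ q`. -/
def twist (χ : AddChar ℚ k) : Puiseux k →+* Puiseux k where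
  toFun a := ⟨twistFun χ a.1, by
    obtain ⟨n, hn⟩ := a.2
    exact ⟨n, by rwa [twistFun_support]⟩⟩
  map_zero' := Subtype.ext (by ext q; exact mul_zero _)
  map_one' := Subtype.ext (by
    ext q
    change χ q * (1 : HahnSeries ℚ k).coeff q = (1 : HahnSeries ℚ k).coeff q
    rw [HahnSeries.coeff_one]
    split_ifs with h
    · rw [h, χ.map_zero_eq_one, mul_one]
    · rw [mul_zero])
  map_add' a b := Subtype.ext (by ext q; exact mul_add _ _ _)
  map_mul' a b := Subtype.ext (by
    ext q
    change χ q * (a.1 * b.1).coeff q = (twistFun χ a.1 * twistFun χ b.1).coeff q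
    rw [HahnSeries.coeff_mul, HahnSeries.coeff_mul, Finset.mul_sum]
    refine Finset.sum_congr ?_ ?_
    · ext ij
      simp only [Finset.mem_antidiagonal, twistFun_support]
    · intro ij hij
      rw [Finset.mem_antidiagonal] at hij
      change _ = χ ij.1 * a.1.coeff ij.1 * (χ ij.2 * b.1.coeff ij.2)
      rw [← hij.2.2, χ.map_add_eq_mul]
      ring)

theorem exists_int_of_algebraMap (f : LaurentSeries k) {q : ℚ}
    (hq : (algebraMap (LaurentSeries k) (Puiseux k) f).1.coeff q ≠ 0) : ∃ m : ℤ, q = m := by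
  have h : (algebraMap (LaurentSeries k) (Puiseux k) f).1 ∈ (rootHom k 0).fieldRange := ⟨f, rfl⟩
  obtain ⟨m, hm⟩ := (mem_range_rootHom k 0 _).1 h q hq
  exact ⟨m, by simpa using hm⟩

theorem exists_algebraMap_eq {a : Puiseux k} (h : ∀ q, a.1.coeff q ≠ 0 → ∃ m : ℤ, q = m) :
    ∃ f : LaurentSeries k, algebraMap (LaurentSeries k) (Puiseux k) f = a := by
  have : a.1 ∈ (rootHom k 0).fieldRange := (mem_range_rootHom k 0 _).2 fun q hq => by
    obtain ⟨m, hm⟩ := h q hq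
    exact ⟨m, by simpa using hm⟩
  obtain ⟨f, hf⟩ := this
  exact ⟨f, Subtype.ext hf⟩

variable [IsAlgClosed k] [CharZero k]

variable (k) in
/-- A character of `ℚ` with kernel `ℤ`. -/
def chi : AddChar ℚ k := (exists_addChar_rat k).choose

theorem chi_eq_one_iff (q : ℚ) : chi k q = 1 ↔ ∃ m : ℤ, q = m :=
  (exists_addChar_rat k).choose_spec q

variable (k) in
/-- The topological generator of the Galois group of `𝕂` over `k((x))` given by `chi`. -/
def sigma : Puiseux k ≃ₐ[LaurentSeries k] Puiseux k :=
  AlgEquiv.ofRingEquiv (f := RingEquiv.ofRingHom (twist (chi k)) (twist (chi k)⁻¹)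
    (by
      refine RingHom.ext fun a => Subtype.ext ?_
      ext q
      change chi k q * ((chi k)⁻¹ q * a.1.coeff q) = a.1.coeff q
      rw [AddChar.inv_apply, ← mul_assoc, ← AddChar.map_add_eq_mul, add_neg_cancel,
        AddChar.map_zero_eq_one, one_mul])
    (by
      refine RingHom.ext fun a => Subtype.ext ?_
      ext q
      change (chi k)⁻¹ q * (chi k q * a.1.coeff q) = a.1.coeff q
      rw [AddChar.inv_apply, ← mul_assoc, ← AddChar.map_add_eq_mul, neg_add_cancel,
        AddChar.map_zero_eq_one, one_mul])) (by
    intro f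
    refine Subtype.ext ?_
    ext q
    change chi k q * (algebraMap (LaurentSeries k) (Puiseux k) f).1.coeff q = _
    by_cases h : (algebraMap (LaurentSeries k) (Puiseux k) f).1.coeff q = 0
    · rw [h, mul_zero]
    · rw [(chi_eq_one_iff q).2 (exists_int_of_algebraMap f h), one_mul])

theorem sigma_coeff (a : Puiseux k) (q : ℚ) :
    (sigma k a).1.coeff q = chi k q * a.1.coeff q := rfl

theorem sigma_pow_coeff (j : ℕ) (a : Puiseux k) (q : ℚ) :
    ((sigma k ^ j) a).1.coeff q = chi k (j * q) * a.1.coeff q := by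
  induction j with
  | zero => simp
  | succ j ih =>
    rw [pow_succ', AlgEquiv.mul_apply, sigma_coeff, ih, ← mul_assoc, ← AddChar.map_add_eq_mul]
    congr 2
    push_cast
    ring

theorem sigma_pow_coeff_eq_zero_iff (j : ℕ) (a : Puiseux k) (q : ℚ) :
    ((sigma k ^ j) a).1.coeff q = 0 ↔ a.1.coeff q = 0 := by
  rw [sigma_pow_coeff, mul_eq_zero, or_iff_right (addChar_ne_zero _ _)]

theorem sigma_pow_eq_iterate (j : ℕ) (a : Puiseux k) : (sigma k ^ j) a = (sigma k)^[j] a := by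
  induction j with
  | zero => rfl
  | succ j ih => rw [pow_succ', AlgEquiv.mul_apply, ih, Function.iterate_succ_apply']

/-- The size of the Galois orbit of `a`. -/
def per (a : Puiseux k) : ℕ := Function.minimalPeriod (sigma k) a

theorem sigma_pow_eq_self_iff (a : Puiseux k) (j : ℕ) : (sigma k ^ j) a = a ↔ per a ∣ j := by
  rw [sigma_pow_eq_iterate]
  exact Function.isPeriodicPt_iff_minimalPeriod_dvd

/-- The power `σ^j` multiplies the coefficient of `x^q` by `χ(jq)`, which is `1` exactly when `jq`
is an integer. Thus `per a` is the least common denominator of the exponents of `a`. -/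
theorem per_dvd_iff (a : Puiseux k) (j : ℕ) :
    per a ∣ j ↔ ∀ q, a.1.coeff q ≠ 0 → ∃ m : ℤ, (j : ℚ) * q = m := by
  rw [← sigma_pow_eq_self_iff]
  constructor
  · intro h q hq
    rw [← chi_eq_one_iff (k := k)]
    have h1 := sigma_pow_coeff j a q
    rw [h] at h1
    exact mul_right_cancel₀ hq (by rw [one_mul]; exact h1.symm)
  · intro h
    refine Subtype.ext ?_
    ext q
    rw [sigma_pow_coeff]
    by_cases hq : a.1.coeff q = 0
    · rw [hq, mul_zero]
    · rw [(chi_eq_one_iff _).2 (h q hq), one_mul]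

theorem per_pos (a : Puiseux k) : 0 < per a := by
  obtain ⟨n, hn⟩ := a.2
  refine Nat.pos_of_dvd_of_pos ((per_dvd_iff a (n + 1)).2 fun q hq => ?_) n.succ_pos
  obtain ⟨m, rfl⟩ := hn q hq
  refine ⟨m, ?_⟩
  have : ((n : ℚ) + 1) ≠ 0 := by positivity
  push_cast
  field_simp

theorem puiseuxAbs_sigma_pow (j : ℕ) (a : Puiseux k) :
    puiseuxAbs k ((sigma k ^ j) a) = puiseuxAbs k a := by
  by_cases ha : a = 0
  · rw [ha, map_zero]
  obtain ⟨q, h1, h2, h3⟩ := exists_puiseuxAbs_eq ha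
  rw [h2]
  refine puiseuxAbs_eq_of_coeff ((sigma_pow_coeff_eq_zero_iff j a q).not.2 h1) fun p hp =>
    (sigma_pow_coeff_eq_zero_iff j a p).2 (h3 p hp)

/-- The product of `y - b` over the Galois conjugates `b` of `a`. -/
def conjPoly (a : Puiseux k) : (Puiseux k)[X] :=
  ∏ j ∈ Finset.range (per a), (X - C ((sigma k ^ j) a))

theorem conjPoly_map_sigma (a : Puiseux k) :
    (conjPoly a).map (sigma k : Puiseux k →+* Puiseux k) = conjPoly a := by
  -- Applying `σ` shifts the product cyclically. After multiplication by `X - C a`, both sides are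
  -- the same product over `per a + 1` consecutive powers.
  have h0 : (X - C a : (Puiseux k)[X]) ≠ 0 := X_sub_C_ne_zero a
  refine mul_right_cancel₀ h0 ?_
  have h1 : (conjPoly a).map (sigma k : Puiseux k →+* Puiseux k) =
      ∏ j ∈ Finset.range (per a), (X - C ((sigma k ^ (j + 1)) a)) := by
    rw [conjPoly, Polynomial.map_prod]
    refine Finset.prod_congr rfl fun j _ => ?_
    rw [Polynomial.map_sub, map_X, map_C, pow_succ', AlgEquiv.mul_apply]
    rfl
  have h2 := Finset.prod_range_succ' (fun j => (X - C ((sigma k ^ j) a) : (Puiseux k)[X])) (per a)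
  rw [Finset.prod_range_succ] at h2
  rw [h1]
  rw [(sigma_pow_eq_self_iff a (per a)).2 dvd_rfl] at h2
  exact h2.symm

theorem exists_of_map_sigma {P : (Puiseux k)[X]}
    (hP : P.map (sigma k : Puiseux k →+* Puiseux k) = P) :
    ∃ Q : (LaurentSeries k)[X], Q.map (algebraMap (LaurentSeries k) (Puiseux k)) = P := by
  have h : P ∈ lifts (algebraMap (LaurentSeries k) (Puiseux k)) := by
    rw [lifts_iff_coeff_lifts]
    intro i
    obtain ⟨f, hf⟩ := exists_algebraMap_eq (a := P.coeff i) fun q hq => by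
      have h1 : sigma k (P.coeff i) = P.coeff i := by
        conv_rhs => rw [← hP, coeff_map]
        rfl
      have h2 := sigma_coeff (P.coeff i) q
      rw [h1] at h2
      rw [← chi_eq_one_iff (k := k)]
      exact mul_right_cancel₀ hq (by rw [one_mul]; exact h2.symm)
    exact ⟨f, hf⟩
  exact h

/-- The product over the `σ`-orbit of `a` has coefficients in `k((x))`, so `τ a` is again one of its
roots. Hence the whole Galois group may be replaced by the powers of `σ`. -/
theorem exists_eq_sigma_pow (τ : Puiseux k ≃ₐ[LaurentSeries k] Puiseux k) (a : Puiseux k) :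
    ∃ j < per a, τ a = (sigma k ^ j) a := by
  obtain ⟨Q, hQ⟩ := exists_of_map_sigma (conjPoly_map_sigma a)
  have h0 : aeval a Q = 0 := by
    rw [← eval_map_algebraMap, hQ, conjPoly, eval_prod]
    exact Finset.prod_eq_zero (Finset.mem_range.2 (per_pos a)) (by simp)
  have h1 : aeval (τ a) Q = 0 := by
    have h2 : aeval (τ a) Q = τ (aeval a Q) := aeval_algHom_apply τ.toAlgHom a Q
    rw [h2, h0, map_zero]
  rw [← eval_map_algebraMap, hQ, conjPoly, eval_prod, Finset.prod_eq_zero_iff] at h1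
  obtain ⟨j, hj, hj0⟩ := h1
  rw [eval_sub, eval_X, eval_C, sub_eq_zero] at hj0
  exact ⟨j, Finset.mem_range.1 hj, hj0⟩

theorem puiseuxAbs_galois (τ : Puiseux k ≃ₐ[LaurentSeries k] Puiseux k) (a : Puiseux k) :
    puiseuxAbs k (τ a) = puiseuxAbs k a := by
  obtain ⟨j, -, hj⟩ := exists_eq_sigma_pow τ a
  rw [hj, puiseuxAbs_sigma_pow]

/-! ### The action on the Berkovich line -/

/-- The right action of the Galois group on the affine line. -/
def galAct (τ : Puiseux k ≃ₐ[LaurentSeries k] Puiseux k) (ξ : BerkA1 k) : BerkA1 k :=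
  ⟨{ toFun := fun f => ξ.1 (f.map (τ : Puiseux k →+* Puiseux k))
     map_zero' := by rw [Polynomial.map_zero, map_zero]
     add_le' := fun f g => by rw [Polynomial.map_add]; exact map_add_le_add _ _ _
     neg' := fun f => by rw [Polynomial.map_neg, map_neg_eq_map]
     map_one' := by rw [Polynomial.map_one, map_one]
     map_mul' := fun f g => by rw [Polynomial.map_mul, map_mul] },
    fun f g => by
      change ξ.1 ((f + g).map _) ≤ _
      rw [Polynomial.map_add]
      exact ξ.2.1 _ _,
    fun c => by
      change ξ.1 ((C c).map _) = _
      rw [map_C, ξ.2.2]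
      exact puiseuxAbs_galois τ c⟩

theorem galAct_apply (τ : Puiseux k ≃ₐ[LaurentSeries k] Puiseux k) (ξ : BerkA1 k)
    (f : (Puiseux k)[X]) : (galAct τ ξ).1 f = ξ.1 (f.map (τ : Puiseux k →+* Puiseux k)) := rfl

theorem galAct_linear (τ : Puiseux k ≃ₐ[LaurentSeries k] Puiseux k) (ξ : BerkA1 k)
    (c : Puiseux k) : (galAct τ ξ).1 (X - C c) = ξ.1 (X - C (τ c)) := by
  rw [galAct_apply, Polynomial.map_sub, map_X, map_C]
  rfl

theorem galAct_galAct (τ υ : Puiseux k ≃ₐ[LaurentSeries k] Puiseux k) (ξ : BerkA1 k) :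
    galAct τ (galAct υ ξ) = galAct (υ * τ) ξ := by
  refine BerkA1.ext_linear fun c => ?_
  rw [galAct_linear, galAct_linear, galAct_linear]
  rfl

theorem galAct_one (ξ : BerkA1 k) : galAct 1 ξ = ξ :=
  BerkA1.ext_linear fun _ => galAct_linear _ _ _

theorem galAct_zetaA (τ : Puiseux k ≃ₐ[LaurentSeries k] Puiseux k) (a : Puiseux k) (r : ℝ) :
    galAct τ (zetaA a r) = zetaA (τ⁻¹ a) r := by
  refine BerkA1.ext_linear fun c => ?_
  rw [galAct_linear, zetaA_linear, zetaA_linear, ← puiseuxAbs_galois τ (τ⁻¹ a - c),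
    map_sub τ, show τ (τ⁻¹ a) = a from AlgEquiv.apply_symm_apply τ a]

/-- The Galois orbit of a point of the affine line. -/
def orb (ξ : BerkA1 k) : Set (BerkA1 k) :=
  Set.range fun τ : Puiseux k ≃ₐ[LaurentSeries k] Puiseux k => galAct τ ξ

theorem mult_coe (ξ : BerkA1 k) : mult (ξ : BerkP1 k) = (orb ξ).encard := by
  have h : {η | GaloisConj (ξ : BerkP1 k) η} = (↑) '' orb ξ := by
    ext η
    constructor
    · rintro (⟨h, -⟩ | ⟨z, w, hz, rfl, τ, hτ⟩)
      · exact absurd h (OnePoint.coe_ne_infty ξ)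
      · obtain rfl := OnePoint.coe_injective hz
        exact ⟨w, ⟨τ, Subtype.ext (DFunLike.ext _ _ fun f => (hτ f).symm)⟩, rfl⟩
    · rintro ⟨w, ⟨τ, rfl⟩, rfl⟩
      exact Or.inr ⟨ξ, _, rfl, rfl, τ, fun f => rfl⟩
  rw [mult, h, OnePoint.coe_injective.encard_image]

omit [IsAlgClosed k] [CharZero k] in
theorem mult_infty : mult (OnePoint.infty : BerkP1 k) = 1 := by
  rw [mult, Set.encard_eq_one]
  refine ⟨OnePoint.infty, ?_⟩
  ext η
  constructor
  · rintro (⟨-, h⟩ | ⟨z, w, hz, -⟩)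
    · exact h
    · exact absurd hz.symm (OnePoint.coe_ne_infty z)
  · rintro rfl
    exact Or.inl ⟨rfl, rfl⟩

theorem mult_ne_zero (ξ : BerkP1 k) : mult ξ ≠ 0 := by
  induction ξ using OnePoint.rec with
  | infty => rw [mult_infty]; exact one_ne_zero
  | coe ξ =>
    rw [mult_coe, Set.encard_ne_zero]
    exact Set.range_nonempty _

theorem sigma_pow_injOn (a : Puiseux k) :
    Set.InjOn (fun j => (sigma k ^ j) a) (Set.Iio (per a)) := by
  intro i hi j hj hij
  simp only [sigma_pow_eq_iterate] at hij
  exact Function.iterate_injOn_Iio_minimalPeriod hi hj hij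

/-- All conjugates of `a` have the support of `a`, so agreement at every exponent below `r` is
equality. -/
theorem sigma_pow_eq_of_le {a : Puiseux k} {r : ℝ} (h : ∀ q : ℚ, a.1.coeff q ≠ 0 → (q : ℝ) < r)
    {i j : ℕ} (hij : puiseuxAbs k ((sigma k ^ i) a - (sigma k ^ j) a) ≤ Real.exp (-r)) :
    (sigma k ^ i) a = (sigma k ^ j) a := by
  rw [puiseuxAbs_le_iff] at hij
  refine Subtype.ext ?_
  ext q
  by_cases hq : a.1.coeff q = 0
  · rw [(sigma_pow_coeff_eq_zero_iff i a q).2 hq, (sigma_pow_coeff_eq_zero_iff j a q).2 hq]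
  · exact sub_eq_zero.1 (hij q (h q hq))

theorem sigma_pow_eq_of_lt {a : Puiseux k} {r : ℝ} (h : ∀ q : ℚ, a.1.coeff q ≠ 0 → (q : ℝ) ≤ r)
    {i j : ℕ} (hij : puiseuxAbs k ((sigma k ^ i) a - (sigma k ^ j) a) < Real.exp (-r)) :
    (sigma k ^ i) a = (sigma k ^ j) a := by
  rw [puiseuxAbs_lt_iff] at hij
  refine Subtype.ext ?_
  ext q
  by_cases hq : a.1.coeff q = 0
  · rw [(sigma_pow_coeff_eq_zero_iff i a q).2 hq, (sigma_pow_coeff_eq_zero_iff j a q).2 hq]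
  · exact sub_eq_zero.1 (hij q (h q hq))

theorem orb_zetaA (a : Puiseux k) (r : ℝ) :
    orb (zetaA a r) = (fun j => zetaA ((sigma k ^ j) a) r) '' (Set.Iio (per a)) := by
  ext w
  constructor
  · rintro ⟨τ, rfl⟩
    obtain ⟨j, hj, hja⟩ := exists_eq_sigma_pow τ⁻¹ a
    exact ⟨j, hj, by simp only [galAct_zetaA, hja]⟩
  · rintro ⟨j, -, rfl⟩
    exact ⟨(sigma k ^ j)⁻¹, by simp only [galAct_zetaA, inv_inv]⟩

theorem mult_zetaA {a : Puiseux k} {r : ℝ} (h : ∀ q : ℚ, a.1.coeff q ≠ 0 → (q : ℝ) < r) :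
    mult (zetaA a r : BerkP1 k) = per a := by
  rw [mult_coe, orb_zetaA, Set.InjOn.encard_image]
  · rw [← Finset.coe_range, Set.encard_coe_eq_coe_finsetCard, Finset.card_range]
  · intro i hi j hj hij
    exact sigma_pow_injOn a hi hj (sigma_pow_eq_of_le h (zetaA_inj hij).2)

theorem encard_biUnion_of_const {α : Type*} (n : ℕ) (s : ℕ → Set α) (c : ℕ∞)
    (hc : ∀ i < n, (s i).encard = c)
    (hd : ∀ i < n, ∀ j < n, i ≠ j → Disjoint (s i) (s j)) :
    (⋃ i ∈ Finset.range n, s i).encard = n * c := by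
  induction n with
  | zero => simp
  | succ n ih =>
    rw [Finset.range_add_one, Finset.set_biUnion_insert, Set.encard_union_eq, hc n n.lt_succ_self,
      ih (fun i hi => hc i (hi.trans n.lt_succ_self))
        fun i hi j hj => hd i (hi.trans n.lt_succ_self) j (hj.trans n.lt_succ_self)]
    · push_cast
      rw [add_mul, one_mul, add_comm]
    · rw [Set.disjoint_iUnion₂_right]
      intro i hi
      have hi := Finset.mem_range.1 hi
      exact hd n n.lt_succ_self i (hi.trans n.lt_succ_self) hi.ne'

/-- The open disks about the conjugates of `a` are pairwise disjoint and permuted transitively by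
the Galois group, so they cut the orbit of `ξ` into `per a` parts of equal, possibly infinite,
cardinality. -/
theorem per_dvd_mult {a : Puiseux k} {r : ℝ} (h : ∀ q : ℚ, a.1.coeff q ≠ 0 → (q : ℝ) ≤ r)
    {ξ : BerkA1 k} (hξ : ξ.1 (X - C a) < Real.exp (-r)) :
    (per a : ℕ∞) ∣ mult (ξ : BerkP1 k) := by
  let s : ℕ → Set (BerkA1 k) := fun j =>
    orb ξ ∩ {w | w.1 (X - C ((sigma k ^ j) a)) < Real.exp (-r)}
  have hU : orb ξ = ⋃ j ∈ Finset.range (per a), s j := by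
    ext w
    simp only [Set.mem_iUnion, Finset.mem_range, s, Set.mem_inter_iff, Set.mem_ofPred_eq]
    constructor
    · rintro ⟨τ, rfl⟩
      obtain ⟨j, hj, hja⟩ := exists_eq_sigma_pow τ⁻¹ a
      refine ⟨j, hj, ⟨τ, rfl⟩, ?_⟩
      rw [galAct_linear, ← hja]
      rwa [show τ (τ⁻¹ a) = a from AlgEquiv.apply_symm_apply τ a]
    · rintro ⟨j, -, hw, -⟩
      exact hw
  have hcard : ∀ j < per a, (s j).encard = (s 0).encard := by
    intro j _
    have himg : s j = galAct (sigma k ^ j)⁻¹ '' s 0 := by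
      ext w
      constructor
      · rintro ⟨⟨τ, rfl⟩, hw⟩
        refine ⟨galAct (sigma k ^ j) (galAct τ ξ), ⟨⟨_, (galAct_galAct _ _ _).symm⟩, ?_⟩, ?_⟩
        · simp only [Set.mem_ofPred_eq] at hw ⊢
          rw [galAct_linear]
          exact hw
        · rw [galAct_galAct, mul_inv_cancel, galAct_one]
      · rintro ⟨_, ⟨⟨τ, rfl⟩, hw⟩, rfl⟩
        refine ⟨⟨_, (galAct_galAct _ _ _).symm⟩, ?_⟩
        simp only [Set.mem_ofPred_eq] at hw ⊢
        rw [galAct_linear, show (sigma k ^ j)⁻¹ ((sigma k ^ j) a) = a from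
          AlgEquiv.symm_apply_apply _ a]
        exact hw
    rw [himg, Set.InjOn.encard_image]
    intro w _ w' _ hww
    have := congrArg (galAct (sigma k ^ j)) hww
    rw [galAct_galAct, galAct_galAct, inv_mul_cancel, galAct_one, galAct_one] at this
    exact this
  have hdisj : ∀ i < per a, ∀ j < per a, i ≠ j → Disjoint (s i) (s j) := by
    intro i hi j hj hij
    rw [Set.disjoint_left]
    rintro w ⟨-, h1⟩ ⟨-, h2⟩
    simp only [Set.mem_ofPred_eq] at h1 h2
    refine hij (sigma_pow_injOn a hi hj (sigma_pow_eq_of_lt h ?_))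
    by_contra hcon
    rw [not_lt] at hcon
    rw [w.linear_eq (h1.trans_le hcon)] at h2
    exact absurd h2 (not_lt.2 hcon)
  refine ⟨(s 0).encard, ?_⟩
  rw [mult_coe]
  conv_lhs => rw [hU]
  exact encard_biUnion_of_const _ s _ hcard hdisj

end Galois

/-! ### Denominators and least common multiples -/

section Arithmetic

theorem den_dvd_iff (r : ℚ) (n : ℕ) : r.den ∣ n ↔ ∃ z : ℤ, (n : ℚ) * r = z := by
  have hd : (r.den : ℚ) ≠ 0 := by exact_mod_cast r.den_ne_zero
  constructor
  · rintro ⟨c, rfl⟩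
    refine ⟨c * r.num, ?_⟩
    have := Rat.mul_den_eq_num r
    push_cast
    linear_combination (c : ℚ) * this
  · rintro ⟨z, hz⟩
    have h1 : (n : ℤ) * r.num = z * r.den := by
      have := Rat.mul_den_eq_num r
      have h2 : (n : ℚ) * r.num = z * r.den := by
        rw [← hz, ← this]; ring
      exact_mod_cast h2
    have h3 : (r.den : ℤ) ∣ n * r.num := ⟨z, by rw [h1]; ring⟩
    have h4 : IsCoprime (r.den : ℤ) r.num := by
      rw [Int.isCoprime_iff_gcd_eq_one, Int.gcd_comm]
      exact r.reduced
    exact_mod_cast h4.dvd_of_dvd_mul_right h3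

/-- This turns generic multiplicities into ordinary denominators: after rescaling exponents by `m`,
the theory of Farey fractions applies. -/
theorem lcm_den (m : ℕ) (r : ℚ) : Nat.lcm m r.den = m * ((m : ℚ) * r).den := by
  apply Nat.dvd_antisymm
  · refine Nat.lcm_dvd (dvd_mul_right _ _) ((den_dvd_iff r _).2 ?_)
    obtain ⟨z, hz⟩ := (den_dvd_iff ((m : ℚ) * r) _).1 dvd_rfl
    exact ⟨z, by rw [← hz]; push_cast; ring⟩
  · obtain ⟨c, hc⟩ := Nat.dvd_lcm_left m r.den
    rw [hc]
    refine mul_dvd_mul_left m ((den_dvd_iff _ _).2 ?_)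
    obtain ⟨z, hz⟩ := (den_dvd_iff r _).1 (Nat.dvd_lcm_right m r.den)
    rw [hc] at hz
    exact ⟨z, by rw [← hz]; push_cast; ring⟩

/-- Every element of `(1/g)ℤ`, `g = lcm(m, den r)`, is `c + l r` with `m c ∈ ℤ` and `l ∈ ℕ`. -/
theorem exists_weight (m : ℕ) (hm : 0 < m) (r : ℚ) :
    ∃ (c : ℚ) (l : ℕ), (∃ z : ℤ, (m : ℚ) * c = z) ∧
      c + l * r = 1 / (Nat.lcm m r.den : ℕ) := by
  set R : ℚ := m * r with hR
  have hm' : (m : ℚ) ≠ 0 := by exact_mod_cast hm.ne'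
  have hd' : (R.den : ℚ) ≠ 0 := by exact_mod_cast R.den_ne_zero
  have hcop : IsCoprime R.num (R.den : ℤ) := by
    rw [Int.isCoprime_iff_gcd_eq_one]
    exact R.reduced
  -- Bézout for the numerator and denominator of `R = m r`. The exponent `l` must be a natural
  -- number, so `u` is reduced modulo the denominator and the quotient is absorbed into `c`.
  obtain ⟨u, v, huv⟩ := hcop
  have hd0 : (R.den : ℤ) ≠ 0 := by exact_mod_cast R.den_ne_zero
  have hl : 0 ≤ u % R.den := Int.emod_nonneg u hd0
  have hdiv := Int.emod_add_mul_ediv u R.den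
  refine ⟨((v + u / R.den * R.num : ℤ) : ℚ) / m, (u % R.den).toNat,
    ⟨v + u / R.den * R.num, mul_div_cancel₀ _ hm'⟩, ?_⟩
  have hcast : (((u % R.den).toNat : ℕ) : ℚ) = ((u % R.den : ℤ) : ℚ) := by
    have := Int.toNat_of_nonneg hl
    exact_mod_cast congrArg (fun z : ℤ => (z : ℚ)) this
  have hnum : (R.num : ℚ) = R * R.den := (Rat.mul_den_eq_num R).symm
  have huv' : (u : ℚ) * R.num + v * R.den = 1 := by exact_mod_cast huv
  have hdiv' : ((u % R.den : ℤ) : ℚ) + R.den * ((u / R.den : ℤ) : ℚ) = u := by exact_mod_cast hdiv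
  have hr : r = R / m := by rw [hR]; field_simp
  rw [hcast, lcm_den m r, ← hR, hr]
  push_cast
  field_simp
  rw [hnum] at huv' ⊢
  linear_combination huv' + R * R.den * hdiv'

end Arithmetic

/-! ### Generic multiplicity in terms of a truncated centre -/

section GenericMultiplicity

variable {k : Type*} [Field k]

theorem ENat.dvd_top' (a : ℕ∞) (ha : a ≠ 0) : a ∣ ⊤ := ⟨⊤, (ENat.mul_top ha).symm⟩

variable [IsAlgClosed k] [CharZero k]

theorem exists_truncated (a : Puiseux k) (r : ℝ) :
    ∃ b : Puiseux k, (∀ q : ℚ, b.1.coeff q ≠ 0 → (q : ℝ) < r) ∧ zetaA a r = zetaA b r ∧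
      ∀ q : ℚ, (q : ℝ) < r → b.1.coeff q = a.1.coeff q := by
  refine ⟨restr (fun q => (q : ℝ) < r) a, fun q hq => ?_, zetaA_eq ?_, fun q hq =>
    restr_coeff_of (P := fun q : ℚ => (q : ℝ) < r) hq a⟩
  · by_contra h
    exact hq (restr_coeff_of_not h a)
  · rw [puiseuxAbs_le_iff]
    intro q hq
    rw [coeff_sub', restr_coeff_of (P := fun q : ℚ => (q : ℝ) < r) hq, sub_self]

theorem IsTypeII.exists_truncated {ζ : BerkP1 k} (h : IsTypeII ζ) :
    ∃ (a : Puiseux k) (r : ℚ), (∀ q : ℚ, a.1.coeff q ≠ 0 → q < r) ∧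
      ζ = (zetaA a (r : ℝ) : BerkP1 k) := by
  obtain ⟨a, r, rfl⟩ := h
  obtain ⟨b, h1, h2, -⟩ := FareyTree.exists_truncated a r
  exact ⟨b, r, fun q hq => by exact_mod_cast h1 q hq, by rw [h2]⟩

theorem genMult_zetaA {a : Puiseux k} {r : ℚ} (h : ∀ q : ℚ, a.1.coeff q ≠ 0 → q < r) :
    genMult (zetaA a (r : ℝ) : BerkP1 k) = (Nat.lcm (per a) r.den : ℕ) := by
  have hex : ∃ (s : ℚ) (b : Puiseux k), (zetaA a (r : ℝ) : BerkP1 k) = (zetaA b (s : ℝ) : BerkA1 k) :=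
    ⟨r, a, rfl⟩
  -- The radius is determined by the point, so the chosen radius in the definition of `genMult` is
  -- `r` although the chosen centre may differ.
  have hr : hex.choose = r := by
    obtain ⟨b, hb⟩ := hex.choose_spec
    have := (zetaA_inj (OnePoint.coe_injective hb)).1
    exact_mod_cast this.symm
  rw [genMult, dif_pos hex, mult_zetaA (fun q hq => by exact_mod_cast h q hq), hr]
  rfl

theorem mult_dvd_genMult (ξ : BerkP1 k) : mult ξ ∣ genMult ξ := by
  by_cases h : IsTypeII ξ
  · obtain ⟨a, r, ha, rfl⟩ := h.exists_truncated
    rw [genMult_zetaA ha, mult_zetaA (fun q hq => by exact_mod_cast ha q hq)]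
    obtain ⟨c, hc⟩ := Nat.dvd_lcm_left (per a) r.den
    exact ⟨c, by exact_mod_cast congrArg (Nat.cast (R := ℕ∞)) hc⟩
  · have h' : ¬ ∃ (r : ℚ) (a : Puiseux k), ξ = (zetaA a (r : ℝ) : BerkA1 k) :=
      fun ⟨r, a, h1⟩ => h ⟨a, r, h1⟩
    rw [genMult, dif_neg h']
    split_ifs
    · exact dvd_rfl
    · exact ENat.dvd_top' _ (mult_ne_zero ξ)

end GenericMultiplicity

/-! ### The norm on the function field -/

section RatNorm

variable {k : Type*} [Field k]

theorem toPuiseuxPoly_injective : Function.Injective (toPuiseuxPoly k) := by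
  refine map_injective _ ((laurentToPuiseux k).injective.comp ?_)
  exact HahnSeries.ofPowerSeries_injective.comp (Polynomial.coe_injective k)

theorem zetaA_eq_zero_iff (a : Puiseux k) (r : ℝ) (f : (Puiseux k)[X]) :
    (zetaA a r).1 f = 0 ↔ f = 0 := by
  change (taylor a f).gaussNorm (puiseuxAbs k) (Real.exp (-r)) = 0 ↔ _
  rw [gaussNorm_eq_zero_iff _ _ (fun x hx => (puiseuxAbs k).eq_zero.1 hx) (Real.exp_pos _)]
  exact taylor_eq_zero _ _

theorem zetaA_pos (a : Puiseux k) (r : ℝ) {f : (Puiseux k)[X]} (hf : f ≠ 0) :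
    0 < (zetaA a r).1 f :=
  lt_of_le_of_ne ((zetaA a r).nonneg f) fun h => hf ((zetaA_eq_zero_iff a r f).1 h.symm)

variable (a : Puiseux k) (r : ℝ)

theorem zetaA_toPuiseuxPoly_pos {p : k[X][X]} (hp : p ≠ 0) :
    0 < (zetaA a r).1 (toPuiseuxPoly k p) :=
  zetaA_pos a r fun h => hp (toPuiseuxPoly_injective (h.trans (map_zero _).symm))

/-- Independence of the chosen representation as a quotient, from which multiplicativity and the
ultrametric inequality follow. -/
theorem ratNorm_div (p h : k[X][X]) (hh : h ≠ 0) :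
    ratNorm (zetaA a r) (algebraMap _ (FunField k) p / algebraMap _ (FunField k) h) =
      (zetaA a r).1 (toPuiseuxPoly k p) / (zetaA a r).1 (toPuiseuxPoly k h) := by
  set f := algebraMap _ (FunField k) p / algebraMap _ (FunField k) h with hf
  have hinj := IsFractionRing.injective k[X][X] (FunField k)
  have hs := IsLocalization.sec_spec (nonZeroDivisors k[X][X]) f
  set s := IsLocalization.sec (nonZeroDivisors k[X][X]) f with hs'
  have hs2 : (s.2 : k[X][X]) ≠ 0 := nonZeroDivisors.ne_zero s.2.2
  have hh' : algebraMap _ (FunField k) h ≠ 0 := fun h0 => hh (hinj (h0.trans (map_zero _).symm))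
  have h1 : p * s.2 = s.1 * h := by
    apply hinj
    rw [map_mul, map_mul, ← hs, hf]
    field_simp
  have h2 := congrArg (fun q => (zetaA a r).1 (toPuiseuxPoly k q)) h1
  simp only [map_mul] at h2
  rw [ratNorm, div_eq_div_iff (zetaA_toPuiseuxPoly_pos a r hs2).ne'
    (zetaA_toPuiseuxPoly_pos a r hh).ne', ← h2]

theorem exists_eq_div (f : FunField k) : ∃ p h : k[X][X], h ≠ 0 ∧
    f = algebraMap _ (FunField k) p / algebraMap _ (FunField k) h := by
  obtain ⟨p, h, hh, rfl⟩ := IsFractionRing.div_surjective (A := k[X][X]) f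
  exact ⟨p, h, nonZeroDivisors.ne_zero hh, rfl⟩

theorem ratNorm_algebraMap (p : k[X][X]) :
    ratNorm (zetaA a r) (algebraMap _ (FunField k) p) = (zetaA a r).1 (toPuiseuxPoly k p) := by
  have := ratNorm_div a r p 1 one_ne_zero
  rwa [map_one, div_one, map_one, map_one, div_one] at this

theorem ratNorm_mul (f g : FunField k) :
    ratNorm (zetaA a r) (f * g) = ratNorm (zetaA a r) f * ratNorm (zetaA a r) g := by
  obtain ⟨p, h, hh, rfl⟩ := exists_eq_div f
  obtain ⟨P, H, hH, rfl⟩ := exists_eq_div g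
  rw [div_mul_div_comm, ← map_mul, ← map_mul, ratNorm_div a r _ _ (mul_ne_zero hh hH),
    ratNorm_div a r _ _ hh, ratNorm_div a r _ _ hH, map_mul, map_mul, map_mul, map_mul,
    div_mul_div_comm]

theorem ratNorm_one : ratNorm (zetaA a r) (1 : FunField k) = 1 := by
  have := ratNorm_algebraMap a r (1 : k[X][X])
  rwa [map_one, map_one, map_one] at this

theorem ratNorm_nonneg (f : FunField k) : 0 ≤ ratNorm (zetaA a r) f :=
  div_nonneg ((zetaA a r).nonneg _) ((zetaA a r).nonneg _)

theorem ratNorm_zero : ratNorm (zetaA a r) (0 : FunField k) = 0 := by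
  have := ratNorm_algebraMap a r (0 : k[X][X])
  rwa [map_zero, map_zero, map_zero] at this

theorem ratNorm_inv (f : FunField k) : ratNorm (zetaA a r) f⁻¹ = (ratNorm (zetaA a r) f)⁻¹ := by
  by_cases hf : f = 0
  · rw [hf, inv_zero, ratNorm_zero, inv_zero]
  · refine eq_inv_of_mul_eq_one_left ?_
    rw [← ratNorm_mul, inv_mul_cancel₀ hf, ratNorm_one]

theorem ratNorm_add_le (f g : FunField k) :
    ratNorm (zetaA a r) (f + g) ≤ max (ratNorm (zetaA a r) f) (ratNorm (zetaA a r) g) := by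
  obtain ⟨p, h, hh, rfl⟩ := exists_eq_div f
  obtain ⟨P, H, hH, rfl⟩ := exists_eq_div g
  have hinj := IsFractionRing.injective k[X][X] (FunField k)
  have hh' : algebraMap _ (FunField k) h ≠ 0 := fun h0 => hh (hinj (h0.trans (map_zero _).symm))
  have hH' : algebraMap _ (FunField k) H ≠ 0 := fun h0 => hH (hinj (h0.trans (map_zero _).symm))
  rw [div_add_div _ _ hh' hH', ← map_mul, ← map_mul, ← map_mul, ← map_add,
    ratNorm_div a r _ _ (mul_ne_zero hh hH), ratNorm_div a r _ _ hh, ratNorm_div a r _ _ hH]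
  have p1 := zetaA_toPuiseuxPoly_pos a r hh
  have p2 := zetaA_toPuiseuxPoly_pos a r hH
  rw [div_le_iff₀ (by rw [map_mul, map_mul]; exact mul_pos p1 p2), map_add]
  refine ((zetaA a r).2.1 _ _).trans ?_
  simp only [map_mul]
  rw [max_mul_of_nonneg _ _ (mul_pos p1 p2).le]
  refine le_of_eq ?_
  congr 1 <;> field_simp

theorem toPuiseuxPoly_C_X : toPuiseuxPoly k (C X) = C (mono 1 1) := by
  rw [toPuiseuxPoly, coe_mapRingHom, map_C]
  congr 1
  refine Subtype.ext ?_
  change rootHom k 0 (HahnSeries.ofPowerSeries ℤ k ((X : k[X]) : PowerSeries k)) = _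
  rw [Polynomial.coe_X, HahnSeries.ofPowerSeries_X, mono_val]
  change HahnSeries.embDomain _ _ = _
  rw [HahnSeries.embDomain_single]
  exact congrArg (fun q : ℚ => HahnSeries.single q (1 : k))
    (show ((1 : ℤ) : ℚ) * (((0 : ℕ) : ℚ) + 1)⁻¹ = 1 by norm_num)

theorem zetaA_C_mono (q : ℚ) : (zetaA a r).1 (C (mono q 1)) = Real.exp (-(q : ℝ)) := by
  rw [(zetaA a r).2.2, puiseuxAbs_mono _ one_ne_zero]

theorem ratNorm_fx : ratNorm (zetaA a r) (fx k) = Real.exp (-1) := by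
  rw [fx, ratNorm_algebraMap, toPuiseuxPoly_C_X, zetaA_C_mono]
  norm_num

end RatNorm

/-! ### Ultrametric estimates for finite sums and products -/

section Ultrametric

variable {k : Type*} [Field k]

theorem BerkA1.sum_le (ξ : BerkA1 k) {ι : Type*} (s : Finset ι) (f : ι → (Puiseux k)[X]) {B : ℝ}
    (hB : 0 ≤ B) (h : ∀ i ∈ s, ξ.1 (f i) ≤ B) : ξ.1 (∑ i ∈ s, f i) ≤ B := by
  classical
  induction s using Finset.induction_on with
  | empty => simpa using hB
  | insert i s hi ih =>
    rw [Finset.sum_insert hi]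
    exact (ξ.2.1 _ _).trans (max_le (h i (Finset.mem_insert_self _ _))
      (ih fun j hj => h j (Finset.mem_insert_of_mem hj)))

theorem BerkA1.sum_lt (ξ : BerkA1 k) {ι : Type*} (s : Finset ι) (f : ι → (Puiseux k)[X]) {B : ℝ}
    (hB : 0 < B) (h : ∀ i ∈ s, ξ.1 (f i) < B) : ξ.1 (∑ i ∈ s, f i) < B := by
  classical
  induction s using Finset.induction_on with
  | empty => simpa using hB
  | insert i s hi ih =>
    rw [Finset.sum_insert hi]
    exact (ξ.2.1 _ _).trans_lt (max_lt (h i (Finset.mem_insert_self _ _))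
      (ih fun j hj => h j (Finset.mem_insert_of_mem hj)))

theorem BerkA1.eq_of_sub_lt (ξ : BerkA1 k) {f g : (Puiseux k)[X]} (h : ξ.1 (f - g) < ξ.1 g) :
    ξ.1 f = ξ.1 g := by
  apply le_antisymm
  · have := ξ.2.1 (f - g) g
    rw [sub_add_cancel] at this
    exact this.trans (max_le h.le le_rfl)
  · have := ξ.2.1 f (-(f - g))
    rw [map_neg_eq_map, show f + -(f - g) = g by ring] at this
    exact (le_max_iff.1 this).resolve_right (not_le.2 h)

theorem BerkA1.sub_le (ξ : BerkA1 k) (f g : (Puiseux k)[X]) :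
    ξ.1 (f - g) ≤ max (ξ.1 f) (ξ.1 g) := by
  have := ξ.2.1 f (-g)
  rwa [map_neg_eq_map, ← sub_eq_add_neg] at this

theorem BerkA1.mul_sub_one_lt (ξ : BerkA1 k) {f g : (Puiseux k)[X]} (hf : ξ.1 (f - 1) < 1)
    (hg : ξ.1 (g - 1) < 1) : ξ.1 (f * g - 1) < 1 := by
  have h1 : ξ.1 g = 1 := by
    have := ξ.eq_of_sub_lt (f := g) (g := 1) (by rwa [map_one])
    rwa [map_one] at this
  rw [show f * g - 1 = (f - 1) * g + (g - 1) by ring]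
  refine (ξ.2.1 _ _).trans_lt (max_lt ?_ hg)
  rwa [map_mul, h1, mul_one]

theorem BerkA1.prod_sub_one_lt (ξ : BerkA1 k) {ι : Type*} (s : Finset ι) (f : ι → (Puiseux k)[X])
    (h : ∀ i ∈ s, ξ.1 (f i - 1) < 1) : ξ.1 (∏ i ∈ s, f i - 1) < 1 := by
  classical
  induction s using Finset.induction_on with
  | empty => simp
  | insert i s hi ih =>
    rw [Finset.prod_insert hi]
    exact ξ.mul_sub_one_lt (h i (Finset.mem_insert_self _ _))
      (ih fun j hj => h j (Finset.mem_insert_of_mem hj))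

end Ultrametric

/-! ### Approximation by polynomials and the value group -/

section Approximation

variable {k : Type*} [Field k]

/-- The inclusion `k[x] → 𝕂`. -/
def polyToPuiseux : k[X] →+* Puiseux k :=
  (laurentToPuiseux k).comp
    ((HahnSeries.ofPowerSeries ℤ k).comp Polynomial.coeToPowerSeries.ringHom)

theorem toPuiseuxPoly_eq_map (p : k[X][X]) : toPuiseuxPoly k p = p.map polyToPuiseux := rfl

theorem polyToPuiseux_monomial (n : ℕ) (c : k) :
    polyToPuiseux (monomial n c) = mono (n : ℚ) c := by
  refine Subtype.ext ?_
  change rootHom k 0 (HahnSeries.ofPowerSeries ℤ k ((monomial n c : k[X]) : PowerSeries k)) = _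
  ext q
  have h0 : ∀ m : ℤ, (m : ℚ) = (m : ℚ) * (((0 : ℕ) : ℚ) + 1)⁻¹ := fun m => by norm_num
  by_cases hq : ∃ m : ℕ, q = m
  · obtain ⟨m, rfl⟩ := hq
    have h1 := h0 m
    rw [Int.cast_natCast] at h1
    have h2 := rootHom_coeff 0
      (HahnSeries.ofPowerSeries ℤ k ((monomial n c : k[X]) : PowerSeries k)) (m : ℤ)
    rw [Int.cast_natCast, ← h1, HahnSeries.ofPowerSeries_apply_coeff, coeff_coe,
      coeff_monomial] at h2
    rw [h2, mono_val]
    split_ifs with h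
    · rw [h, HahnSeries.coeff_single_same]
    · rw [HahnSeries.coeff_single_of_ne]
      exact fun h' => h (by exact_mod_cast h'.symm)
  · rw [mono_val, HahnSeries.coeff_single_of_ne fun h => hq ⟨n, h⟩]
    by_contra hne
    have hmem : rootHom k 0 (HahnSeries.ofPowerSeries ℤ k ((monomial n c : k[X]) : PowerSeries k)) ∈
      (rootHom k 0).fieldRange := ⟨_, rfl⟩
    obtain ⟨m, hm⟩ := (mem_range_rootHom k 0 _).1 hmem q hne
    rw [hm, rootHom_coeff] at hne
    rw [← h0] at hm
    have hneg : ¬ 0 ≤ m := fun h => hq ⟨m.toNat, by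
      rw [hm]
      have := Int.toNat_of_nonneg h
      exact_mod_cast this.symm⟩
    apply hne
    rw [HahnSeries.ofPowerSeries_apply]
    refine HahnSeries.embDomain_of_notMem_range ?_
    rintro ⟨i, hi⟩
    have : (i : ℤ) = m := hi
    omega

theorem polyToPuiseux_coeff (p : k[X]) (q : ℚ) :
    (polyToPuiseux p).1.coeff q = ∑ i ∈ p.support, (HahnSeries.single (i : ℚ) (p.coeff i)).coeff q := by
  conv_lhs => rw [p.as_sum_support, map_sum]
  rw [AddSubmonoidClass.coe_finsetSum, HahnSeries.coeff_sum]
  simp only [polyToPuiseux_monomial, mono_val]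

theorem polyToPuiseux_coeff_natCast (p : k[X]) (n : ℕ) :
    (polyToPuiseux p).1.coeff (n : ℚ) = p.coeff n := by
  rw [polyToPuiseux_coeff]
  by_cases hn : n ∈ p.support
  · rw [Finset.sum_eq_single n, HahnSeries.coeff_single_same]
    · intro i _ hi
      exact HahnSeries.coeff_single_of_ne fun h => hi (by exact_mod_cast h.symm)
    · exact fun h => absurd hn h
  · rw [notMem_support_iff.1 hn]
    refine Finset.sum_eq_zero fun i hi => HahnSeries.coeff_single_of_ne fun h => hn ?_
    rwa [show n = i by exact_mod_cast h]

theorem polyToPuiseux_coeff_of_ne (p : k[X]) {q : ℚ} (hq : ∀ n : ℕ, q ≠ n) :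
    (polyToPuiseux p).1.coeff q = 0 := by
  rw [polyToPuiseux_coeff]
  exact Finset.sum_eq_zero fun i _ => HahnSeries.coeff_single_of_ne (hq i)

theorem mono_mul_coeff (p q : ℚ) (b : Puiseux k) :
    (mono p 1 * b).1.coeff q = b.1.coeff (q - p) := by
  have := HahnSeries.coeff_single_mul_add (r := (1 : k)) (x := b.1) (a := q - p) (b := p)
  rw [one_mul, sub_add_cancel] at this
  exact this

/-- A Laurent series is approximated by Laurent polynomials. -/
theorem exists_poly_approx (f : LaurentSeries k) (B : ℝ) :
    ∃ N₀ : ℕ, ∀ N ≥ N₀, ∃ p : k[X],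
      puiseuxAbs k (mono (N : ℚ) 1 * algebraMap (LaurentSeries k) (Puiseux k) f -
        polyToPuiseux p) ≤ Real.exp (-(B + N)) := by
  set b := algebraMap (LaurentSeries k) (Puiseux k) f with hb
  obtain ⟨N₀, hN₀⟩ := exists_nat_ge (-b.1.order)
  refine ⟨N₀, fun N hN => ?_⟩
  -- After the shift by `N` no negative exponents remain, and the series is cut off at `B + N`.
  refine ⟨∑ i ∈ Finset.range ⌈B + N⌉₊, monomial i (b.1.coeff ((i : ℚ) - N)), ?_⟩
  rw [puiseuxAbs_le_iff]
  intro q hq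
  rw [coeff_sub', mono_mul_coeff, sub_eq_zero]
  by_cases hn : ∃ n : ℕ, q = n
  · obtain ⟨n, rfl⟩ := hn
    rw [polyToPuiseux_coeff_natCast, finsetSum_coeff]
    simp only [coeff_monomial]
    rw [Finset.sum_ite_eq' , if_pos]
    rw [Finset.mem_range, Nat.lt_ceil]
    exact_mod_cast hq
  · rw [polyToPuiseux_coeff_of_ne _ fun n h => hn ⟨n, h⟩]
    by_contra hne
    obtain ⟨m, hm⟩ := exists_int_of_algebraMap f hne
    have h1 : ¬ q - N < b.1.order := fun h => hne (HahnSeries.coeff_eq_zero_of_lt_order h)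
    have h2 : (N₀ : ℚ) ≤ N := by exact_mod_cast hN
    have h3 : q = ((m + N : ℤ) : ℚ) := by
      push_cast
      linarith
    have h4 : (0 : ℚ) ≤ ((m + N : ℤ) : ℚ) := by
      rw [← h3]
      linarith [not_lt.1 h1]
    have h5 : 0 ≤ m + N := by exact_mod_cast h4
    refine hn ⟨(m + N).toNat, ?_⟩
    rw [h3]
    exact_mod_cast (Int.toNat_of_nonneg h5).symm

/-- The denominator exponent is allowed to be any large `N`, so that approximations of two summands
can be added over a common power of `x`. -/
theorem exists_poly_poly_approx (ξ : BerkA1 k) (Q : (LaurentSeries k)[X]) :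
    ∀ ε : ℝ, 0 < ε → ∃ N₀ : ℕ, ∀ N ≥ N₀, ∃ t : k[X][X],
      ξ.1 (C (mono (N : ℚ) 1) * Q.map (algebraMap (LaurentSeries k) (Puiseux k)) -
        toPuiseuxPoly k t) < ε * Real.exp (-(N : ℝ)) := by
  induction Q using Polynomial.induction_on' with
  | add P Q hP hQ =>
    intro ε hε
    obtain ⟨N₁, h₁⟩ := hP ε hε
    obtain ⟨N₂, h₂⟩ := hQ ε hε
    refine ⟨max N₁ N₂, fun N hN => ?_⟩
    obtain ⟨t₁, ht₁⟩ := h₁ N (le_of_max_le_left hN)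
    obtain ⟨t₂, ht₂⟩ := h₂ N (le_of_max_le_right hN)
    refine ⟨t₁ + t₂, ?_⟩
    rw [Polynomial.map_add, map_add, mul_add, add_sub_add_comm]
    exact (ξ.2.1 _ _).trans_lt (max_lt ht₁ ht₂)
  | monomial n f =>
    intro ε hε
    obtain ⟨B, hB⟩ : ∃ B : ℝ, Real.exp (-B) * (ξ.1 X ^ n) < ε := by
      have h1 : Filter.Tendsto (fun B : ℝ => Real.exp (-B) * (ξ.1 X ^ n)) Filter.atTop (𝓝 0) := by
        have := (Real.tendsto_exp_neg_atTop_nhds_zero).mul_const (ξ.1 X ^ n)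
        rwa [zero_mul] at this
      exact (h1.eventually_lt_const hε).exists
    obtain ⟨N₀, h⟩ := exists_poly_approx f B
    refine ⟨N₀, fun N hN => ?_⟩
    obtain ⟨p, hp⟩ := h N hN
    refine ⟨monomial n p, ?_⟩
    rw [toPuiseuxPoly_eq_map, map_monomial, map_monomial, C_mul_monomial, ← monomial_sub,
      ← C_mul_X_pow_eq_monomial, map_mul, map_pow, ξ.2.2]
    have h2 := ξ.nonneg X
    calc _ ≤ Real.exp (-(B + N)) * ξ.1 X ^ n := by gcongr
      _ = Real.exp (-B) * ξ.1 X ^ n * Real.exp (-(N : ℝ)) := by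
        rw [neg_add, Real.exp_add]; ring
      _ < _ := by gcongr

variable [IsAlgClosed k] [CharZero k]

theorem map_sigma_pow_of_fixed {F : (Puiseux k)[X]} (h : F.map (sigma k : Puiseux k →+* Puiseux k) = F)
    (j : ℕ) : F.map ((sigma k ^ j : Puiseux k ≃ₐ[LaurentSeries k] Puiseux k) :
      Puiseux k →+* Puiseux k) = F := by
  ext1 i
  rw [coeff_map]
  have h1 : sigma k (F.coeff i) = F.coeff i := by
    conv_rhs => rw [← h, coeff_map]
    rfl
  change (sigma k ^ j) (F.coeff i) = _
  rw [sigma_pow_eq_iterate]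
  exact Function.iterate_fixed h1 j

omit [IsAlgClosed k] [CharZero k] in
theorem map_galois_toPuiseuxPoly (τ : Puiseux k ≃ₐ[LaurentSeries k] Puiseux k) (p : k[X][X]) :
    (toPuiseuxPoly k p).map (τ : Puiseux k →+* Puiseux k) = toPuiseuxPoly k p := by
  ext1 i
  rw [toPuiseuxPoly_eq_map, coeff_map, coeff_map]
  exact τ.commutes _

/-- The values of `ζ(a, |x|^r)` on `k((x))[y]` are powers of `|x|^(1/g)`. -/
theorem exists_zetaA_eq_exp {a : Puiseux k} {r : ℚ} {F : (Puiseux k)[X]}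
    (hF : F.map ((sigma k ^ (per a) : Puiseux k ≃ₐ[LaurentSeries k] Puiseux k) :
      Puiseux k →+* Puiseux k) = F) (h0 : F ≠ 0) :
    ∃ n : ℤ, (zetaA a (r : ℝ)).1 F = Real.exp (-((n : ℝ) / (Nat.lcm (per a) r.den : ℕ))) := by
  obtain ⟨i, hi⟩ := exists_eq_gaussNorm (puiseuxAbs k) (Real.exp (-(r : ℝ))) (taylor a F)
  change (zetaA a (r : ℝ)).1 F = _ at hi
  have hc : (taylor a F).coeff i ≠ 0 := by
    intro h
    rw [h, map_zero, zero_mul] at hi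
    exact (zetaA_pos a r h0).ne' hi
  obtain ⟨q, hq1, hq2, -⟩ := exists_puiseuxAbs_eq hc
  -- Both `F` and `a` are fixed by `σ^(per a)`, hence so are the Taylor coefficients at `a`; their
  -- exponents have denominators dividing `per a`.
  have hfix : (sigma k ^ per a) ((taylor a F).coeff i) = (taylor a F).coeff i := by
    have h1 : (taylor a F).map ((sigma k ^ (per a) : Puiseux k ≃ₐ[LaurentSeries k] Puiseux k) :
        Puiseux k →+* Puiseux k) = taylor (((sigma k ^ (per a) :
          Puiseux k ≃ₐ[LaurentSeries k] Puiseux k) : Puiseux k →+* Puiseux k) a)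
          (F.map ((sigma k ^ (per a) : Puiseux k ≃ₐ[LaurentSeries k] Puiseux k) :
            Puiseux k →+* Puiseux k)) := by rw [map_taylor]
    have h2 : ((sigma k ^ (per a) : Puiseux k ≃ₐ[LaurentSeries k] Puiseux k) :
      Puiseux k →+* Puiseux k) a = a := (sigma_pow_eq_self_iff a _).2 dvd_rfl
    rw [hF, h2] at h1
    have h3 := congrArg (fun G => coeff G i) h1
    simp only [coeff_map] at h3
    exact h3
  rw [sigma_pow_eq_self_iff, per_dvd_iff] at hfix
  obtain ⟨z, hz⟩ := hfix q hq1
  have hg0 : Nat.lcm (per a) r.den ≠ 0 := Nat.lcm_ne_zero (per_pos a).ne' r.den_ne_zero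
  obtain ⟨u, hu⟩ := Nat.dvd_lcm_left (per a) r.den
  obtain ⟨w, hw⟩ := (den_dvd_iff r _).1 (Nat.dvd_lcm_right (per a) r.den)
  refine ⟨u * z + i * w, ?_⟩
  rw [hi, hq2, ← Real.exp_nat_mul, ← Real.exp_add]
  congr 1
  have hg : ((Nat.lcm (per a) r.den : ℕ) : ℝ) ≠ 0 := by exact_mod_cast hg0
  rw [eq_neg_iff_add_eq_zero]
  have e1 : ((Nat.lcm (per a) r.den : ℕ) : ℝ) * q = u * z := by
    have : ((Nat.lcm (per a) r.den : ℕ) : ℚ) * q = u * z := by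
      rw [hu, ← hz]; push_cast; ring
    exact_mod_cast this
  have e2 : ((Nat.lcm (per a) r.den : ℕ) : ℝ) * r = w := by exact_mod_cast hw
  field_simp
  push_cast
  linear_combination -e1 - i * e2

end Approximation

/-! ### Separating conjugates by traces, and the equality of 𝔟 and 𝔤 -/

section FareyB

variable {k : Type*} [Field k] [IsAlgClosed k] [CharZero k]

theorem galAct_sigma_pow_zetaA (a : Puiseux k) (r : ℝ) {j : ℕ} (hj : j ≤ per a) :
    galAct (sigma k ^ j) (zetaA a r) = zetaA ((sigma k ^ (per a - j)) a) r := by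
  rw [galAct_zetaA]
  congr 1
  have h1 : (sigma k ^ j) ((sigma k ^ (per a - j)) a) = a := by
    rw [← AlgEquiv.mul_apply, ← pow_add, Nat.add_sub_cancel' hj]
    exact (sigma_pow_eq_self_iff a _).2 dvd_rfl
  conv_lhs => rw [← h1]
  exact AlgEquiv.symm_apply_apply _ _

/-- A polynomial close to `1` at `ζ(a, |x|^r)` and small at the other conjugates. -/
def separator (a : Puiseux k) : (Puiseux k)[X] :=
  ∏ i ∈ Finset.range (per a - 1), ((X - C ((sigma k ^ (i + 1)) a)) *
    C (a - (sigma k ^ (i + 1)) a)⁻¹)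

theorem sub_sigma_pow_ne_zero (a : Puiseux k) {i : ℕ} (h0 : 0 < i) (hi : i < per a) :
    a - (sigma k ^ i) a ≠ 0 := by
  intro h
  have h1 : (sigma k ^ i) a = a := (sub_eq_zero.1 h).symm
  rw [sigma_pow_eq_self_iff] at h1
  exact absurd (Nat.le_of_dvd h0 h1) (not_le.2 hi)

theorem lt_abs_sub_sigma_pow {a : Puiseux k} {r : ℝ}
    (h : ∀ q : ℚ, a.1.coeff q ≠ 0 → (q : ℝ) < r) {i : ℕ} (h0 : 0 < i) (hi : i < per a) :
    Real.exp (-r) < puiseuxAbs k (a - (sigma k ^ i) a) := by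
  by_contra hcon
  refine sub_sigma_pow_ne_zero a h0 hi (sub_eq_zero.2 ?_)
  exact sigma_pow_eq_of_le (i := 0) h (not_lt.1 hcon)

/-- Each factor differs from `1` by `(y - a) / (a - σ^i a)`, which is small because truncation keeps
the conjugates farther apart than `|x|^r`. -/
theorem separator_sub_one_lt {a : Puiseux k} {r : ℝ}
    (h : ∀ q : ℚ, a.1.coeff q ≠ 0 → (q : ℝ) < r) : (zetaA a r).1 (separator a - 1) < 1 := by
  refine BerkA1.prod_sub_one_lt _ _ _ fun i hi => ?_
  have hi' : i + 1 < per a := by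
    have := Finset.mem_range.1 hi
    omega
  have hne := sub_sigma_pow_ne_zero a i.succ_pos hi'
  have hlt := lt_abs_sub_sigma_pow h i.succ_pos hi'
  have he : (X - C ((sigma k ^ (i + 1)) a)) * C (a - (sigma k ^ (i + 1)) a)⁻¹ - 1 =
      (X - C a) * C (a - (sigma k ^ (i + 1)) a)⁻¹ := by
    have h1 : (1 : (Puiseux k)[X]) = C (a - (sigma k ^ (i + 1)) a) * C (a - (sigma k ^ (i + 1)) a)⁻¹ := by
      rw [← C_mul, mul_inv_cancel₀ hne, C_1]
    conv_lhs => rw [h1]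
    rw [← sub_mul, C_sub]
    ring
  rw [he, map_mul, zetaA_linear, sub_self, map_zero, max_eq_left (Real.exp_pos _).le,
    (zetaA a r).2.2, map_inv₀, ← div_eq_mul_inv, div_lt_one (lt_trans (Real.exp_pos _) hlt)]
  exact hlt

theorem conjPoly_eq_mul_separator (a : Puiseux k) :
    conjPoly a = (X - C a) * separator a *
      C (∏ i ∈ Finset.range (per a - 1), (a - (sigma k ^ (i + 1)) a)) := by
  obtain ⟨m, hm⟩ : ∃ m, per a = m + 1 := ⟨per a - 1, by have := per_pos a; omega⟩
  rw [conjPoly, separator, hm, Nat.add_sub_cancel, Finset.prod_range_succ', mul_assoc, mul_comm]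
  congr 1
  rw [map_prod, ← Finset.prod_mul_distrib]
  refine Finset.prod_congr rfl fun i hi => ?_
  have hne := sub_sigma_pow_ne_zero a i.succ_pos (by have := Finset.mem_range.1 hi; omega)
  rw [mul_assoc, ← C_mul, inv_mul_cancel₀ hne, C_1, mul_one]

/-- The conjugate polynomial is Galois invariant and, up to a constant, equals `(y - a)` times the
separator. At another conjugate point `y - a` is larger than at `ζ(a, |x|^r)`, so the separator must
be smaller than its value `1` there. -/
theorem separator_conj_lt_one {a : Puiseux k} {r : ℝ}
    (h : ∀ q : ℚ, a.1.coeff q ≠ 0 → (q : ℝ) < r) {j : ℕ} (h0 : 0 < j) (hj : j < per a) :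
    (galAct (sigma k ^ j) (zetaA a r)).1 (separator a) < 1 := by
  set η := galAct (sigma k ^ j) (zetaA a r) with hη
  set δ : Puiseux k := ∏ i ∈ Finset.range (per a - 1), (a - (sigma k ^ (i + 1)) a) with hδ
  have hδ0 : δ ≠ 0 := Finset.prod_ne_zero_iff.2 fun i hi =>
    sub_sigma_pow_ne_zero a i.succ_pos (by have := Finset.mem_range.1 hi; omega)
  have h1 : η.1 (conjPoly a) = (zetaA a r).1 (conjPoly a) := by
    rw [hη, galAct_apply, map_sigma_pow_of_fixed (conjPoly_map_sigma a)]
  have h2 : (zetaA a r).1 (separator a) = 1 := by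
    have := (zetaA a r).eq_of_sub_lt (f := separator a) (g := 1)
      (by rw [map_one]; exact separator_sub_one_lt h)
    rwa [map_one] at this
  rw [conjPoly_eq_mul_separator, map_mul, map_mul, map_mul, map_mul, η.2.2, (zetaA a r).2.2, h2,
    mul_one] at h1
  have h3 := mul_right_cancel₀ ((puiseuxAbs k).ne_zero hδ0) h1
  have hlt := lt_abs_sub_sigma_pow h (i := per a - j) (by omega) (by omega)
  rw [hη, galAct_sigma_pow_zetaA a r hj.le, zetaA_linear, zetaA_linear, sub_self, map_zero,
    max_eq_left (Real.exp_pos _).le, (puiseuxAbs k).map_sub, max_eq_right hlt.le] at h3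
  have hη' : (zetaA ((sigma k ^ (per a - j)) a) r).1 (separator a) < 1 := by
    by_contra hcon
    rw [not_lt] at hcon
    have := mul_le_mul hlt.le hcon zero_le_one ((puiseuxAbs k).nonneg _)
    nlinarith [Real.exp_pos (-r)]
  rw [hη, galAct_sigma_pow_zetaA a r hj.le]
  exact hη'

theorem map_sigma_per_separator (a : Puiseux k) :
    (separator a).map ((sigma k ^ per a : Puiseux k ≃ₐ[LaurentSeries k] Puiseux k) :
      Puiseux k →+* Puiseux k) = separator a := by
  have ha : (sigma k ^ per a) a = a := (sigma_pow_eq_self_iff a _).2 dvd_rfl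
  have hai : ∀ i, (sigma k ^ per a) ((sigma k ^ i) a) = (sigma k ^ i) a := by
    intro i
    rw [← AlgEquiv.mul_apply, ← pow_add, add_comm, pow_add, AlgEquiv.mul_apply, ha]
  rw [separator, Polynomial.map_prod]
  refine Finset.prod_congr rfl fun i _ => ?_
  rw [Polynomial.map_mul, Polynomial.map_sub, map_X, map_C, map_C]
  have e1 : ((sigma k ^ per a : Puiseux k ≃ₐ[LaurentSeries k] Puiseux k) :
      Puiseux k →+* Puiseux k) ((sigma k ^ (i + 1)) a) = (sigma k ^ (i + 1)) a := hai (i + 1)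
  have e2 : ((sigma k ^ per a : Puiseux k ≃ₐ[LaurentSeries k] Puiseux k) :
      Puiseux k →+* Puiseux k) a = a := ha
  rw [e1, map_inv₀, map_sub, e1, e2]

/-- The trace of a polynomial over `k((x^(1/n)))`, up to a power of `n`. -/
theorem map_sigma_sum {F : (Puiseux k)[X]} {m : ℕ}
    (hF : F.map ((sigma k ^ m : Puiseux k ≃ₐ[LaurentSeries k] Puiseux k) :
      Puiseux k →+* Puiseux k) = F) :
    (∑ j ∈ Finset.range m, F.map ((sigma k ^ j : Puiseux k ≃ₐ[LaurentSeries k] Puiseux k) :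
      Puiseux k →+* Puiseux k)).map (sigma k : Puiseux k →+* Puiseux k) =
    ∑ j ∈ Finset.range m, F.map ((sigma k ^ j : Puiseux k ≃ₐ[LaurentSeries k] Puiseux k) :
      Puiseux k →+* Puiseux k) := by
  have h1 : (∑ j ∈ Finset.range m, F.map ((sigma k ^ j :
      Puiseux k ≃ₐ[LaurentSeries k] Puiseux k) : Puiseux k →+* Puiseux k)).map
        (sigma k : Puiseux k →+* Puiseux k) =
      ∑ j ∈ Finset.range m, F.map ((sigma k ^ (j + 1) :
        Puiseux k ≃ₐ[LaurentSeries k] Puiseux k) : Puiseux k →+* Puiseux k) := by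
    rw [Polynomial.map_sum]
    refine Finset.sum_congr rfl fun j _ => ?_
    rw [Polynomial.map_map, pow_succ']
    rfl
  have h2 := Finset.sum_range_succ' (fun j => F.map ((sigma k ^ j :
    Puiseux k ≃ₐ[LaurentSeries k] Puiseux k) : Puiseux k →+* Puiseux k)) m
  rw [Finset.sum_range_succ, hF] at h2
  have h3 : F.map ((sigma k ^ 0 : Puiseux k ≃ₐ[LaurentSeries k] Puiseux k) :
      Puiseux k →+* Puiseux k) = F := by
    ext1 i
    rw [coeff_map]
    rfl
  rw [h3] at h2
  rw [h1]
  exact (add_right_cancel h2).symm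

omit [IsAlgClosed k] [CharZero k] in
theorem zetaA_monomial (a : Puiseux k) (r : ℝ) (c : ℚ) (l : ℕ) :
    (zetaA a r).1 (C (mono c 1) * (X - C a) ^ l) = Real.exp (-(c + l * r)) := by
  rw [map_mul, map_pow, zetaA_C_mono, zetaA_linear, sub_self, map_zero,
    max_eq_left (Real.exp_pos _).le, ← Real.exp_nat_mul, ← Real.exp_add]
  congr 1
  ring

/-- The monomials in `x^(1/m)` and `y - a` are approximated at `ζ(a, |x|^r)` by elements of
`k[x, x⁻¹][y]`. -/
theorem exists_approx {a : Puiseux k} {r : ℝ} (h : ∀ q : ℚ, a.1.coeff q ≠ 0 → (q : ℝ) < r)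
    {c : ℚ} (hc : ∃ z : ℤ, (per a : ℚ) * c = z) (l : ℕ) :
    ∃ (N : ℕ) (t : k[X][X]),
      (zetaA a r).1 (toPuiseuxPoly k t - C (mono (N + c) 1) * (X - C a) ^ l) <
        Real.exp (-(N + c + l * r)) := by
  set ζ := zetaA a r with hζ
  set m := per a with hm
  set H : (Puiseux k)[X] := C (mono c 1) * (X - C a) ^ l with hH
  have hHnorm : ζ.1 H = Real.exp (-(c + l * r)) := zetaA_monomial a r c l
  have hHpos : 0 < ζ.1 H := by rw [hHnorm]; exact Real.exp_pos _
  set L := separator a with hL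
  have hHfix : H.map ((sigma k ^ m : Puiseux k ≃ₐ[LaurentSeries k] Puiseux k) :
      Puiseux k →+* Puiseux k) = H := by
    have e1 : ((sigma k ^ m : Puiseux k ≃ₐ[LaurentSeries k] Puiseux k) :
      Puiseux k →+* Puiseux k) a = a := (sigma_pow_eq_self_iff a _).2 dvd_rfl
    have e2 : ((sigma k ^ m : Puiseux k ≃ₐ[LaurentSeries k] Puiseux k) :
      Puiseux k →+* Puiseux k) (mono c 1) = mono c 1 := by
      refine (sigma_pow_eq_self_iff _ _).2 ((per_dvd_iff _ _).2 fun q hq => ?_)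
      obtain rfl : q = c := by
        by_contra hne
        exact hq (HahnSeries.coeff_single_of_ne hne)
      exact hc
    rw [hH, Polynomial.map_mul, Polynomial.map_pow, Polynomial.map_sub, map_X, map_C, map_C, e1, e2]
  -- A high power of the separator makes the product negligible at all other conjugates without
  -- changing its leading part at `ζ`.
  have hev : ∀ᶠ M : ℕ in Filter.atTop, ∀ j ∈ Finset.Ico 1 m,
      (galAct (sigma k ^ j) ζ).1 (H * L ^ M) < ζ.1 H := by
    rw [Filter.eventually_all_finset]
    intro j hj
    rw [Finset.mem_Ico] at hj
    have h1 := separator_conj_lt_one h hj.1 hj.2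
    have h2 : Filter.Tendsto (fun M : ℕ => (galAct (sigma k ^ j) ζ).1 (H * L ^ M))
        Filter.atTop (𝓝 0) := by
      have := (tendsto_pow_atTop_nhds_zero_of_lt_one ((galAct (sigma k ^ j) ζ).nonneg L) h1).const_mul
        ((galAct (sigma k ^ j) ζ).1 H)
      rw [mul_zero] at this
      refine this.congr fun M => ?_
      rw [← map_pow, ← map_mul]
    exact h2.eventually_lt_const hHpos
  obtain ⟨M, hM⟩ := hev.exists
  set F := H * L ^ M with hF
  have hFfix : F.map ((sigma k ^ m : Puiseux k ≃ₐ[LaurentSeries k] Puiseux k) :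
      Puiseux k →+* Puiseux k) = F := by
    rw [hF, Polynomial.map_mul, Polynomial.map_pow, hHfix, hL, hm, map_sigma_per_separator]
  -- The trace is defined over `k((x))`. Only the term `j = 0` matters at `ζ`, since the value of
  -- the others at `ζ` is that of `F` at a conjugate point.
  set T := ∑ j ∈ Finset.range m, F.map ((sigma k ^ j :
    Puiseux k ≃ₐ[LaurentSeries k] Puiseux k) : Puiseux k →+* Puiseux k) with hT
  obtain ⟨Q, hQ⟩ := exists_of_map_sigma (map_sigma_sum hFfix)
  rw [← hT] at hQ
  have hTH : ζ.1 (T - H) < ζ.1 H := by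
    have hmem : 0 ∈ Finset.range m := Finset.mem_range.2 (per_pos a)
    have h3 : F.map ((sigma k ^ 0 : Puiseux k ≃ₐ[LaurentSeries k] Puiseux k) :
        Puiseux k →+* Puiseux k) = F := by
      ext1 i
      rw [coeff_map]
      rfl
    rw [hT, ← Finset.add_sum_erase _ _ hmem, h3, add_sub_right_comm]
    refine (ζ.2.1 _ _).trans_lt (max_lt ?_ ?_)
    · rw [hF, show H * L ^ M - H = H * (L ^ M - 1) by ring, map_mul]
      have h4 : ζ.1 (L ^ M - 1) < 1 := by
        have := ζ.prod_sub_one_lt (Finset.range M) (fun _ => L)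
          (fun _ _ => separator_sub_one_lt h)
        rwa [Finset.prod_const, Finset.card_range] at this
      exact mul_lt_of_lt_one_right hHpos h4
    · refine ζ.sum_lt _ _ hHpos fun j hj => ?_
      rw [Finset.mem_erase, Finset.mem_range] at hj
      exact hM j (Finset.mem_Ico.2 ⟨Nat.pos_of_ne_zero hj.1, hj.2⟩)
  obtain ⟨N, hN⟩ := exists_poly_poly_approx ζ Q (ζ.1 H) hHpos
  obtain ⟨t, ht⟩ := hN N le_rfl
  refine ⟨N, t, ?_⟩
  have e1 : toPuiseuxPoly k t - C (mono (N + c) 1) * (X - C a) ^ l =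
      -(C (mono (N : ℚ) 1) * T - toPuiseuxPoly k t) + C (mono (N : ℚ) 1) * (T - H) := by
    rw [hH, show mono ((N : ℚ) + c) (1 : k) = mono (N : ℚ) 1 * mono c 1 by
      rw [mono_mul, mul_one], C_mul]
    ring
  have e2 : Real.exp (-(N + c + l * r)) = ζ.1 H * Real.exp (-(N : ℝ)) := by
    rw [hHnorm, ← Real.exp_add]
    congr 1
    ring
  rw [e1, e2]
  refine (ζ.2.1 _ _).trans_lt (max_lt ?_ ?_)
  · rw [map_neg_eq_map, ← hQ]
    exact ht
  · rw [map_mul, hζ, zetaA_C_mono, ← hζ, mul_comm, Rat.cast_natCast]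
    exact mul_lt_mul_of_pos_right hTH (Real.exp_pos _)

theorem per_map_fixed (a : Puiseux k) (p : k[X][X]) :
    (toPuiseuxPoly k p).map ((sigma k ^ (per a) : Puiseux k ≃ₐ[LaurentSeries k] Puiseux k) :
      Puiseux k →+* Puiseux k) = toPuiseuxPoly k p := map_galois_toPuiseuxPoly _ p

theorem exists_ratNorm_eq_exp (a : Puiseux k) (r : ℚ) {f : FunField k} (hf : f ≠ 0) :
    ∃ n : ℤ, ratNorm (zetaA a (r : ℝ)) f =
      Real.exp (-((n : ℝ) / (Nat.lcm (per a) r.den : ℕ))) := by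
  obtain ⟨p, h, hh, rfl⟩ := exists_eq_div f
  have hp : p ≠ 0 := by
    rintro rfl
    exact hf (by rw [map_zero, zero_div])
  have key : ∀ p : k[X][X], p ≠ 0 → toPuiseuxPoly k p ≠ 0 := fun p hp h0 =>
    hp (toPuiseuxPoly_injective (h0.trans (map_zero _).symm))
  obtain ⟨n, hn⟩ := exists_zetaA_eq_exp (r := r) (per_map_fixed a p) (key p hp)
  obtain ⟨l, hl⟩ := exists_zetaA_eq_exp (r := r) (per_map_fixed a h) (key h hh)
  refine ⟨n - l, ?_⟩
  rw [ratNorm_div _ _ _ _ hh, hn, hl, ← Real.exp_sub]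
  congr 1
  push_cast
  ring

omit [IsAlgClosed k] [CharZero k] in
/-- An approximation of a monomial in `x^(1/m)` and `y - a` by a quotient `t / x^N`. -/
theorem ratNorm_approx {a : Puiseux k} {r : ℝ} {c : ℚ} {l N : ℕ} {t : k[X][X]}
    (ht : (zetaA a r).1 (toPuiseuxPoly k t - C (mono (N + c) 1) * (X - C a) ^ l) <
        Real.exp (-(N + c + l * r))) :
    (zetaA a r).1 (toPuiseuxPoly k t) = Real.exp (-(N + c + l * r)) ∧
    ratNorm (zetaA a r) (algebraMap _ (FunField k) t / fx k ^ N) = Real.exp (-(c + l * r)) := by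
  have h1 : (zetaA a r).1 (C (mono (N + c) 1) * (X - C a) ^ l) = Real.exp (-(N + c + l * r)) := by
    rw [zetaA_monomial]
    push_cast
    ring_nf
  have h2 : (zetaA a r).1 (toPuiseuxPoly k t) = Real.exp (-(N + c + l * r)) := by
    rw [← h1] at ht ⊢
    exact (zetaA a r).eq_of_sub_lt ht
  refine ⟨h2, ?_⟩
  rw [fx, ← map_pow, ratNorm_div _ _ _ _ (pow_ne_zero _ (C_ne_zero.2 X_ne_zero)), h2, map_pow,
    toPuiseuxPoly_C_X, map_pow, zetaA_C_mono, ← Real.exp_nat_mul, ← Real.exp_sub]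
  congr 1
  push_cast
  ring

/-- The value group bounds the norm of a uniformiser, and the approximation of a monomial of weight
`1/𝔤` attains the bound. -/
theorem unifNorm_zetaA {a : Puiseux k} {r : ℚ} (h : ∀ q : ℚ, a.1.coeff q ≠ 0 → q < r) :
    unifNorm (zetaA a (r : ℝ)) = Real.exp (-(1 / (Nat.lcm (per a) r.den : ℕ))) := by
  have hg0 : 0 < Nat.lcm (per a) r.den := Nat.lcm_pos (per_pos a) r.den_pos
  have hg : (0 : ℝ) < ((Nat.lcm (per a) r.den : ℕ) : ℝ) := by exact_mod_cast hg0
  refine IsGreatest.csSup_eq ⟨⟨?_, ?_⟩, ?_⟩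
  · rw [Real.exp_lt_one_iff]
    have : 0 < 1 / ((Nat.lcm (per a) r.den : ℕ) : ℝ) := by positivity
    linarith
  · obtain ⟨c, l, hc, hcl⟩ := exists_weight (per a) (per_pos a) r
    obtain ⟨N, t, ht⟩ := exists_approx (r := (r : ℝ)) (fun q hq => by exact_mod_cast h q hq) hc l
    refine ⟨_, (ratNorm_approx ht).2.trans ?_⟩
    congr 2
    have := congrArg (Rat.cast (K := ℝ)) hcl
    push_cast at this
    exact this
  · rintro _ ⟨hlt, f, rfl⟩
    by_cases hf : f = 0
    · rw [hf, ratNorm_zero]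
      exact (Real.exp_pos _).le
    · obtain ⟨n, hn⟩ := exists_ratNorm_eq_exp a r hf
      rw [hn] at hlt ⊢
      rw [Real.exp_lt_one_iff, neg_lt_zero] at hlt
      rw [Real.exp_le_exp, neg_le_neg_iff]
      have h1 : (0 : ℝ) < n := by
        have := mul_pos hlt hg
        rwa [div_mul_cancel₀ _ hg.ne'] at this
      have h2 : (1 : ℝ) ≤ n := by exact_mod_cast (show (0 : ℤ) < n by exact_mod_cast h1)
      gcongr

theorem divOrd_fx {a : Puiseux k} {r : ℚ} (h : ∀ q : ℚ, a.1.coeff q ≠ 0 → q < r) :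
    divOrd (zetaA a (r : ℝ)) (fx k) = (Nat.lcm (per a) r.den : ℕ) := by
  have hg0 : 0 < Nat.lcm (per a) r.den := Nat.lcm_pos (per_pos a) r.den_pos
  have hg : (0 : ℝ) < ((Nat.lcm (per a) r.den : ℕ) : ℝ) := by exact_mod_cast hg0
  have hset : {n : ℤ | ratNorm (zetaA a (r : ℝ)) (fx k) ≤ unifNorm (zetaA a (r : ℝ)) ^ n} =
      Set.Iic ((Nat.lcm (per a) r.den : ℕ) : ℤ) := by
    ext n
    rw [Set.mem_ofPred_eq, Set.mem_Iic, ratNorm_fx, unifNorm_zetaA h, ← Real.rpow_intCast,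
      ← Real.exp_mul, Real.exp_le_exp]
    have e1 : -(1 / ((Nat.lcm (per a) r.den : ℕ) : ℝ)) * (n : ℝ) =
      -((n : ℝ) / ((Nat.lcm (per a) r.den : ℕ) : ℝ)) := by ring
    rw [e1, neg_le_neg_iff, div_le_one hg]
    exact_mod_cast Iff.rfl
  rw [divOrd, hset, csSup_Iic]

theorem fareyB_zetaA {a : Puiseux k} {r : ℚ} (h : ∀ q : ℚ, a.1.coeff q ≠ 0 → q < r) :
    fareyB (zetaA a (r : ℝ) : BerkP1 k) = (Nat.lcm (per a) r.den : ℕ) := divOrd_fx h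

/-- This removes `𝔟` from the theorem; only the generic multiplicity remains to be studied. -/
theorem bMult_eq_genMult (ξ : BerkP1 k) : bMult ξ = genMult ξ := by
  by_cases h : IsTypeII ξ
  · rw [bMult, if_pos h]
    obtain ⟨a, r, ha, rfl⟩ := h.exists_truncated
    rw [fareyB_zetaA ha, genMult_zetaA ha, Int.toNat_natCast]
  · rw [bMult, if_neg h]

end FareyB

/-! ### Derivations adapted to a Type II point -/

section EulerDerivation

variable {k : Type*} [Field k] [CharZero k]

/-- The derivation `x d/dx` of the field of Puiseux series. -/
def euler : Derivation ℤ (Puiseux k) (Puiseux k) := by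
  let f : Puiseux k → Puiseux k := fun a =>
    ⟨⟨fun q => (q : k) * a.1.coeff q, a.1.isPWO_support.mono fun q hq h => hq (by
        have h' : a.1.coeff q = 0 := h
        simp [h'])⟩, by
      obtain ⟨n, hn⟩ := a.2
      refine ⟨n, fun q hq => hn q fun h => hq ?_⟩
      have h' : a.1.coeff q = 0 := h
      change (q : k) * a.1.coeff q = 0
      simp [h']⟩
  have hs : ∀ a, (f a).1.support ⊆ a.1.support := fun a q hq h => hq (by
    have h' : a.1.coeff q = 0 := h
    change (q : k) * a.1.coeff q = 0
    simp [h'])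
  refine Derivation.mk' (AddMonoidHom.toIntLinearMap ⟨⟨f, ?_⟩, ?_⟩) ?_
  · refine Subtype.ext (HahnSeries.ext (funext fun q => ?_))
    exact mul_zero _
  · intro a b
    refine Subtype.ext (HahnSeries.ext (funext fun q => ?_))
    exact mul_add _ _ _
  · intro a b
    refine Subtype.ext (HahnSeries.ext (funext fun q => ?_))
    change (q : k) * (a.1 * b.1).coeff q = (a.1 * (f b).1).coeff q + (b.1 * (f a).1).coeff q
    rw [mul_comm b.1, HahnSeries.coeff_mul, HahnSeries.coeff_mul_right' b.1.isPWO_support (hs b),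
      HahnSeries.coeff_mul_left' a.1.isPWO_support (hs a), Finset.mul_sum, ← Finset.sum_add_distrib]
    refine Finset.sum_congr rfl fun ij hij => ?_
    have h1 : ij.1 + ij.2 = q := (Finset.mem_antidiagonal.1 hij).2.2
    change (q : k) * _ = a.1.coeff ij.1 * ((ij.2 : k) * b.1.coeff ij.2) +
      (ij.1 : k) * a.1.coeff ij.1 * b.1.coeff ij.2
    rw [← h1]
    push_cast
    ring

theorem euler_coeff (a : Puiseux k) (q : ℚ) : (euler a).1.coeff q = (q : k) * a.1.coeff q := rfl

omit [CharZero k] in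
theorem mono_zero_mul_coeff (c : k) (a : Puiseux k) (q : ℚ) :
    (mono 0 c * a).1.coeff q = c * a.1.coeff q := by
  have h := HahnSeries.coeff_single_mul_add (r := c) (x := a.1) (a := q) (b := (0 : ℚ))
  rw [add_zero] at h
  exact h

instance : Differential (Puiseux k) := ⟨euler⟩

/-- The derivation of `𝕂[y]` that extends `x d/dx` and for which `y - a` is an eigenvector with
eigenvalue `r`. -/
def eulerAt (a : Puiseux k) (r : ℚ) : Derivation ℤ (Puiseux k)[X] (Puiseux k)[X] :=
  Differential.implicitDeriv (C (euler a) + C (mono 0 (r : k)) * (X - C a))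

theorem eulerAt_C (a : Puiseux k) (r : ℚ) (c : Puiseux k) : eulerAt a r (C c) = C (euler c) :=
  Differential.implicitDeriv_C _ _

theorem eulerAt_X_sub_C (a : Puiseux k) (r : ℚ) :
    eulerAt a r (X - C a) = C (mono 0 (r : k)) * (X - C a) := by
  rw [map_sub, eulerAt_C, eulerAt, Differential.implicitDeriv_X]
  ring

omit [CharZero k] in
theorem mono_zero_natCast (n : ℕ) : mono 0 (n : k) = (n : Puiseux k) := by
  induction n with
  | zero => refine Subtype.ext ?_; simp
  | succ n ih =>
    rw [Nat.cast_succ (R := Puiseux k), ← ih, ← mono_zero_one]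
    refine Subtype.ext ?_
    simp

/-- For `c = x^q` the eigenvalue is `q + n r`, the weight of the monomial at `ζ(a, |x|^r)`. -/
theorem eulerAt_monomial (a : Puiseux k) (r : ℚ) (c : Puiseux k) (n : ℕ) :
    eulerAt a r (C c * (X - C a) ^ n) =
      C (euler c + mono 0 ((n * r : ℚ) : k) * c) * (X - C a) ^ n := by
  have h1 : mono 0 ((n * r : ℚ) : k) = (n : Puiseux k) * mono 0 (r : k) := by
    rw [← mono_zero_natCast, mono_mul]
    push_cast
    rw [zero_add]
  rw [Derivation.leibniz, Derivation.leibniz_pow, eulerAt_C, eulerAt_X_sub_C, h1]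
  simp only [smul_eq_mul, nsmul_eq_mul, C_add, C_mul, map_natCast]
  rcases n with _ | n
  · simp
  · simp only [Nat.add_sub_cancel, pow_succ]
    ring

omit [CharZero k] in
theorem zetaA_term (a : Puiseux k) (r : ℝ) (c : Puiseux k) (n : ℕ) :
    (zetaA a r).1 (C c * (X - C a) ^ n) = puiseuxAbs k c * Real.exp (-(n * r)) := by
  rw [map_mul, map_pow, (zetaA a r).2.2, zetaA_linear, sub_self, map_zero,
    max_eq_left (Real.exp_pos _).le, ← Real.exp_nat_mul]
  congr 2
  ring

omit [CharZero k] in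
/-- The expansion of a polynomial around `a` and the norms of its terms. -/
theorem exists_expansion (a : Puiseux k) (r : ℝ) (F : (Puiseux k)[X]) :
    ∃ (s : Finset ℕ) (c : ℕ → Puiseux k), F = ∑ n ∈ s, C (c n) * (X - C a) ^ n ∧
      ∀ n, puiseuxAbs k (c n) * Real.exp (-(n * r)) ≤ (zetaA a r).1 F := by
  refine ⟨(taylor a F).support, fun n => (taylor a F).coeff n, (sum_taylor_eq F a).symm,
    fun n => ?_⟩
  have h := le_gaussNorm (puiseuxAbs k) (taylor a F) (Real.exp_pos (-r)).le n
  rw [← Real.exp_nat_mul, mul_neg] at h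
  exact h

/-- In the expansion around `a`, the monomials of weight exactly `w` are eigenvectors with
eigenvalue `w` and cancel; every other monomial present has larger weight. -/
theorem eulerAt_sub_lt (a : Puiseux k) (r w : ℚ) {F : (Puiseux k)[X]}
    (hF : (zetaA a (r : ℝ)).1 F ≤ Real.exp (-(w : ℝ))) :
    (zetaA a (r : ℝ)).1 (eulerAt a r F - C (mono 0 (w : k)) * F) < Real.exp (-(w : ℝ)) := by
  obtain ⟨s, c, hc, hb⟩ := exists_expansion a r F
  have h1 : eulerAt a r F - C (mono 0 (w : k)) * F = ∑ n ∈ s,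
      C (euler (c n) + mono 0 ((n * r : ℚ) : k) * c n - mono 0 (w : k) * c n) * (X - C a) ^ n := by
    rw [hc, map_sum, Finset.mul_sum, ← Finset.sum_sub_distrib]
    refine Finset.sum_congr rfl fun n _ => ?_
    rw [eulerAt_monomial]
    simp only [C_add, C_sub, C_mul]
    ring
  rw [h1]
  refine (zetaA a (r : ℝ)).sum_lt _ _ (Real.exp_pos _) fun n _ => ?_
  rw [zetaA_term]
  have h2 : puiseuxAbs k (c n) ≤ Real.exp (-((w : ℝ) - n * r)) := by
    have h3 := (hb n).trans hF
    rw [← le_div_iff₀ (Real.exp_pos _), ← Real.exp_sub] at h3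
    refine h3.trans_eq ?_
    congr 1
    ring
  suffices h3 : puiseuxAbs k (euler (c n) + mono 0 ((n * r : ℚ) : k) * c n - mono 0 (w : k) * c n) <
      Real.exp (-((w : ℝ) - n * r)) by
    rw [← lt_div_iff₀ (Real.exp_pos _), ← Real.exp_sub]
    refine h3.trans_eq ?_
    congr 1
    ring
  rw [puiseuxAbs_le_iff] at h2
  rw [puiseuxAbs_lt_iff]
  intro q hq
  rw [coeff_sub', coeff_add', euler_coeff, mono_zero_mul_coeff, mono_zero_mul_coeff]
  rcases hq.lt_or_eq with hq | hq
  · rw [h2 q hq]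
    ring
  · have : q = w - n * r := by exact_mod_cast hq
    subst this
    push_cast
    ring

omit [CharZero k] in
theorem puiseuxAbs_natCast_le (n : ℕ) : puiseuxAbs k (n : Puiseux k) ≤ 1 := by
  rw [← mono_zero_natCast]
  by_cases hn : (n : k) = 0
  · rw [hn, show mono 0 (0 : k) = 0 from Subtype.ext (by simp), map_zero]
    exact zero_le_one
  · rw [puiseuxAbs_mono _ hn]
    simp

omit [CharZero k] in
theorem zetaA_derivative_le (a : Puiseux k) (r : ℝ) (F : (Puiseux k)[X]) :
    (zetaA a r).1 (derivative F) ≤ Real.exp r * (zetaA a r).1 F := by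
  obtain ⟨s, c, hc, hb⟩ := exists_expansion a r F
  have h0 := (zetaA a r).nonneg F
  conv_lhs => rw [hc, derivative_sum]
  refine (zetaA a r).sum_le _ _ (by positivity) fun n _ => ?_
  rw [derivative_C_mul, derivative_X_sub_C_pow]
  rcases n with _ | n
  · simpa using by positivity
  · rw [Nat.add_sub_cancel, ← mul_assoc, ← C_mul, zetaA_term, map_mul]
    have h1 := hb (n + 1)
    have h2 := puiseuxAbs_natCast_le (k := k) (n + 1)
    have h3 := (puiseuxAbs k).nonneg (c (n + 1))
    calc _ ≤ puiseuxAbs k (c (n + 1)) * 1 * Real.exp (-(n * r)) := by gcongr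
      _ = Real.exp r * (puiseuxAbs k (c (n + 1)) * Real.exp (-(((n + 1 : ℕ) : ℝ) * r))) := by
        rw [mul_one, mul_left_comm, ← Real.exp_add]
        congr 2
        push_cast
        ring
      _ ≤ _ := by gcongr

end EulerDerivation

/-! ### Kähler differentials of a fraction field -/

section Kaehler

variable {k A F : Type*} [Field k] [CommRing A] [Field F] [Algebra k A] [Algebra A F] [Algebra k F]
  [IsScalarTower k A F] [IsFractionRing A F]

/-- Localisation is formally étale, so the differentials of the fraction field are the base change
of those of `A`, and a linear map on the latter extends. -/
theorem exists_kaehler_functional (d : Derivation k A A) :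
    ∃ l : Ω[F⁄k] →ₗ[F] F, ∀ p : A,
      l (KaehlerDifferential.D k F (algebraMap A F p)) = algebraMap A F (d p) := by
  have := Algebra.FormallyEtale.of_isLocalization (Rₘ := F) (nonZeroDivisors A)
  have h := KaehlerDifferential.isBaseChange_of_formallyEtale k A F
  refine ⟨h.lift ((Algebra.linearMap A F).comp d.liftKaehlerDifferential), fun p => ?_⟩
  have h2 := h.lift_eq ((Algebra.linearMap A F).comp d.liftKaehlerDifferential)
    (KaehlerDifferential.D k A p)
  simpa using h2

end Kaehler

/-! ### Partial derivatives -/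

section Partial

variable {k : Type*} [Field k]

variable (k) in
/-- The partial derivative `∂/∂y` of `k[x][y]`. -/
def partialY : Derivation k k[X][X] k[X][X] :=
  (derivative' (R := k[X])).restrictScalars k

variable (k) in
/-- The partial derivative `∂/∂x` of `k[x][y]`. -/
def partialX : Derivation k k[X][X] k[X][X] :=
  PolynomialModule.equivPolynomialSelf.compDer (derivative' (R := k)).mapCoeffs

theorem partialY_apply (p : k[X][X]) : partialY k p = derivative p := rfl

theorem partialX_coeff (p : k[X][X]) (n : ℕ) : (partialX k p).coeff n = derivative (p.coeff n) := rfl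

theorem toPuiseuxPoly_partialY (p : k[X][X]) :
    toPuiseuxPoly k (partialY k p) = derivative (toPuiseuxPoly k p) := by
  rw [partialY_apply, toPuiseuxPoly_eq_map, toPuiseuxPoly_eq_map, derivative_map]

theorem polyToPuiseux_X_mul_derivative [CharZero k] (p : k[X]) :
    polyToPuiseux (X * derivative p) = euler (polyToPuiseux p) := by
  refine Subtype.ext (HahnSeries.ext (funext fun q => ?_))
  rw [euler_coeff]
  by_cases hq : ∃ n : ℕ, q = n
  · obtain ⟨n, rfl⟩ := hq
    rw [polyToPuiseux_coeff_natCast, polyToPuiseux_coeff_natCast]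
    rcases n with _ | n
    · simp
    · rw [coeff_X_mul, coeff_derivative]
      push_cast
      ring
  · have hq' : ∀ n : ℕ, q ≠ n := fun n h => hq ⟨n, h⟩
    rw [polyToPuiseux_coeff_of_ne _ hq', polyToPuiseux_coeff_of_ne _ hq', mul_zero]

/-- On polynomials in `x` and `y` the adapted derivation is `x ∂/∂x` plus a multiple of `∂/∂y`. Its
determinant with `∂/∂y` is thus `x` times the usual Jacobian. -/
theorem eulerAt_toPuiseuxPoly [CharZero k] (a : Puiseux k) (r : ℚ) (p : k[X][X]) :
    eulerAt a r (toPuiseuxPoly k p) = toPuiseuxPoly k (C X * partialX k p) +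
      (C (euler a) + C (mono 0 (r : k)) * (X - C a)) * derivative (toPuiseuxPoly k p) := by
  have h : Differential.mapCoeffs (toPuiseuxPoly k p) = toPuiseuxPoly k (C X * partialX k p) := by
    ext1 n
    rw [Differential.coeff_mapCoeffs, toPuiseuxPoly_eq_map, toPuiseuxPoly_eq_map, coeff_map,
      coeff_map, coeff_C_mul, partialX_coeff, polyToPuiseux_X_mul_derivative]
    rfl
  rw [← h]
  rfl

end Partial

/-! ### Alternating forms in two variables -/

section AlternatingTwo

variable {R M N : Type*} [CommRing R] [AddCommGroup M] [Module R M] [AddCommGroup N] [Module R N]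

theorem alternatingMap_two_apply (φ : M [⋀^Fin 2]→ₗ[R] N) (a b c d : R) (u v : M) :
    φ ![a • u + b • v, c • u + d • v] = (a * d - c * b) • φ ![u, v] := by
  have hadd : ∀ x y z : M, φ ![x + y, z] = φ ![x, z] + φ ![y, z] := fun x y z => by
    have := φ.map_vecCons_add ![z] x y
    simpa using this
  have hsmul : ∀ (t : R) (x z : M), φ ![t • x, z] = t • φ ![x, z] := fun t x z => by
    have := φ.map_vecCons_smul ![z] t x
    simpa using this
  have hswap : ∀ x y : M, φ ![x, y] = - φ ![y, x] := fun x y => by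
    have h := φ.map_swap ![x, y] (i := 0) (j := 1) (by decide)
    have h2 : (![x, y] ∘ Equiv.swap (0 : Fin 2) 1) = ![y, x] := by
      ext i; fin_cases i <;> simp
    rw [h2] at h
    rw [h, neg_neg]
  have hself : ∀ x : M, φ ![x, x] = 0 := fun x =>
    φ.map_eq_zero_of_eq _ (i := 0) (j := 1) rfl (by decide)
  have hadd2 : ∀ x y z : M, φ ![z, x + y] = φ ![z, x] + φ ![z, y] := fun x y z => by
    rw [hswap, hadd, neg_add, ← hswap, ← hswap]
  have hsmul2 : ∀ (t : R) (x z : M), φ ![z, t • x] = t • φ ![z, x] := fun t x z => by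
    rw [hswap, hsmul, ← smul_neg, ← hswap]
  rw [hadd, hsmul, hsmul, hadd2, hadd2, hsmul2, hsmul2, hsmul2, hsmul2, hself, hself, hswap v u]
  module

end AlternatingTwo

/-! ### Jacobians and rational 2-forms -/

section Jacobian

variable {k : Type*} [Field k]

theorem exists_functional (d : Derivation k k[X][X] k[X][X]) :
    ∃ l : Ω[FunField k⁄k] →ₗ[FunField k] FunField k, ∀ p : k[X][X],
      l (KaehlerDifferential.D k (FunField k) (algebraMap _ (FunField k) p)) =
        algebraMap _ (FunField k) (d p) := exists_kaehler_functional d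

/-- The functional `df ↦ ∂f/∂x` on the Kähler differentials of `k(x, y)`. -/
def funX : Ω[FunField k⁄k] →ₗ[FunField k] FunField k := (exists_functional (partialX k)).choose

/-- The functional `df ↦ ∂f/∂y` on the Kähler differentials of `k(x, y)`. -/
def funY : Ω[FunField k⁄k] →ₗ[FunField k] FunField k := (exists_functional (partialY k)).choose

/-- The derivation `∂/∂x` of `k(x, y)`. -/
def derX : Derivation k (FunField k) (FunField k) := funX.compDer (KaehlerDifferential.D _ _)

/-- The derivation `∂/∂y` of `k(x, y)`. -/
def derY : Derivation k (FunField k) (FunField k) := funY.compDer (KaehlerDifferential.D _ _)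

theorem derX_algebraMap (p : k[X][X]) :
    derX (algebraMap _ (FunField k) p) = algebraMap _ (FunField k) (partialX k p) :=
  (exists_functional (partialX k)).choose_spec p

theorem derY_algebraMap (p : k[X][X]) :
    derY (algebraMap _ (FunField k) p) = algebraMap _ (FunField k) (partialY k p) :=
  (exists_functional (partialY k)).choose_spec p

theorem derX_fx : derX (fx k) = 1 := by
  have : partialX k (C X) = 1 := by
    ext1 n
    rw [partialX_coeff, coeff_C, coeff_one]
    split_ifs <;> simp
  rw [fx, derX_algebraMap, this, map_one]

theorem derX_fy : derX (fy k) = 0 := by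
  have : partialX k X = 0 := by
    ext1 n
    rw [partialX_coeff, coeff_X, coeff_zero]
    split_ifs <;> simp
  rw [fy, derX_algebraMap, this, map_zero]

theorem derY_fx : derY (fx k) = 0 := by
  rw [fx, derY_algebraMap, partialY_apply, derivative_C, map_zero]

theorem derY_fy : derY (fy k) = 1 := by
  rw [fy, derY_algebraMap, partialY_apply, derivative_X, map_one]

theorem derivation_funField_ext {M : Type*} [AddCommGroup M] [Module (FunField k) M] [Module k M]
    [Module k[X][X] M] [Module k[X] M]
    [IsScalarTower k[X][X] (FunField k) M] [IsScalarTower k[X] k[X][X] M]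
    {d e : Derivation k (FunField k) M} (hx : d (fx k) = e (fx k)) (hy : d (fy k) = e (fy k)) :
    d = e := by
  have h1 : (d.compAlgebraMap k[X][X]).compAlgebraMap k[X] =
      (e.compAlgebraMap k[X][X]).compAlgebraMap k[X] := derivation_ext hx
  have h2 : ∀ p : k[X][X], d (algebraMap _ (FunField k) p) = e (algebraMap _ (FunField k) p) := by
    intro p
    change d.compAlgebraMap k[X][X] p = e.compAlgebraMap k[X][X] p
    induction p using Polynomial.induction_on' with
    | add p q hp hq => rw [map_add, map_add, hp, hq]
    | monomial n c =>
      have h3 : d.compAlgebraMap k[X][X] (C c) = e.compAlgebraMap k[X][X] (C c) :=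
        DFunLike.congr_fun h1 c
      have h4 : d.compAlgebraMap k[X][X] X = e.compAlgebraMap k[X][X] X := hy
      rw [← C_mul_X_pow_eq_monomial, Derivation.leibniz, Derivation.leibniz, Derivation.leibniz_pow,
        Derivation.leibniz_pow, h3, h4]
  ext f
  obtain ⟨p, h, -, rfl⟩ := exists_eq_div f
  rw [Derivation.leibniz_div, Derivation.leibniz_div, h2, h2]

/-- Both sides are derivations of `k(x,y)`, and a derivation is determined by its values at `x` and
`y`. -/
theorem D_eq (f : FunField k) : KaehlerDifferential.D k (FunField k) f =
    derX f • KaehlerDifferential.D k (FunField k) (fx k) +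
      derY f • KaehlerDifferential.D k (FunField k) (fy k) := by
  let T : Ω[FunField k⁄k] →ₗ[FunField k] Ω[FunField k⁄k] :=
    (funX.smulRight (KaehlerDifferential.D k (FunField k) (fx k))) +
      (funY.smulRight (KaehlerDifferential.D k (FunField k) (fy k)))
  have hT : ∀ f, T.compDer (KaehlerDifferential.D k (FunField k)) f =
    derX f • KaehlerDifferential.D k (FunField k) (fx k) +
      derY f • KaehlerDifferential.D k (FunField k) (fy k) := fun f => rfl
  rw [← hT]
  refine DFunLike.congr_fun (derivation_funField_ext ?_ ?_) f
  · rw [hT, derX_fx, derY_fx, one_smul, zero_smul, add_zero]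
  · rw [hT, derX_fy, derY_fy, one_smul, zero_smul, zero_add]

/-- The Jacobian determinant of two rational functions. -/
def jacobian (f g : FunField k) : FunField k := derX f * derY g - derX g * derY f

theorem wedge_eq (f g : FunField k) : wedge f g = jacobian f g • wedge (fx k) (fy k) := by
  rw [wedge, D_eq f, D_eq g, alternatingMap_two_apply]
  rfl

variable (k) in
/-- The functional `u dx ∧ dy ↦ u` on the rational `2`-forms. -/
def formCoeff : ⋀[FunField k]^2 (Ω[FunField k⁄k]) →ₗ[FunField k] FunField k :=
  exteriorPower.alternatingMapLinearEquiv
    ((Matrix.detRowAlternating (n := Fin 2) (R := FunField k)).compLinearMap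
      (LinearMap.pi ![funX, funY]))

theorem formCoeff_wedge (f g : FunField k) : formCoeff k (wedge f g) = jacobian f g := by
  rw [formCoeff, wedge, exteriorPower.alternatingMapLinearEquiv_apply_ιMulti,
    AlternatingMap.compLinearMap_apply, jacobian, mul_comm (derX g)]
  exact Matrix.det_fin_two _

theorem formCoeff_dx_dy : formCoeff k (wedge (fx k) (fy k)) = 1 := by
  rw [formCoeff_wedge, jacobian, derX_fx, derY_fx, derX_fy, derY_fy]
  ring

end Jacobian

/-! ### Upper bound for Jacobians -/

section FareyA

variable {k : Type*} [Field k] [CharZero k]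

/-- This is `|D(P/H)| < 1` for `|P/H| ≤ 1`, with denominators cleared. Subtracting `w` from `D`
leaves the Wronskian unchanged and makes both terms small. -/
theorem eulerAt_wronskian_le (a : Puiseux k) (r w : ℚ) {P H : (Puiseux k)[X]}
    (hH : (zetaA a (r : ℝ)).1 H = Real.exp (-(w : ℝ)))
    (hP : (zetaA a (r : ℝ)).1 P ≤ Real.exp (-(w : ℝ))) :
    (zetaA a (r : ℝ)).1 (H * eulerAt a r P - P * eulerAt a r H) <
      (zetaA a (r : ℝ)).1 H ^ 2 := by
  rw [show H * eulerAt a r P - P * eulerAt a r H = H * (eulerAt a r P - C (mono 0 (w : k)) * P) -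
    P * (eulerAt a r H - C (mono 0 (w : k)) * H) by ring]
  refine ((zetaA a (r : ℝ)).sub_le _ _).trans_lt (max_lt ?_ ?_)
  · rw [map_mul, pow_two, hH]
    exact mul_lt_mul_of_pos_left (eulerAt_sub_lt a r w hP) (Real.exp_pos _)
  · rw [map_mul, pow_two, hH]
    exact mul_lt_mul_of_le_of_lt_of_nonneg_of_pos hP (eulerAt_sub_lt a r w hH.le)
      ((zetaA a (r : ℝ)).nonneg _) (Real.exp_pos _)

omit [CharZero k] in
theorem derivative_wronskian_le (a : Puiseux k) (r : ℝ) (P H : (Puiseux k)[X]) :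
    (zetaA a r).1 (H * derivative P - P * derivative H) ≤
      Real.exp r * ((zetaA a r).1 P * (zetaA a r).1 H) := by
  have h1 := (zetaA a r).nonneg H
  have h2 := (zetaA a r).nonneg P
  refine ((zetaA a r).sub_le _ _).trans (max_le ?_ ?_)
  · rw [map_mul]
    refine (mul_le_mul_of_nonneg_left (zetaA_derivative_le a r P) h1).trans_eq (by ring)
  · rw [map_mul]
    refine (mul_le_mul_of_nonneg_left (zetaA_derivative_le a r H) h2).trans_eq (by ring)

/-- The norm of a Jacobian in terms of the derivations adapted to a point. -/
theorem ratNorm_jacobian (a : Puiseux k) (r : ℚ) {p h p' h' : k[X][X]} (hh : h ≠ 0) (hh' : h' ≠ 0) :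
    ratNorm (zetaA a (r : ℝ)) (jacobian
      (algebraMap _ (FunField k) p / algebraMap _ (FunField k) h)
      (algebraMap _ (FunField k) p' / algebraMap _ (FunField k) h')) * Real.exp (-1) *
      ((zetaA a (r : ℝ)).1 (toPuiseuxPoly k h) ^ 2 *
        (zetaA a (r : ℝ)).1 (toPuiseuxPoly k h') ^ 2) =
    (zetaA a (r : ℝ)).1
      ((toPuiseuxPoly k h * eulerAt a r (toPuiseuxPoly k p) -
        toPuiseuxPoly k p * eulerAt a r (toPuiseuxPoly k h)) *
       (toPuiseuxPoly k h' * derivative (toPuiseuxPoly k p') -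
        toPuiseuxPoly k p' * derivative (toPuiseuxPoly k h')) -
       (toPuiseuxPoly k h' * eulerAt a r (toPuiseuxPoly k p') -
        toPuiseuxPoly k p' * eulerAt a r (toPuiseuxPoly k h')) *
       (toPuiseuxPoly k h * derivative (toPuiseuxPoly k p) -
        toPuiseuxPoly k p * derivative (toPuiseuxPoly k h))) := by
  have hinj := IsFractionRing.injective k[X][X] (FunField k)
  have n1 : algebraMap _ (FunField k) h ≠ 0 := fun h0 => hh (hinj (h0.trans (map_zero _).symm))
  have n2 : algebraMap _ (FunField k) h' ≠ 0 := fun h0 => hh' (hinj (h0.trans (map_zero _).symm))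
  set J : k[X][X] := (h * partialX k p - p * partialX k h) * (h' * partialY k p' - p' * partialY k h') -
    (h' * partialX k p' - p' * partialX k h') * (h * partialY k p - p * partialY k h) with hJ
  have e1 : jacobian (algebraMap _ (FunField k) p / algebraMap _ (FunField k) h)
      (algebraMap _ (FunField k) p' / algebraMap _ (FunField k) h') =
      algebraMap _ (FunField k) J / algebraMap _ (FunField k) (h ^ 2 * h' ^ 2) := by
    rw [jacobian, Derivation.leibniz_div, Derivation.leibniz_div, Derivation.leibniz_div,
      Derivation.leibniz_div, derX_algebraMap, derX_algebraMap, derX_algebraMap, derX_algebraMap,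
      derY_algebraMap, derY_algebraMap, derY_algebraMap, derY_algebraMap, hJ]
    simp only [map_sub, map_mul, map_pow, smul_eq_mul]
    field_simp
  have e2 : (toPuiseuxPoly k h * eulerAt a r (toPuiseuxPoly k p) -
        toPuiseuxPoly k p * eulerAt a r (toPuiseuxPoly k h)) *
       (toPuiseuxPoly k h' * derivative (toPuiseuxPoly k p') -
        toPuiseuxPoly k p' * derivative (toPuiseuxPoly k h')) -
       (toPuiseuxPoly k h' * eulerAt a r (toPuiseuxPoly k p') -
        toPuiseuxPoly k p' * eulerAt a r (toPuiseuxPoly k h')) *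
       (toPuiseuxPoly k h * derivative (toPuiseuxPoly k p) -
        toPuiseuxPoly k p * derivative (toPuiseuxPoly k h)) =
      toPuiseuxPoly k (C X) * toPuiseuxPoly k J := by
    simp only [eulerAt_toPuiseuxPoly, hJ, map_sub, map_mul, toPuiseuxPoly_partialY]
    ring
  have p1 := zetaA_toPuiseuxPoly_pos a (r : ℝ) hh
  have p2 := zetaA_toPuiseuxPoly_pos a (r : ℝ) hh'
  have e3 : (zetaA a (r : ℝ)).1 (toPuiseuxPoly k (C X) * toPuiseuxPoly k J) =
      Real.exp (-1) * (zetaA a (r : ℝ)).1 (toPuiseuxPoly k J) := by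
    rw [map_mul, toPuiseuxPoly_C_X, zetaA_C_mono, Rat.cast_one]
  rw [e1, e2, e3, ratNorm_div _ _ _ _ (mul_ne_zero (pow_ne_zero 2 hh) (pow_ne_zero 2 hh')), map_mul,
    map_mul (zetaA a (r : ℝ)).1, map_pow, map_pow, map_pow, map_pow]
  field_simp

variable [IsAlgClosed k]

/-- In each product of the determinant, the adapted derivation contributes a factor below `1` and
`∂/∂y` one of at most `e^r`. The remaining `e` comes from dividing by `x`. -/
theorem ratNorm_jacobian_lt (a : Puiseux k) (r : ℚ) {f g : FunField k}
    (hf : ratNorm (zetaA a (r : ℝ)) f ≤ 1) (hg : ratNorm (zetaA a (r : ℝ)) g ≤ 1) :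
    ratNorm (zetaA a (r : ℝ)) (jacobian f g) < Real.exp (r + 1) := by
  obtain ⟨p, h, hh, rfl⟩ := exists_eq_div f
  obtain ⟨p', h', hh', rfl⟩ := exists_eq_div g
  have key := ratNorm_jacobian a r (p := p) (p' := p') hh hh'
  have p1 := zetaA_toPuiseuxPoly_pos a (r : ℝ) hh
  have p2 := zetaA_toPuiseuxPoly_pos a (r : ℝ) hh'
  rw [ratNorm_div _ _ _ _ hh, div_le_one p1] at hf
  rw [ratNorm_div _ _ _ _ hh', div_le_one p2] at hg
  have hexp : ∀ h : k[X][X], h ≠ 0 → ∃ w : ℚ,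
      (zetaA a (r : ℝ)).1 (toPuiseuxPoly k h) = Real.exp (-(w : ℝ)) := by
    intro h hh
    have hinj := IsFractionRing.injective k[X][X] (FunField k)
    obtain ⟨n, hn⟩ := exists_ratNorm_eq_exp a r (f := algebraMap _ (FunField k) h)
      fun h0 => hh (hinj (h0.trans (map_zero _).symm))
    rw [ratNorm_algebraMap] at hn
    exact ⟨n / (Nat.lcm (per a) r.den : ℕ), by rw [hn]; push_cast; rfl⟩
  obtain ⟨w, hw⟩ := hexp h hh
  obtain ⟨w', hw'⟩ := hexp h' hh'
  set ζ := zetaA a (r : ℝ) with hζ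
  have b1 := eulerAt_wronskian_le a r w hw (hw ▸ hf)
  have b2 := eulerAt_wronskian_le a r w' hw' (hw' ▸ hg)
  have c1 : ∀ {P H : (Puiseux k)[X]}, 0 < ζ.1 H → ζ.1 P ≤ ζ.1 H →
      ζ.1 (H * derivative P - P * derivative H) ≤ Real.exp r * ζ.1 H ^ 2 := by
    intro P H hH hP
    refine (derivative_wronskian_le a r P H).trans ?_
    rw [pow_two]
    gcongr
  have d1 := c1 p1 hf
  have d2 := c1 p2 hg
  have hlt : ratNorm ζ (jacobian
      (algebraMap _ (FunField k) p / algebraMap _ (FunField k) h)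
      (algebraMap _ (FunField k) p' / algebraMap _ (FunField k) h')) * Real.exp (-1) *
      (ζ.1 (toPuiseuxPoly k h) ^ 2 * ζ.1 (toPuiseuxPoly k h') ^ 2) <
      Real.exp r * (ζ.1 (toPuiseuxPoly k h) ^ 2 * ζ.1 (toPuiseuxPoly k h') ^ 2) := by
    rw [key]
    refine (ζ.sub_le _ _).trans_lt (max_lt ?_ ?_)
    · rw [map_mul ζ.1]
      refine (mul_lt_mul_of_lt_of_le_of_nonneg_of_pos b1 d2 (ζ.nonneg _) (by positivity)).trans_eq
        (by ring)
    · rw [map_mul ζ.1]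
      refine (mul_lt_mul_of_lt_of_le_of_nonneg_of_pos b2 d1 (ζ.nonneg _) (by positivity)).trans_eq
        (by ring)
  have h3 := lt_of_mul_lt_mul_right hlt (by positivity)
  rw [← lt_div_iff₀ (Real.exp_pos _), ← Real.exp_sub, sub_neg_eq_add] at h3
  exact h3

/-- `g r` is an integer if `g` is a multiple of the denominator of `r`. -/
theorem exists_lcm_mul (m : ℕ) (r : ℚ) : ∃ z : ℤ, ((Nat.lcm m r.den : ℕ) : ℚ) * r = z :=
  (den_dvd_iff r _).1 (Nat.dvd_lcm_right m r.den)

/-- Values are powers of `e^(1/𝔤)`, and `e^(r+1)` is one of them, so the strict bound improves by a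
full step. -/
theorem ratNorm_jacobian_le (a : Puiseux k) (r : ℚ) {f g : FunField k}
    (hf : ratNorm (zetaA a (r : ℝ)) f ≤ 1) (hg : ratNorm (zetaA a (r : ℝ)) g ≤ 1) :
    ratNorm (zetaA a (r : ℝ)) (jacobian f g) ≤
      Real.exp (r + 1 - 1 / (Nat.lcm (per a) r.den : ℕ)) := by
  by_cases hJ : jacobian f g = 0
  · rw [hJ, ratNorm_zero]
    exact (Real.exp_pos _).le
  have hlt := ratNorm_jacobian_lt a r hf hg
  obtain ⟨n, hn⟩ := exists_ratNorm_eq_exp a r hJ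
  obtain ⟨z, hz⟩ := exists_lcm_mul (per a) r
  have hg0 : (0 : ℝ) < ((Nat.lcm (per a) r.den : ℕ) : ℝ) := by
    exact_mod_cast Nat.lcm_pos (per_pos a) r.den_pos
  set G := Nat.lcm (per a) r.den
  have hz' : (G : ℝ) * r = z := by exact_mod_cast congrArg (Rat.cast (K := ℝ)) hz
  rw [hn, Real.exp_lt_exp] at hlt
  rw [hn, Real.exp_le_exp]
  have h1 : (-n : ℝ) < z + G := by
    have := mul_lt_mul_of_pos_left hlt hg0
    rw [mul_add, hz', mul_neg, mul_div_cancel₀ _ hg0.ne', mul_one] at this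
    exact this
  have h2 : -n + 1 ≤ z + G := by
    have : -n < z + G := by exact_mod_cast h1
    omega
  have h3 : (-n + 1 : ℝ) ≤ z + G := by exact_mod_cast h2
  rw [← hz'] at h3
  rw [← mul_le_mul_iff_right₀ hg0]
  field_simp
  linarith

end FareyA

/-! ### Sharpness of the bound, and the log discrepancy -/

section FareyALower

variable {k : Type*} [Field k] [CharZero k]

omit [CharZero k] in
theorem BerkA1.sub_eq_of_lt (ξ : BerkA1 k) {f g : (Puiseux k)[X]} (h : ξ.1 g < ξ.1 f) :
    ξ.1 (f - g) = ξ.1 f := by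
  refine ξ.eq_of_sub_lt ?_
  rwa [sub_sub_cancel_left, map_neg_eq_map]

omit [CharZero k] in
theorem mono_zero_zero : mono 0 (0 : k) = 0 := Subtype.ext (by simp)

theorem euler_mono (q : ℚ) (c : k) : euler (mono q c) = mono 0 (q : k) * mono q c := by
  refine Subtype.ext (HahnSeries.ext (funext fun p => ?_))
  rw [euler_coeff, mono_zero_mul_coeff, mono_val]
  by_cases h : p = q
  · rw [h]
  · rw [HahnSeries.coeff_single_of_ne h, mul_zero, mul_zero]

theorem eulerAt_wronskian_approx {a : Puiseux k} {r c : ℚ} {l N : ℕ} {P : (Puiseux k)[X]}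
    (hP : (zetaA a (r : ℝ)).1 P = Real.exp (-(N + c + l * r))) :
    (zetaA a (r : ℝ)).1 (C (mono N 1) * eulerAt a r P - P * eulerAt a r (C (mono N 1)) -
      C (mono 0 ((c + l * r : ℚ) : k)) * (C (mono N 1) * P)) <
      (zetaA a (r : ℝ)).1 (C (mono N 1) * P) := by
  have h1 := eulerAt_sub_lt a r (N + c + l * r) (F := P) (by rw [hP]; push_cast; exact le_rfl)
  have h2 : mono 0 ((N + c + l * r : ℚ) : k) =
      mono 0 ((N : ℚ) : k) + mono 0 ((c + l * r : ℚ) : k) := by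
    refine Subtype.ext ?_
    change _ = HahnSeries.single _ _ + HahnSeries.single _ _
    rw [mono_val, ← HahnSeries.single_add]
    congr 1
    push_cast
    ring
  rw [eulerAt_C, euler_mono, show C (mono (N : ℚ) 1) * eulerAt a r P -
      P * C (mono 0 ((N : ℚ) : k) * mono (N : ℚ) 1) -
      C (mono 0 ((c + l * r : ℚ) : k)) * (C (mono (N : ℚ) 1) * P) =
      C (mono (N : ℚ) 1) * (eulerAt a r P - C (mono 0 ((N + c + l * r : ℚ) : k)) * P) by
    rw [h2, C_mul, C_add]; ring, map_mul, map_mul]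
  refine mul_lt_mul_of_pos_left (h1.trans_eq ?_) ?_
  · rw [hP]
    push_cast
    rfl
  · rw [zetaA_C_mono]
    exact Real.exp_pos _

theorem zetaA_derivative_approx {a : Puiseux k} {r : ℝ} {c : ℚ} {l N : ℕ} (hl : l ≠ 0)
    {P : (Puiseux k)[X]}
    (hP : (zetaA a r).1 (P - C (mono (N + c) 1) * (X - C a) ^ l) <
      Real.exp (-(N + c + l * r))) :
    (zetaA a r).1 (derivative P) = Real.exp r * Real.exp (-(N + c + l * r)) := by
  have h1 := zetaA_derivative_le a r (P - C (mono (N + c) 1) * (X - C a) ^ l)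
  have h2 : (zetaA a r).1 (derivative (C (mono (N + c) 1) * (X - C a) ^ l)) =
      Real.exp r * Real.exp (-(N + c + l * r)) := by
    obtain ⟨l, rfl⟩ := Nat.exists_eq_succ_of_ne_zero hl
    rw [derivative_C_mul, derivative_X_sub_C_pow, Nat.succ_eq_add_one, Nat.add_sub_cancel,
      ← mul_assoc, ← C_mul, zetaA_term, map_mul,
      puiseuxAbs_mono _ one_ne_zero, ← mono_zero_natCast,
      puiseuxAbs_mono _ (Nat.cast_ne_zero.2 l.succ_ne_zero), ← Real.exp_add, ← Real.exp_add,
      ← Real.exp_add]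
    congr 1
    push_cast
    ring
  rw [derivative_sub] at h1
  rw [← h2]
  refine (zetaA a r).eq_of_sub_lt (h1.trans_lt ?_)
  rw [h2]
  exact mul_lt_mul_of_pos_left hP (Real.exp_pos _)

variable [IsAlgClosed k]

/-- A uniformiser is paired with a function of weight zero that genuinely involves `y - a`. The
adapted derivation multiplies the first by `1/𝔤` up to smaller terms and `∂/∂y` has maximal effect
on the second, so one product of the determinant dominates. -/
theorem exists_ratNorm_jacobian_eq {a : Puiseux k} {r : ℚ}
    (h : ∀ q : ℚ, a.1.coeff q ≠ 0 → q < r) :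
    ∃ f g : FunField k, ratNorm (zetaA a (r : ℝ)) f ≤ 1 ∧ ratNorm (zetaA a (r : ℝ)) g ≤ 1 ∧
      ratNorm (zetaA a (r : ℝ)) (jacobian f g) =
        Real.exp (r + 1 - 1 / (Nat.lcm (per a) r.den : ℕ)) := by
  have hG : 0 < Nat.lcm (per a) r.den := Nat.lcm_pos (per_pos a) r.den_pos
  set G := Nat.lcm (per a) r.den with hGdef
  have hr : ∀ q : ℚ, a.1.coeff q ≠ 0 → (q : ℝ) < r := fun q hq => by exact_mod_cast h q hq
  obtain ⟨c₁, l₁, hc₁, hw₁⟩ := exists_weight (per a) (per_pos a) r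
  obtain ⟨N₁, t₁, ht₁⟩ := exists_approx hr hc₁ l₁
  -- The second function approximates `x^(-r·den r) (y-a)^(den r)`; the power of `x` is integral and
  -- makes the weight zero.
  have hc₂ : ∃ z : ℤ, (per a : ℚ) * (-(r.den * r)) = z := by
    refine ⟨-(per a * r.num), ?_⟩
    rw [mul_comm (r.den : ℚ), Rat.mul_den_eq_num]
    push_cast
    ring
  obtain ⟨N₂, t₂, ht₂⟩ := exists_approx hr hc₂ r.den
  have hw₁' : (c₁ + l₁ * r : ℝ) = 1 / G := by
    have := congrArg (Rat.cast (K := ℝ)) hw₁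
    push_cast at this
    exact this
  have hw₂ : ((-(r.den * r) : ℚ) + r.den * r : ℝ) = 0 := by push_cast; ring
  obtain ⟨n₁, f₁⟩ := ratNorm_approx ht₁
  obtain ⟨n₂, f₂⟩ := ratNorm_approx ht₂
  have hX : ∀ N : ℕ, toPuiseuxPoly k (C X ^ N) = C (mono N 1) := fun N => by
    rw [map_pow, toPuiseuxPoly_C_X, ← C_pow, mono_pow, mul_one]
  have hX0 : ∀ N : ℕ, (C X ^ N : k[X][X]) ≠ 0 := fun N => pow_ne_zero N (C_ne_zero.2 X_ne_zero)
  have hfx : ∀ N : ℕ, fx k ^ N = algebraMap _ (FunField k) (C X ^ N) := fun N => (map_pow _ _ _).symm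
  refine ⟨algebraMap _ (FunField k) t₁ / fx k ^ N₁, algebraMap _ (FunField k) t₂ / fx k ^ N₂,
    ?_, ?_, ?_⟩
  · rw [f₁, Real.exp_le_one_iff, hw₁']
    have : (0 : ℝ) ≤ 1 / G := by positivity
    linarith
  · rw [f₂, hw₂]
    simp
  have key := ratNorm_jacobian a r (p := t₁) (p' := t₂) (hX0 N₁) (hX0 N₂)
  rw [hfx, hfx]
  rw [hX, hX] at key
  have E₁ := eulerAt_wronskian_approx n₁
  have E₂ := eulerAt_wronskian_approx n₂
  have D₂ := zetaA_derivative_approx r.den_ne_zero ht₂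
  have D₁ := derivative_wronskian_le a (r : ℝ) (toPuiseuxPoly k t₁) (C (mono N₁ 1))
  rw [hw₁] at E₁
  rw [show (-(r.den * r) + r.den * r : ℚ) = 0 by ring, Rat.cast_zero, mono_zero_zero, C_0, zero_mul,
    sub_zero] at E₂
  set ζ := zetaA a (r : ℝ) with hζ
  set P₁ := toPuiseuxPoly k t₁
  set P₂ := toPuiseuxPoly k t₂
  have hG0 : ((1 / (G : ℚ) : ℚ) : k) ≠ 0 := by
    rw [Rat.cast_ne_zero]
    positivity
  have E₁' := ζ.eq_of_sub_lt (g := C (mono 0 ((1 / (G : ℚ) : ℚ) : k)) * (C (mono (N₁ : ℚ) 1) * P₁))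
    (E₁.trans_eq (by rw [map_mul ζ.1 (C (mono 0 _)), ζ.2.2, puiseuxAbs_mono _ hG0]; simp))
  rw [map_mul ζ.1 (C (mono 0 _)), ζ.2.2, puiseuxAbs_mono _ hG0, Rat.cast_zero, neg_zero,
    Real.exp_zero, one_mul, map_mul ζ.1 (C (mono (N₁ : ℚ) 1)) P₁] at E₁'
  rw [map_mul ζ.1 (C (mono (N₂ : ℚ) 1)) P₂] at E₂
  rw [derivative_C, mul_zero, sub_zero] at key D₁
  rw [derivative_C, mul_zero, sub_zero] at key
  have m₁ : ζ.1 (C (mono (N₁ : ℚ) 1)) = Real.exp (-N₁) := by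
    rw [zetaA_C_mono]; push_cast; rfl
  have m₂ : ζ.1 (C (mono (N₂ : ℚ) 1)) = Real.exp (-N₂) := by
    rw [zetaA_C_mono]; push_cast; rfl
  have hA : ζ.1 ((C (mono (N₁ : ℚ) 1) * eulerAt a r P₁ - P₁ * eulerAt a r (C (mono (N₁ : ℚ) 1))) *
      (C (mono (N₂ : ℚ) 1) * derivative P₂)) =
      Real.exp r * (ζ.1 (C (mono (N₂ : ℚ) 1)) * ζ.1 P₂) * (ζ.1 P₁ * ζ.1 (C (mono (N₁ : ℚ) 1))) := by
    rw [map_mul ζ.1, E₁', map_mul ζ.1 _ (derivative P₂), D₂, n₂]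
    ring
  have hB : ζ.1 ((C (mono (N₂ : ℚ) 1) * eulerAt a r P₂ - P₂ * eulerAt a r (C (mono (N₂ : ℚ) 1))) *
      (C (mono (N₁ : ℚ) 1) * derivative P₁)) <
      Real.exp r * (ζ.1 (C (mono (N₂ : ℚ) 1)) * ζ.1 P₂) * (ζ.1 P₁ * ζ.1 (C (mono (N₁ : ℚ) 1))) := by
    have h0 : 0 < ζ.1 P₁ * ζ.1 (C (mono (N₁ : ℚ) 1)) := by
      rw [m₁, n₁]
      positivity
    rw [map_mul ζ.1]
    refine (mul_lt_mul_of_lt_of_le_of_nonneg_of_pos E₂ D₁ (ζ.nonneg _) (by positivity)).trans_eq ?_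
    ring
  rw [ζ.sub_eq_of_lt (hB.trans_eq hA.symm), hA, m₁, m₂, n₁, n₂] at key
  have e₁ : Real.exp (-(N₁ + c₁ + l₁ * r)) = Real.exp (-N₁) * Real.exp (-(1 / G)) := by
    rw [← Real.exp_add, ← hw₁']
    congr 1
    ring
  have e₂ : Real.exp (-(N₂ + (-(r.den * r) : ℚ) + r.den * r)) = Real.exp (-N₂) := by
    congr 1
    push_cast
    ring
  have e₃ : Real.exp (r + 1 - 1 / G) * Real.exp (-1) = Real.exp r * Real.exp (-(1 / G)) := by
    rw [← Real.exp_add, ← Real.exp_add]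
    congr 1
    ring
  rw [e₁, e₂] at key
  have p₁ := Real.exp_pos (-(N₁ : ℝ))
  have p₂ := Real.exp_pos (-(N₂ : ℝ))
  refine mul_right_cancel₀ (Real.exp_pos (-1)).ne' (mul_right_cancel₀ (b := Real.exp (-(N₁ : ℝ)) ^ 2 *
    Real.exp (-(N₂ : ℝ)) ^ 2) (by positivity) ?_)
  rw [key, e₃]
  ring

/-- The form `df ∧ dg` is the Jacobian times `dx ∧ dy`, so the order of `dx ∧ dy` is minus the least
order of a Jacobian of functions in the valuation ring. -/
theorem formOrd_zetaA {a : Puiseux k} {r : ℚ} (h : ∀ q : ℚ, a.1.coeff q ≠ 0 → q < r) :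
    (formOrd (zetaA a (r : ℝ)) (wedge (fx k) (fy k)) : ℚ) =
      (Nat.lcm (per a) r.den : ℕ) * r + (Nat.lcm (per a) r.den : ℕ) - 1 := by
  have hG : 0 < Nat.lcm (per a) r.den := Nat.lcm_pos (per_pos a) r.den_pos
  have hϖ := unifNorm_zetaA h
  obtain ⟨z, hz⟩ := exists_lcm_mul (per a) r
  obtain ⟨f, g, hf, hg, hJ⟩ := exists_ratNorm_jacobian_eq h
  have hup : ∀ {f g}, _ := @ratNorm_jacobian_le k _ _ _ a r
  set G := Nat.lcm (per a) r.den with hGdef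
  set ζ := zetaA a (r : ℝ) with hζ
  have hG' : (0 : ℝ) < G := by exact_mod_cast hG
  have hz' : (G : ℝ) * r = z := by exact_mod_cast congrArg (Rat.cast (K := ℝ)) hz
  have hr' : (r : ℝ) = z / G := by rw [← hz', mul_div_cancel_left₀ _ hG'.ne']
  have hpow : ∀ n : ℤ, unifNorm ζ ^ n = Real.exp (-(n / G)) := fun n => by
    rw [hϖ, ← Real.rpow_intCast, ← Real.exp_mul]
    congr 1
    ring
  have hmax : IsGreatest {n : ℤ | wedge (fx k) (fy k) ∈ AddSubgroup.closure
      {η | ∃ u f g : FunField k, ratNorm ζ u ≤ unifNorm ζ ^ n ∧ ratNorm ζ f ≤ 1 ∧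
        ratNorm ζ g ≤ 1 ∧ η = u • wedge f g}} (z + G - 1) := by
    constructor
    · refine AddSubgroup.subset_closure ⟨(jacobian f g)⁻¹, f, g, ?_, hf, hg, ?_⟩
      · rw [hpow, ratNorm_inv, hJ, ← Real.exp_neg, hr']
        refine (congrArg Real.exp ?_).le
        push_cast
        field_simp
      · rw [wedge_eq f g, smul_smul, inv_mul_cancel₀, one_smul]
        intro h0
        rw [h0, ratNorm_zero] at hJ
        exact (Real.exp_pos _).ne hJ
    · intro n hn
      -- The bound on the coefficient of `dx ∧ dy` passes from generators to sums because the norm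
      -- is ultrametric.
      have hle : ∀ η ∈ AddSubgroup.closure
          {η | ∃ u f g : FunField k, ratNorm ζ u ≤ unifNorm ζ ^ n ∧ ratNorm ζ f ≤ 1 ∧
            ratNorm ζ g ≤ 1 ∧ η = u • wedge f g},
          ratNorm ζ (formCoeff k η) ≤ Real.exp (-(n / G)) * Real.exp (r + 1 - 1 / G) := by
        intro η hη
        induction hη using AddSubgroup.closure_induction with
        | mem η hη =>
          obtain ⟨u, f, g, hu, hf, hg, rfl⟩ := hη
          rw [map_smul, smul_eq_mul, formCoeff_wedge, ratNorm_mul]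
          rw [hpow] at hu
          exact mul_le_mul hu (hup hf hg) (ratNorm_nonneg _ _ _) (Real.exp_pos _).le
        | zero =>
          rw [map_zero, ratNorm_zero]
          positivity
        | add x y _ _ hx hy =>
          rw [map_add]
          exact (ratNorm_add_le _ _ _ _).trans (max_le hx hy)
        | neg x _ hx =>
          have h1 : ratNorm ζ (-1 : FunField k) = 1 := by
            have h2 := ratNorm_algebraMap a (r : ℝ) (-1 : k[X][X])
            rwa [map_neg, map_one, map_neg, map_one, map_neg_eq_map, map_one] at h2
          rwa [map_neg, ← neg_one_mul, ratNorm_mul, h1, one_mul]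
      have h1 := hle _ hn
      rw [formCoeff_dx_dy, ratNorm_one, ← Real.exp_add, Real.one_le_exp_iff, hr'] at h1
      have h2 : (n : ℝ) ≤ z + G - 1 := by
        have := mul_nonneg hG'.le h1
        field_simp at this
        linarith
      exact_mod_cast h2
  rw [formOrd, hmax.csSup_eq, hz]
  push_cast
  ring

/-- The log discrepancy of the divisor attached to `ζ(a, |x|^r)`. -/
theorem fareyA_zetaA {a : Puiseux k} {r : ℚ} (h : ∀ q : ℚ, a.1.coeff q ≠ 0 → q < r) :
    (fareyA (zetaA a (r : ℝ) : BerkP1 k) : ℚ) = (Nat.lcm (per a) r.den : ℕ) * r := by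
  have h1 := formOrd_zetaA h
  have h2 := divOrd_fx h
  change ((formOrd (zetaA a (r : ℝ)) (wedge (fx k) (fy k)) - divOrd (zetaA a (r : ℝ)) (fx k) + 1 : ℤ) :
    ℚ) = _
  rw [h2]
  push_cast
  rw [h1]
  ring

end FareyALower

/-! ### Farey neighbours -/

section FareyArithmetic

theorem exists_mul_sub_mul_eq_one (A : ℚ) :
    ∃ (d : ℕ) (n : ℤ), 0 < d ∧ d ≤ A.den ∧ A.num * d - n * A.den = 1 := by
  have hcop : IsCoprime A.num (A.den : ℤ) := A.isCoprime_num_den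
  obtain ⟨u, v, huv⟩ := hcop
  have hd : (0 : ℤ) < A.den := by exact_mod_cast A.den_pos
  have h1 := Int.emod_nonneg (u - 1) hd.ne'
  have h2 := Int.emod_lt_of_pos (u - 1) hd
  have h3 := Int.emod_add_mul_ediv (u - 1) A.den
  -- The shift by one selects the residue of `u` in `1, …, den A` rather than in `0, …, den A - 1`,
  -- so that `d` is positive.
  refine ⟨((u - 1) % A.den + 1).toNat, -v - A.num * ((u - 1) / A.den), by omega, by omega, ?_⟩
  rw [Int.toNat_of_nonneg (by omega)]
  linear_combination huv + A.num * h3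

/-- The fraction `n/d` just below `A` with `d ≤ den A` cannot lie between `B` and `A`, so it is at
most `B`. The size of `den B` then forces equality with `B`. -/
theorem farey_adjacent_aux {A B : ℚ} (hlt : B < A) (hd : B.den ≤ A.den)
    (H : ∀ R, B < R → R < A → A.den < R.den) : (A - B) * A.den * B.den = 1 := by
  obtain ⟨d, n, hd0, hdA, hdet⟩ := exists_mul_sub_mul_eq_one A
  have hA := Rat.mul_den_eq_num A
  have hB := Rat.mul_den_eq_num B
  have hAd : (0 : ℚ) < A.den := by exact_mod_cast A.den_pos
  have hBd : (0 : ℚ) < B.den := by exact_mod_cast B.den_pos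
  have hd' : (0 : ℚ) < d := by exact_mod_cast hd0
  have hdet' : (A.num : ℚ) * d - n * A.den = 1 := by exact_mod_cast hdet
  have hRA : (n / d : ℚ) < A := by
    rw [div_lt_iff₀ hd']
    have : 0 < (A * d - n) * A.den := by
      rw [sub_mul, mul_right_comm, hA, hdet']
      exact one_pos
    have := pos_of_mul_pos_left this hAd.le
    linarith
  have hRden : (n / d : ℚ).den ≤ d :=
    Nat.le_of_dvd hd0 ((den_dvd_iff _ _).2 ⟨n, mul_div_cancel₀ _ hd'.ne'⟩)
  have hRB : (n / d : ℚ) ≤ B := by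
    by_contra! h
    have := H _ h hRA
    omega
  set D : ℤ := A.num * B.den - B.num * A.den with hD
  set u : ℤ := B.num * d - n * B.den with hu
  have hD1 : 0 < D := by
    have h1 : (0 : ℚ) < D := by
      rw [hD]
      push_cast
      rw [← hA, ← hB]
      have : 0 < (A - B) * A.den * B.den := by
        have := sub_pos.2 hlt
        positivity
      linarith
    exact_mod_cast h1
  have hu0 : 0 ≤ u := by
    have h1 : (0 : ℚ) ≤ u := by
      rw [hu]
      push_cast
      rw [← hB]
      rw [div_le_iff₀ hd'] at hRB
      have := mul_nonneg (sub_nonneg.2 hRB) hBd.le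
      linarith
    exact_mod_cast h1
  -- The numerator and denominator of `B` are expanded in the unimodular basis given by `n/d` and
  -- `A`. Positivity of `D` and `den B ≤ den A` leave only `u = 0`; then `D` divides both and is a
  -- unit.
  have hsum : D * d + u * A.den = B.den := by
    rw [hD, hu]
    linear_combination (B.den : ℤ) * hdet
  have hsum2 : D * n + u * A.num = B.num := by
    rw [hD, hu]
    linear_combination (B.num : ℤ) * hdet
  have hu1 : u = 0 := by
    by_contra hne
    have h1 : 1 ≤ u := by omega
    have h2 : (A.den : ℤ) ≤ u * A.den := le_mul_of_one_le_left (by positivity) h1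
    have h3 : 0 < D * d := by positivity
    omega
  rw [hu1, zero_mul, add_zero] at hsum hsum2
  have hunit : IsUnit D := B.isCoprime_num_den.isUnit_of_dvd' ⟨n, hsum2.symm⟩ ⟨d, hsum.symm⟩
  have hone : D = 1 := by
    rcases Int.isUnit_iff.1 hunit with h | h <;> omega
  have : (D : ℚ) = 1 := by exact_mod_cast hone
  rw [hD] at this
  push_cast at this
  rw [← hA, ← hB] at this
  linarith

/-- Two rationals such that everything between them has a larger denominator are Farey
neighbours. -/
theorem farey_adjacent {A B : ℚ} (hlt : B < A)
    (H : ∀ R, B < R → R < A → max A.den B.den < R.den) : (A - B) * A.den * B.den = 1 := by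
  rcases le_total B.den A.den with h | h
  · exact farey_adjacent_aux hlt h fun R h1 h2 => (le_max_left _ _).trans_lt (H R h1 h2)
  · have := farey_adjacent_aux (A := -B) (B := -A) (neg_lt_neg hlt) (by simpa using h)
      fun R h1 h2 => by
        have := (le_max_right _ _).trans_lt (H (-R) (by linarith) (by linarith))
        simpa using this
    rw [Rat.den_neg_eq_den, Rat.den_neg_eq_den] at this
    linarith

/-- The denominators between two Farey neighbours. -/
theorem farey_den {A B R : ℚ} (h : (A - B) * A.den * B.den = 1) (h1 : B < R) (h2 : R < A) :
    ∃ s t : ℕ, 0 < s ∧ 0 < t ∧ R.den = s * A.den + t * B.den := by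
  have hA := Rat.mul_den_eq_num A
  have hB := Rat.mul_den_eq_num B
  have hR := Rat.mul_den_eq_num R
  have hAd : (0 : ℚ) < A.den := by exact_mod_cast A.den_pos
  have hBd : (0 : ℚ) < B.den := by exact_mod_cast B.den_pos
  have hRd : (0 : ℚ) < R.den := by exact_mod_cast R.den_pos
  have key : ∀ {P Q : ℚ}, Q < P → 0 < P.num * Q.den - Q.num * P.den := by
    intro P Q hPQ
    have := Rat.lt_iff Q P |>.1 hPQ
    omega
  have s0 := key h1
  have t0 := key h2
  -- Cramer's rule: `A` and `B` form a unimodular basis, and the coordinates of `R` are its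
  -- determinants with `B` and `A`.
  refine ⟨(R.num * B.den - B.num * R.den).toNat, (A.num * R.den - R.num * A.den).toNat,
    by omega, by omega, ?_⟩
  zify
  rw [Int.toNat_of_nonneg s0.le, Int.toNat_of_nonneg t0.le]
  have : (R.den : ℚ) = (R.num * B.den - B.num * R.den) * A.den +
      (A.num * R.den - R.num * A.den) * B.den := by
    rw [← hA, ← hB]
    linear_combination -(R.den : ℚ) * h
  exact_mod_cast this

theorem farey_coprime {A B : ℚ} (h : (A - B) * A.den * B.den = 1) : Nat.Coprime A.den B.den := by
  have hA := Rat.mul_den_eq_num A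
  have hB := Rat.mul_den_eq_num B
  rw [← Nat.isCoprime_iff_coprime]
  refine ⟨-B.num, A.num, ?_⟩
  have : -(B.num : ℚ) * A.den + A.num * B.den = 1 := by
    rw [← hA, ← hB]
    linear_combination h
  exact_mod_cast this

end FareyArithmetic

/-! ### Adjacent Type II points -/

section Adjacent

variable {k : Type*} [Field k] [IsAlgClosed k] [CharZero k]

theorem exp_neg_lt {s r : ℝ} (h : s < r) : Real.exp (-r) < Real.exp (-s) :=
  Real.exp_lt_exp.2 (neg_lt_neg h)

omit [IsAlgClosed k] [CharZero k] in
theorem mem_disk_of_lt {a : Puiseux k} {r s : ℝ} (h : s < r) : (zetaA a r : BerkP1 k) ∈ disk a s := by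
  rw [coe_mem_disk, zetaA_linear, sub_self, map_zero, max_eq_left (Real.exp_pos _).le]
  exact exp_neg_lt h

/-- Both the truncation of `a` below `q` and the exponent `q` itself occur in `a`, so their
denominators divide `per a`. Consequently a branching exponent forces small generic multiplicity. -/
theorem lcm_per_trunc_dvd {a : Puiseux k} {q : ℚ} (hq : a.1.coeff q ≠ 0) :
    ∃ n : ℕ, genMult (zetaA a (q : ℝ) : BerkP1 k) = n ∧ n ∣ per a := by
  obtain ⟨b, hb, hab, hc⟩ := exists_truncated a (q : ℝ)
  have hb' : ∀ p : ℚ, b.1.coeff p ≠ 0 → p < q := fun p hp => by exact_mod_cast hb p hp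
  refine ⟨_, by rw [hab, genMult_zetaA hb'], Nat.lcm_dvd ?_ ?_⟩
  · rw [per_dvd_iff]
    intro p hp
    refine (per_dvd_iff a _).1 dvd_rfl p ?_
    rwa [← hc p (hb p hp)]
  · exact (den_dvd_iff _ _).2 ((per_dvd_iff a _).1 dvd_rfl q hq)

theorem genMult_le_of_coeff {a : Puiseux k} {q : ℚ} (hq : a.1.coeff q ≠ 0) {r : ℚ}
    (h : ∀ q : ℚ, a.1.coeff q ≠ 0 → q < r) :
    genMult (zetaA a (q : ℝ) : BerkP1 k) ≤ genMult (zetaA a (r : ℝ) : BerkP1 k) := by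
  obtain ⟨n, hn, hdvd⟩ := lcm_per_trunc_dvd hq
  rw [hn, genMult_zetaA h]
  exact_mod_cast Nat.le_of_dvd (Nat.lcm_pos (per_pos a) r.den_pos)
    (hdvd.trans (Nat.dvd_lcm_left _ _))

/-- Truncating below `s` may lose the exponent `s` and change the period, but the least common
multiple with `den s` does not notice. -/
theorem exists_trunc_lcm {a : Puiseux k} {s : ℚ} (ha : ∀ q : ℚ, a.1.coeff q ≠ 0 → q ≤ s) :
    ∃ b : Puiseux k, (∀ q : ℚ, b.1.coeff q ≠ 0 → q < s) ∧
      (zetaA a (s : ℝ)) = zetaA b (s : ℝ) ∧ Nat.lcm (per b) s.den = Nat.lcm (per a) s.den := by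
  obtain ⟨b, hb, hab, hc⟩ := exists_truncated a (s : ℝ)
  refine ⟨b, fun p hp => by exact_mod_cast hb p hp, hab, Nat.dvd_antisymm ?_ ?_⟩
  · refine Nat.lcm_dvd (dvd_trans ?_ (Nat.dvd_lcm_left _ _)) (Nat.dvd_lcm_right _ _)
    rw [per_dvd_iff]
    intro p hp
    refine (per_dvd_iff a _).1 dvd_rfl p ?_
    rwa [← hc p (hb p hp)]
  · refine Nat.lcm_dvd ?_ (Nat.dvd_lcm_right _ _)
    rw [per_dvd_iff]
    intro p hp
    rcases (ha p hp).lt_or_eq with h | rfl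
    · refine (per_dvd_iff b _).1 (Nat.dvd_lcm_left _ _) p ?_
      rwa [hc p (by exact_mod_cast h)]
    · exact (den_dvd_iff _ _).1 (Nat.dvd_lcm_right _ _)

/-- The numerical description of two adjacent points `α = ζ(a, |x|^r)` and `β = ζ(a, |x|^s)`. -/
structure AdjacentData (α β : BerkP1 k) (a : Puiseux k) (r s : ℚ) : Prop where
  lt : s < r
  supp : ∀ q : ℚ, a.1.coeff q ≠ 0 → q ≤ s
  left : α = (zetaA a (r : ℝ) : BerkP1 k)
  right : β = (zetaA a (s : ℝ) : BerkP1 k)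
  det : ((per a : ℚ) * r - per a * s) * ((per a : ℚ) * r).den * ((per a : ℚ) * s).den = 1

namespace AdjacentData

variable {α β : BerkP1 k} {a : Puiseux k} {r s : ℚ}

omit [IsAlgClosed k] [CharZero k] in
theorem supp_lt {a : Puiseux k} {s t : ℚ} (h : ∀ q : ℚ, a.1.coeff q ≠ 0 → q ≤ s) (hst : s < t) :
    ∀ q : ℚ, a.1.coeff q ≠ 0 → q < t := fun q hq => (h q hq).trans_lt hst

theorem genMult_left (h : AdjacentData α β a r s) :
    genMult α = ((per a * ((per a : ℚ) * r).den : ℕ) : ℕ∞) := by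
  rw [h.left, genMult_zetaA (supp_lt h.supp h.lt), lcm_den]

theorem genMult_right (h : AdjacentData α β a r s) :
    genMult β = ((per a * ((per a : ℚ) * s).den : ℕ) : ℕ∞) := by
  obtain ⟨b, hb, hab, hl⟩ := exists_trunc_lcm h.supp
  rw [h.right, hab, genMult_zetaA hb, hl, lcm_den]

theorem prec (h : AdjacentData α β a r s) : Prec α β := by
  refine ⟨?_, ?_⟩
  · rw [h.left, h.right]
    exact mem_closedInterval_of_sep (isOpen_disk a s) (isClosed_insert_disk a s)
      (mem_disk_of_lt (by exact_mod_cast h.lt)) infty_notMem_disk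
  · rw [h.left, h.right]
    intro h'
    have := (zetaA_inj (OnePoint.coe_injective h')).1
    exact h.lt.ne (by exact_mod_cast this)

theorem fareyAdjacent (h : AdjacentData α β a r s) : FareyAdjacent α β := by
  have hα := supp_lt h.supp h.lt
  obtain ⟨b, hb, hab, hl⟩ := exists_trunc_lcm h.supp
  have bα : fareyB α = (per a * ((per a : ℚ) * r).den : ℕ) := by
    rw [h.left, fareyB_zetaA hα, lcm_den]
  have bβ : fareyB β = (per a * ((per a : ℚ) * s).den : ℕ) := by
    rw [h.right, hab, fareyB_zetaA hb, hl, lcm_den]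
  have aα : (fareyA α : ℚ) = (per a * ((per a : ℚ) * r).den : ℕ) * r := by
    rw [h.left, fareyA_zetaA hα, lcm_den]
  have aβ : (fareyA β : ℚ) = (per a * ((per a : ℚ) * s).den : ℕ) * s := by
    rw [h.right, hab, fareyA_zetaA hb, hl, lcm_den]
  have hgcd : Int.gcd (fareyB α) (fareyB β) = per a := by
    rw [bα, bβ, Int.gcd_natCast_natCast, Nat.gcd_mul_left, (farey_coprime h.det).gcd_eq_one, mul_one]
  refine ⟨h.prec, ?_, ?_⟩
  · rw [hgcd]
    have h1 : (fareyA α : ℚ) * fareyB β - fareyB α * fareyA β = (per a : ℚ) := by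
      rw [aα, aβ, bα, bβ]
      push_cast
      linear_combination (per a : ℚ) * h.det
    exact_mod_cast h1
  · rw [hgcd, h.left]
    exact mult_zetaA fun q hq => by exact_mod_cast hα q hq

end AdjacentData

/-- An exponent of `a` strictly between `s` and `r` would give a point with generic multiplicity at
most that of the lower end. Without such exponents, `𝔤` along the path is `per a` times a
denominator, and the Farey criterion applies. -/
theorem exists_adjacentData_of_lt {a : Puiseux k} {r s : ℚ}
    (ha : ∀ q : ℚ, a.1.coeff q ≠ 0 → q < r) (hsr : s < r)
    (H : ∀ t : ℚ, s < t → t < r →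
      max (genMult (zetaA a (r : ℝ) : BerkP1 k)) (genMult (zetaA a (s : ℝ) : BerkP1 k)) <
        genMult (zetaA a (t : ℝ) : BerkP1 k)) :
    AdjacentData (zetaA a (r : ℝ) : BerkP1 k) (zetaA a (s : ℝ) : BerkP1 k) a r s := by
  have hsupp : ∀ q : ℚ, a.1.coeff q ≠ 0 → q ≤ s := by
    intro q hq
    by_contra! h
    exact ((le_max_left _ _).trans_lt (H q h (ha q hq))).not_ge (genMult_le_of_coeff hq ha)
  refine ⟨hsr, hsupp, rfl, rfl, ?_⟩
  have hm : (0 : ℚ) < per a := by exact_mod_cast per_pos a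
  obtain ⟨b, hb, hab, hl⟩ := exists_trunc_lcm hsupp
  refine farey_adjacent (mul_lt_mul_of_pos_left hsr hm) fun R h1 h2 => ?_
  have h3 : s < R / per a := by rwa [lt_div_iff₀ hm, mul_comm]
  have h4 : R / per a < r := by rwa [div_lt_iff₀ hm, mul_comm]
  have h5 := H _ h3 h4
  rw [genMult_zetaA ha, genMult_zetaA (AdjacentData.supp_lt hsupp h3), hab, genMult_zetaA hb, hl,
    lcm_den, lcm_den, lcm_den, mul_div_cancel₀ _ hm.ne'] at h5
  rw [max_lt_iff] at h5 ⊢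
  exact ⟨Nat.lt_of_mul_lt_mul_left (by exact_mod_cast h5.1),
    Nat.lt_of_mul_lt_mul_left (by exact_mod_cast h5.2)⟩

theorem FareyAdjacent.exists_adjacentData {α β : BerkP1 k} (hα : IsTypeII α) (hβ : IsTypeII β)
    (h : FareyAdjacent α β) : ∃ (a : Puiseux k) (r s : ℚ), AdjacentData α β a r s := by
  obtain ⟨⟨hmem, hne⟩, hdet, hmult⟩ := h
  obtain ⟨a, r, ha, rfl⟩ := hα.exists_truncated
  obtain ⟨b, s, hb, rfl⟩ := hβ.exists_truncated
  obtain ⟨t, htr, ht⟩ := closedInterval_infty_subset a r hmem (OnePoint.coe_ne_infty _)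
  obtain rfl : (s : ℝ) = t := (zetaA_inj (OnePoint.coe_injective ht)).1
  have hsr : s < r := by
    refine lt_of_le_of_ne (by exact_mod_cast htr) ?_
    rintro rfl
    exact hne ht
  have A1 := fareyA_zetaA ha
  have A2 := fareyA_zetaA hb
  have B1 := fareyB_zetaA ha
  have B2 := fareyB_zetaA hb
  rw [mult_zetaA fun q hq => by exact_mod_cast ha q hq] at hmult
  have hgcd : Int.gcd (fareyB (zetaA a (r : ℝ) : BerkP1 k)) (fareyB (zetaA b (s : ℝ) : BerkP1 k)) =
      per a := by exact_mod_cast hmult.symm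
  rw [hgcd] at hdet
  -- The equality of `per a` with the gcd is used here: `per a` divides `𝔟(β)`.
  have hdvd : per a ∣ Nat.lcm (per b) s.den := by
    have : (per a : ℤ) ∣ fareyB (zetaA b (s : ℝ) : BerkP1 k) := by
      rw [← hgcd]
      exact Int.gcd_dvd_right ..
    rw [B2] at this
    exact_mod_cast this
  have g1 : 0 < Nat.lcm (per a) r.den := Nat.lcm_pos (per_pos a) r.den_pos
  have g2 : 0 < Nat.lcm (per b) s.den := Nat.lcm_pos (per_pos b) s.den_pos
  have hle : per a ≤ Nat.lcm (per a) r.den := Nat.le_of_dvd g1 (Nat.dvd_lcm_left _ _)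
  have hdet' : ((Nat.lcm (per a) r.den : ℕ) : ℚ) * (Nat.lcm (per b) s.den : ℕ) * (r - s) = per a := by
    have := congrArg (Int.cast (R := ℚ)) hdet
    push_cast at this
    rw [A1, A2, B1, B2] at this
    push_cast at this
    linarith
  -- For an exponent `q` between `s` and `r`, both `G1 (r - q)` and `G2 (q - s)` are positive
  -- integers, so `G1 G2 (r - s) ≥ G1 + G2`. This exceeds `per a`, contradicting the determinant.
  have hsupp : ∀ q : ℚ, a.1.coeff q ≠ 0 → q ≤ s := by
    intro q hq
    by_contra! hlt
    have hqr := ha q hq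
    obtain ⟨z1, hz1⟩ := exists_lcm_mul (per a) r
    obtain ⟨z2, hz2⟩ := (per_dvd_iff a _).1 (Nat.dvd_lcm_left (per a) r.den) q hq
    obtain ⟨z3, hz3⟩ := exists_lcm_mul (per b) s
    obtain ⟨z4, hz4⟩ := (per_dvd_iff a _).1 hdvd q hq
    set G1 := Nat.lcm (per a) r.den
    set G2 := Nat.lcm (per b) s.den
    have g1' : (0 : ℚ) < G1 := by exact_mod_cast g1
    have g2' : (0 : ℚ) < G2 := by exact_mod_cast g2
    have hle' : (per a : ℚ) ≤ G1 := by exact_mod_cast hle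
    have i1 : (1 : ℚ) ≤ G1 * (r - q) := by
      have h0 : 0 < G1 * (r - q) := mul_pos g1' (sub_pos.2 hqr)
      rw [mul_sub, hz1, hz2] at h0 ⊢
      have : 0 < z1 - z2 := by exact_mod_cast h0
      exact_mod_cast (show 1 ≤ z1 - z2 by omega)
    have i2 : (1 : ℚ) ≤ G2 * (q - s) := by
      have h0 : 0 < G2 * (q - s) := mul_pos g2' (sub_pos.2 hlt)
      rw [mul_sub, hz4, hz3] at h0 ⊢
      have : 0 < z4 - z3 := by exact_mod_cast h0
      exact_mod_cast (show 1 ≤ z4 - z3 by omega)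
    have j1 := mul_le_mul_of_nonneg_left i1 g2'.le
    have j2 := mul_le_mul_of_nonneg_left i2 g1'.le
    linarith
  refine ⟨a, r, s, hsr, hsupp, rfl, ht, ?_⟩
  obtain ⟨c, hc, hac, hl⟩ := exists_trunc_lcm hsupp
  have h2 : Nat.lcm (per b) s.den = Nat.lcm (per a) s.den := by
    have h3 := genMult_zetaA hb
    rw [ht, hac, genMult_zetaA hc, hl] at h3
    exact_mod_cast h3.symm
  rw [h2, lcm_den, lcm_den] at hdet'
  have hm : (per a : ℚ) ≠ 0 := by exact_mod_cast (per_pos a).ne'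
  refine mul_left_cancel₀ hm ?_
  push_cast at hdet'
  linarith

end Adjacent

/-! ### Annuli -/

section Domains

variable {k : Type*} [Field k] [IsAlgClosed k] [CharZero k]

theorem genMult_ne_zero (ξ : BerkP1 k) : genMult ξ ≠ 0 := by
  by_cases h : IsTypeII ξ
  · obtain ⟨a, r, ha, rfl⟩ := h.exists_truncated
    rw [genMult_zetaA ha]
    exact_mod_cast (Nat.lcm_pos (per_pos a) r.den_pos).ne'
  · have h' : ¬ ∃ (r : ℚ) (a : Puiseux k), ξ = (zetaA a (r : ℝ) : BerkA1 k) :=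
      fun ⟨r, a, h1⟩ => h ⟨a, r, h1⟩
    rw [genMult, dif_neg h']
    split_ifs
    · exact mult_ne_zero ξ
    · exact ENat.top_ne_zero

omit [IsAlgClosed k] [CharZero k] in
/-- The points `ζ(a, |x|^t)` of finite generic multiplicity are those with rational `t`. -/
theorem exists_rat_of_genMult_ne_top {a : Puiseux k} {t : ℝ}
    (h : genMult (zetaA a t : BerkP1 k) ≠ ⊤) : ∃ q : ℚ, t = q := by
  by_contra hq
  refine h ?_
  rw [genMult, dif_neg, if_neg]
  · rintro (h1 | ⟨z, hz, b, hb⟩)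
    · exact OnePoint.coe_ne_infty _ h1
    · have h2 := hb (X - C b)
      rw [← OnePoint.coe_injective hz, eval_sub, eval_X, eval_C, sub_self, map_zero,
        zetaA_eq_zero_iff] at h2
      exact X_sub_C_ne_zero b h2
  · rintro ⟨s, b, hb⟩
    exact hq ⟨s, (zetaA_inj (OnePoint.coe_injective hb)).1⟩

/-- The factor `c` is there for points off the path: their generic multiplicity is a multiple of
that of the path point they branch from. -/
theorem genMult_zetaA_mem {α β : BerkP1 k} {a : Puiseux k} {r s t : ℚ}
    (h : AdjacentData α β a r s) (h1 : s < t) (h2 : t < r) {n : ℕ∞} {c : ℕ} (hc : 0 < c)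
    (hn : n = ((c * Nat.lcm (per a) t.den : ℕ) : ℕ∞)) :
    n ∈ posSemigroup (genMult α) (genMult β) := by
  have hm : (0 : ℚ) < per a := by exact_mod_cast per_pos a
  obtain ⟨u, v, hu, hv, huv⟩ := farey_den h.det (mul_lt_mul_of_pos_left h1 hm)
    (mul_lt_mul_of_pos_left h2 hm)
  refine ⟨c * u, c * v, by positivity, by positivity, ?_⟩
  rw [hn, h.genMult_left, h.genMult_right, lcm_den, huv]
  push_cast
  ring

theorem max_lt_of_mem_posSemigroup {a b : ℕ} (ha : 0 < a) (hb : 0 < b) {n : ℕ∞}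
    (h : n ∈ posSemigroup (a : ℕ∞) b) : max (a : ℕ∞) b < n := by
  obtain ⟨s, t, hs, ht, rfl⟩ := h
  have h1 : a ≤ s * a := Nat.le_mul_of_pos_left a hs
  have h2 : b ≤ t * b := Nat.le_mul_of_pos_left b ht
  rw [max_lt_iff]
  exact ⟨by exact_mod_cast (show a < s * a + t * b by omega),
    by exact_mod_cast (show b < s * a + t * b by omega)⟩

theorem AdjacentData.max_lt_of_mem {α β : BerkP1 k} {a : Puiseux k} {r s : ℚ}
    (h : AdjacentData α β a r s) {n : ℕ∞}
    (hn : n ≠ ⊤ → n ∈ posSemigroup (genMult α) (genMult β)) :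
    max (genMult α) (genMult β) < n := by
  by_cases hn' : n = ⊤
  · rw [hn', h.genMult_left, h.genMult_right, max_lt_iff]
    exact ⟨ENat.natCast_lt_top _, ENat.natCast_lt_top _⟩
  · have h1 := hn hn'
    rw [h.genMult_left, h.genMult_right] at h1 ⊢
    exact max_lt_of_mem_posSemigroup (Nat.mul_pos (per_pos a) (Rat.den_pos _))
      (Nat.mul_pos (per_pos a) (Rat.den_pos _)) h1

theorem AdjacentData.lt_genMult_of_mem_openInterval {α β : BerkP1 k} {a : Puiseux k} {r s : ℚ}
    (h : AdjacentData α β a r s) {ξ : BerkP1 k} (hξ : ξ ∈ openInterval α β) :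
    max (genMult α) (genMult β) < genMult ξ := by
  refine h.max_lt_of_mem fun hfin => ?_
  obtain ⟨hξ, hne⟩ := hξ
  rw [h.left, h.right] at hξ hne
  obtain ⟨t, ht1, ht2, rfl⟩ := closedInterval_subset a (by exact_mod_cast h.lt.le) hξ
  obtain ⟨t, rfl⟩ := exists_rat_of_genMult_ne_top hfin
  have h1 : s < t := lt_of_le_of_ne (by exact_mod_cast ht1) fun h' => hne (by simp [h'])
  have h2 : t < r := lt_of_le_of_ne (by exact_mod_cast ht2) fun h' => hne (by simp [h'])
  refine genMult_zetaA_mem h h1 h2 one_pos ?_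
  rw [one_mul]
  exact genMult_zetaA (supp_lt h.supp h1)

/-- The points of an annulus are related to the path between its boundary points. -/
theorem annulus_subset {U : Set (BerkP1 k)} (hU : IsPreconnected U) {a : Puiseux k} {r s : ℝ}
    (hsr : s < r) (hα : (zetaA a r : BerkP1 k) ∉ U) (hβ : (zetaA a s : BerkP1 k) ∉ U)
    (hα' : (zetaA a r : BerkP1 k) ∈ closure U) (hβ' : (zetaA a s : BerkP1 k) ∈ closure U)
    {ξ : BerkP1 k} (hξ : ξ ∈ U) :
    ∃ z : BerkA1 k, ξ = z ∧ z.1 (X - C a) < Real.exp (-s) ∧ Real.exp (-r) < z.1 (X - C a) := by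
  have h1 : U ⊆ disk a s := by
    refine (subset_or_disjoint_of_sep (isOpen_disk a s) (isClosed_insert_disk a s) hU hβ).resolve_right
      fun h => ?_
    obtain ⟨x, hx1, hx2⟩ := mem_closure_iff.1 hα' _ (isOpen_disk a s) (mem_disk_of_lt hsr)
    exact Set.disjoint_left.1 h hx2 hx1
  -- Every residue disk at `α` misses `U`, since `U` accumulates at `β`, which lies beyond `α`.
  have h2 : ∀ c, puiseuxAbs k (a - c) ≤ Real.exp (-r) → Disjoint U (disk c r) := by
    intro c hc
    have hac := zetaA_eq hc
    refine (subset_or_disjoint_of_sep (isOpen_disk c r) (isClosed_insert_disk c r) hU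
      (by rwa [← hac])).resolve_left fun h => ?_
    have h3 := closure_minimal (h.trans (Set.subset_insert _ _)) (isClosed_insert_disk c r) hβ'
    rcases h3 with h3 | h3
    · exact hsr.ne (zetaA_inj (OnePoint.coe_injective h3)).1
    · rw [coe_mem_disk, zetaA_linear] at h3
      exact ((le_max_left _ _).trans_lt h3).not_gt (exp_neg_lt hsr)
  obtain ⟨z, hz, rfl⟩ := h1 hξ
  refine ⟨z, rfl, hz, ?_⟩
  by_contra! hle
  obtain ⟨c, hc⟩ := BerkA1.exists_linear_lt hle (fun h => hα (h ▸ hξ))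
  refine Set.disjoint_left.1 (h2 c ?_) hξ (by rwa [coe_mem_disk])
  by_contra! hlt
  have := z.linear_eq (hle.trans_lt hlt)
  linarith

/-- On the path the mediant formula applies. A point off the path lies in an open disk branching
from `ζ(a, |x|^q)`, and `lcm(per a, den q)` divides the multiplicity of every point of that disk. -/
theorem AdjacentData.genMult_mem {α β : BerkP1 k} {a : Puiseux k} {r s : ℚ}
    (h : AdjacentData α β a r s) {U : Set (BerkP1 k)} (hU : IsPreconnected U)
    (hα : α ∉ U) (hβ : β ∉ U) (hα' : α ∈ closure U) (hβ' : β ∈ closure U)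
    {ξ : BerkP1 k} (hξ : ξ ∈ U) (hfin : genMult ξ ≠ ⊤) :
    genMult ξ ∈ posSemigroup (genMult α) (genMult β) := by
  obtain ⟨z, rfl, h1, h2⟩ := annulus_subset hU (a := a) (r := r) (s := s) (by exact_mod_cast h.lt)
    (h.left ▸ hα) (h.right ▸ hβ) (h.left ▸ hα') (h.right ▸ hβ') hξ
  obtain ⟨t, ht⟩ : ∃ t : ℝ, z.1 (X - C a) = Real.exp (-t) :=
    ⟨-Real.log (z.1 (X - C a)), by rw [neg_neg, Real.exp_log ((Real.exp_pos _).trans h2)]⟩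
  rw [ht, Real.exp_lt_exp, neg_lt_neg_iff] at h1 h2
  by_cases hz : z = zetaA a t
  · subst hz
    obtain ⟨t, rfl⟩ := exists_rat_of_genMult_ne_top hfin
    refine genMult_zetaA_mem h (by exact_mod_cast h1) (by exact_mod_cast h2) one_pos ?_
    rw [one_mul]
    exact genMult_zetaA (supp_lt h.supp (by exact_mod_cast h1))
  · obtain ⟨c, hc⟩ := BerkA1.exists_linear_lt ht.le hz
    have hca : puiseuxAbs k (c - a) = Real.exp (-t) := by
      rcases lt_trichotomy (puiseuxAbs k (c - a)) (Real.exp (-t)) with hlt | heq | hgt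
      · have := z.linear_le c a
        rw [ht] at this
        exact absurd (max_lt hc hlt) this.not_gt
      · exact heq
      · have := z.linear_eq (hc.trans hgt)
        rw [ht] at this
        exact this.symm
    have hca0 : c - a ≠ 0 := by
      intro h0
      rw [h0, map_zero] at hca
      exact (Real.exp_pos _).ne hca
    obtain ⟨q, hq1, hq2, hq3⟩ := exists_puiseuxAbs_eq hca0
    obtain rfl : t = q := by
      rw [hq2] at hca
      exact (neg_injective (Real.exp_injective hca)).symm
    have h1' : s < q := by exact_mod_cast h1
    have h2' : q < r := by exact_mod_cast h2
    set b := restr (fun p => p ≤ q) c with hb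
    have hbs : ∀ p : ℚ, b.1.coeff p ≠ 0 → (p : ℝ) ≤ q := by
      intro p hp
      by_contra hlt
      exact hp (restr_coeff_of_not (P := fun p => p ≤ q) (fun h' => hlt (by exact_mod_cast h')) c)
    have hbc : puiseuxAbs k (c - b) < Real.exp (-(q : ℝ)) := by
      rw [puiseuxAbs_lt_iff]
      intro p hp
      rw [coeff_sub', hb, restr_coeff_of (P := fun p => p ≤ q) (by exact_mod_cast hp), sub_self]
    have hzb : z.1 (X - C b) < Real.exp (-(q : ℝ)) := (z.linear_le c b).trans_lt (max_lt hc hbc)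
    have hbp : ∀ p ≤ q, b.1.coeff p = c.1.coeff p := fun p hp =>
      restr_coeff_of (P := fun p => p ≤ q) hp c
    -- Below `q` the series `b` agrees with `a`, whose exponents are all at most `s < q`; at `q` the
    -- coefficient of `a` vanishes while that of `b` does not.
    have hdvd : Nat.lcm (per a) q.den ∣ per b := by
      refine Nat.lcm_dvd ?_ ?_
      · rw [per_dvd_iff]
        intro p hp
        have hps := (h.supp p hp).trans_lt h1'
        refine (per_dvd_iff b _).1 dvd_rfl p ?_
        have := hq3 p hps
        rw [coeff_sub', sub_eq_zero] at this
        rwa [hbp p hps.le, this]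
      · refine (den_dvd_iff _ _).2 ((per_dvd_iff b _).1 dvd_rfl q ?_)
        have haq : a.1.coeff q = 0 := by
          by_contra h0
          exact (h.supp q h0).not_gt h1'
        rw [coeff_sub', haq, sub_zero] at hq1
        rwa [hbp q le_rfl]
    have hdvd2 : ((Nat.lcm (per a) q.den : ℕ) : ℕ∞) ∣ genMult (z : BerkP1 k) :=
      (Nat.cast_dvd_cast hdvd).trans ((per_dvd_mult hbs hzb).trans (mult_dvd_genMult _))
    obtain ⟨w, hw⟩ := hdvd2
    have hL : Nat.lcm (per a) q.den ≠ 0 := (Nat.lcm_pos (per_pos a) q.den_pos).ne'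
    have hw0 : w ≠ 0 := by
      rintro rfl
      exact genMult_ne_zero (z : BerkP1 k) (hw.trans (mul_zero _))
    have hwt : w ≠ ⊤ := by
      rintro rfl
      exact hfin (hw.trans (ENat.mul_top (by exact_mod_cast hL)))
    lift w to ℕ using hwt
    refine genMult_zetaA_mem h h1' h2' (c := w) (Nat.pos_of_ne_zero (by exact_mod_cast hw0)) ?_
    rw [hw]
    push_cast
    ring

/-- If all points separating `α` from `β` have large generic multiplicity, then `α` and `β` are
adjacent. -/
theorem exists_adjacentData {α β : BerkP1 k} (hα : IsTypeII α) (hβ : IsTypeII β) (hne : α ≠ β)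
    (H : ∀ (a : Puiseux k) (t : ℝ),
      (α ∈ disk a t ∧ β ∉ insert (zetaA a t : BerkP1 k) (disk a t)) ∨
      (β ∈ disk a t ∧ α ∉ insert (zetaA a t : BerkP1 k) (disk a t)) →
      max (genMult α) (genMult β) < genMult (zetaA a t : BerkP1 k)) :
    ∃ (a : Puiseux k) (r s : ℚ), AdjacentData α β a r s ∨ AdjacentData β α a r s := by
  obtain ⟨a, r, ha, rfl⟩ := hα.exists_truncated
  obtain ⟨b, s, hb, rfl⟩ := hβ.exists_truncated
  -- When one point lies above the other, the intermediate points of the path separate them.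
  have key : ∀ {a b : Puiseux k} {r s : ℚ}, s < r → puiseuxAbs k (a - b) ≤ Real.exp (-(s : ℝ)) →
      (∀ t : ℚ, s < t → t < r → (zetaA a (r : ℝ) : BerkP1 k) ∈ disk a t ∧
        (zetaA b (s : ℝ) : BerkP1 k) ∉ insert (zetaA a t : BerkP1 k) (disk a t)) := by
    intro a b r s hsr hab t h1 h2
    have h1' : (s : ℝ) < t := by exact_mod_cast h1
    refine ⟨mem_disk_of_lt (by exact_mod_cast h2), ?_⟩
    rw [← zetaA_eq hab]
    rintro (h | h)
    · exact h1'.ne (zetaA_inj (OnePoint.coe_injective h)).1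
    · rw [coe_mem_disk, zetaA_linear] at h
      exact ((le_max_left _ _).trans_lt h).not_gt (exp_neg_lt h1')
  have hsymm : puiseuxAbs k (b - a) = puiseuxAbs k (a - b) := by
    rw [← neg_sub, (puiseuxAbs k).map_neg]
  rcases le_or_gt (puiseuxAbs k (a - b)) (Real.exp (-(s : ℝ))) with hab | hab
  · have hβa := zetaA_eq hab
    rcases lt_trichotomy s r with hsr | rfl | hrs
    · refine ⟨a, r, s, Or.inl ?_⟩
      rw [← hβa]
      refine exists_adjacentData_of_lt ha hsr fun t h1 h2 => ?_
      rw [hβa]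
      exact H a t (Or.inl (key hsr hab t h1 h2))
    · exact absurd (congrArg _ hβa) hne
    · have hab' : puiseuxAbs k (b - a) ≤ Real.exp (-(r : ℝ)) := by
        rw [hsymm]
        exact hab.trans (exp_neg_lt (by exact_mod_cast hrs)).le
      have hαb := zetaA_eq hab'
      refine ⟨b, s, r, Or.inr ?_⟩
      rw [← hαb]
      refine exists_adjacentData_of_lt hb hrs fun t h1 h2 => ?_
      rw [hαb, max_comm]
      exact H b t (Or.inr (key hrs hab' t h1 h2))
  · rcases le_or_gt (puiseuxAbs k (b - a)) (Real.exp (-(r : ℝ))) with hba | hba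
    · have hrs : r < s := by
        rw [hsymm] at hba
        have := hab.trans_le hba
        rw [Real.exp_lt_exp, neg_lt_neg_iff] at this
        exact_mod_cast this
      have hαb := zetaA_eq hba
      refine ⟨b, s, r, Or.inr ?_⟩
      rw [← hαb]
      refine exists_adjacentData_of_lt hb hrs fun t h1 h2 => ?_
      rw [hαb, max_comm]
      exact H b t (Or.inr (key hrs hba t h1 h2))
    -- Neither point lies above the other. Their join is at the first exponent `q` where `a` and `b`
    -- differ; one of the two has a nonzero coefficient there, so the join has generic multiplicity
    -- at most that of the corresponding end.
    · exfalso
      have h0 : a - b ≠ 0 := by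
        intro h0
        rw [h0, map_zero] at hab
        exact hab.not_ge (Real.exp_pos _).le
      obtain ⟨q, hq1, hq2, hq3⟩ := exists_puiseuxAbs_eq h0
      rw [hsymm, hq2, Real.exp_lt_exp, neg_lt_neg_iff] at hba
      rw [hq2, Real.exp_lt_exp, neg_lt_neg_iff] at hab
      have hγ := H a q (Or.inl ⟨mem_disk_of_lt hba, by
        rintro (h | h)
        · exact hab.ne' (zetaA_inj (OnePoint.coe_injective h)).1
        · rw [coe_mem_disk, zetaA_linear, hsymm, hq2] at h
          exact (le_max_right _ _).not_gt h⟩)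
      rw [max_lt_iff] at hγ
      by_cases haq : a.1.coeff q = 0
      · have hbq : b.1.coeff q ≠ 0 := by
          rw [coeff_sub', haq, zero_sub, neg_ne_zero] at hq1
          exact hq1
        rw [zetaA_eq hq2.le] at hγ
        exact hγ.2.not_ge (genMult_le_of_coeff hbq hb)
      · exact hγ.1.not_ge (genMult_le_of_coeff haq ha)

end Domains

/-! ### Disks -/

section Disks

variable {k : Type*} [Field k] [IsAlgClosed k] [CharZero k]

omit [IsAlgClosed k] [CharZero k] in
theorem notMem_of_mem_frontier {U : Set (BerkP1 k)} (hU : IsOpen U) {ξ : BerkP1 k}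
    (h : ξ ∈ frontier U) : ξ ∉ U := by
  rw [hU.frontier_eq] at h
  exact h.2

/-- A domain whose boundary point is not above the point `ζ(a, |x|^s)` of the domain
contains `∞`. -/
theorem infty_mem_of_zetaA_mem {U : Set (BerkP1 k)} (hU : IsOpen U) {a : Puiseux k} {s : ℝ}
    (hs : (zetaA a s : BerkP1 k) ∈ U) {ζ : BerkA1 k} (hf : frontier U = {(ζ : BerkP1 k)})
    (hζ : ∀ t ≤ s, ζ ≠ zetaA a t) : (OnePoint.infty : BerkP1 k) ∈ U := by
  set S : Set (BerkP1 k) := (fun t : ℝ => (zetaA a t : BerkP1 k)) '' Set.Iic s with hS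
  have hpre : IsPreconnected (insert OnePoint.infty S) := by
    refine IsPreconnected.subset_closure (isPreconnected_Iic.image _
      (OnePoint.continuous_coe.comp (continuous_zetaA a)).continuousOn) (Set.subset_insert _ _)
      (Set.insert_subset ?_ subset_closure)
    exact mem_closure_of_tendsto (tendsto_zetaA_atBot a)
      ((Filter.eventually_le_atBot s).mono fun t ht => ⟨t, ht, rfl⟩)
  refine hpre.subset_left_of_subset_union hU isClosed_closure.isOpen_compl
    (Set.disjoint_left.2 fun x hx hx' => hx' (subset_closure hx)) ?_
    ⟨_, Or.inr ⟨s, Set.mem_Iic.2 le_rfl, rfl⟩, hs⟩ (Set.mem_insert _ _)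
  intro x hx
  by_cases hxU : x ∈ closure U
  · by_contra hcon
    have hxf : x ∈ frontier U := by
      rw [hU.frontier_eq]
      exact ⟨hxU, fun h => hcon (Or.inl h)⟩
    rw [hf] at hxf
    obtain rfl : x = ζ := hxf
    rcases hx with hx | ⟨t, ht, hx⟩
    · exact OnePoint.coe_ne_infty _ hx
    · exact hζ t ht (OnePoint.coe_injective hx).symm
  · exact Or.inr hxU

/-- From a point outside the closed disk, connectedness of `U` reaches the join of that point with
the boundary point. The ray from the join to `∞` avoids the boundary, which would put `∞` in `U`. -/
theorem le_of_infty_notMem {U : Set (BerkP1 k)} (hU : IsOpen U) (hc : IsPreconnected U)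
    {a : Puiseux k} {r : ℝ} (hf : frontier U = {(zetaA a r : BerkP1 k)})
    (hinf : (OnePoint.infty : BerkP1 k) ∉ U) {ξ : BerkA1 k} (hξ : (ξ : BerkP1 k) ∈ U) :
    ξ.1 (X - C a) ≤ Real.exp (-r) := by
  by_contra! hlt
  obtain ⟨s, hs⟩ : ∃ s : ℝ, ξ.1 (X - C a) = Real.exp (-s) :=
    ⟨-Real.log (ξ.1 (X - C a)), by rw [neg_neg, Real.exp_log ((Real.exp_pos _).trans hlt)]⟩
  rw [hs, Real.exp_lt_exp, neg_lt_neg_iff] at hlt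
  refine hinf (infty_mem_of_zetaA_mem hU (a := a) (s := s) ?_ hf ?_)
  · by_cases h : ξ = zetaA a s
    · rwa [← h]
    obtain ⟨c, hcξ⟩ := BerkA1.exists_linear_lt hs.le h
    have hac : puiseuxAbs k (c - a) = Real.exp (-s) := by
      rcases lt_trichotomy (puiseuxAbs k (c - a)) (Real.exp (-s)) with hlt | heq | hgt
      · have := ξ.linear_le c a
        rw [hs] at this
        exact absurd (max_lt hcξ hlt) this.not_gt
      · exact heq
      · have := ξ.linear_eq (hcξ.trans hgt)
        rw [hs] at this
        exact this.symm
    rw [← zetaA_eq hac.le]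
    refine mem_of_sep (isOpen_disk c s) (isClosed_insert_disk c s) hc
      ((coe_mem_disk).2 hcξ) ?_ (subset_closure hξ)
      (frontier_subset_closure (hf ▸ Set.mem_singleton _))
    rintro (h | h)
    · exact hlt.ne' (zetaA_inj (OnePoint.coe_injective h)).1
    · rw [coe_mem_disk, zetaA_linear, ← neg_sub c a, (puiseuxAbs k).map_neg, hac] at h
      exact (le_max_right _ _).not_gt h
  · intro t ht h
    exact (ht.trans_lt hlt).ne' (zetaA_inj h).1

theorem multSet_eq {U : Set (BerkP1 k)} {n : ℕ∞} (h : ∀ ξ ∈ U, n ∣ mult ξ) {ξ : BerkP1 k}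
    (hξ : ξ ∈ U) (hn : mult ξ = n) : multSet U = n := by
  refine le_antisymm ((iInf₂_le ξ hξ).trans_eq hn) (le_iInf₂ fun η hη => ?_)
  obtain ⟨w, hw⟩ := h η hη
  rw [hw]
  refine le_mul_of_one_le_right zero_le (Order.one_le_iff_ne_zero.2 ?_)
  rintro rfl
  exact mult_ne_zero η (hw.trans (mul_zero _))

/-- The multiplicity of a disk divides the multiplicities of all its points. -/
theorem multSet_dvd {U : Set (BerkP1 k)} (hU : IsOpen U) (hc : IsConnected U) {a : Puiseux k}
    {r : ℝ} (hf : frontier U = {(zetaA a r : BerkP1 k)}) {η : BerkP1 k} (hη : η ∈ U) :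
    multSet U ∣ mult η := by
  have hζcl : (zetaA a r : BerkP1 k) ∈ closure U :=
    frontier_subset_closure (hf ▸ Set.mem_singleton _)
  have hζU : (zetaA a r : BerkP1 k) ∉ U := notMem_of_mem_frontier hU (hf ▸ Set.mem_singleton _)
  suffices h : ∃ n : ℕ∞, (∀ ξ ∈ U, n ∣ mult ξ) ∧ ∃ ξ ∈ U, mult ξ = n by
    obtain ⟨n, h1, ξ, hξ, h2⟩ := h
    rw [multSet_eq h1 hξ h2]
    exact h1 η hη
  -- If `∞` belongs to the disk, the minimal multiplicity is `1`. Otherwise the disk lies in `D(b,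
  -- r)` and the minimum is `per b`.
  by_cases hinf : (OnePoint.infty : BerkP1 k) ∈ U
  · exact ⟨1, fun ξ _ => one_dvd _, _, hinf, mult_infty⟩
  have hcoe : ∀ ξ ∈ U, ∃ z : BerkA1 k, ξ = z := by
    intro ξ hξ
    induction ξ using OnePoint.rec with
    | infty => exact absurd hξ hinf
    | coe z => exact ⟨z, rfl⟩
  obtain ⟨ξ, hξ⟩ := hc.nonempty
  obtain ⟨ξ, rfl⟩ := hcoe ξ hξ
  have hle := le_of_infty_notMem hU hc.isPreconnected hf hinf hξ
  obtain ⟨c, hcξ⟩ := BerkA1.exists_linear_lt hle fun h => hζU (h ▸ hξ)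
  set b := restr (fun p : ℚ => (p : ℝ) ≤ r) c with hb
  have hbs : ∀ p : ℚ, b.1.coeff p ≠ 0 → (p : ℝ) ≤ r := by
    intro p hp
    by_contra hlt
    exact hp (restr_coeff_of_not (P := fun p : ℚ => (p : ℝ) ≤ r) hlt c)
  have hbc : puiseuxAbs k (c - b) < Real.exp (-r) := by
    rw [puiseuxAbs_lt_iff]
    intro p hp
    rw [coeff_sub', hb, restr_coeff_of (P := fun p : ℚ => (p : ℝ) ≤ r) hp, sub_self]
  have hbξ : ξ.1 (X - C b) < Real.exp (-r) := (ξ.linear_le c b).trans_lt (max_lt hcξ hbc)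
  have hab : zetaA a r = zetaA b r := by
    refine zetaA_eq ?_
    by_contra! hlt
    rw [← neg_sub b a, (puiseuxAbs k).map_neg] at hlt
    have := ξ.linear_eq (hbξ.trans hlt)
    linarith
  have hsub : U ⊆ disk b r := by
    refine (subset_or_disjoint_of_sep (isOpen_disk b r) (isClosed_insert_disk b r)
      hc.isPreconnected (hab ▸ hζU)).resolve_right fun h => ?_
    exact Set.disjoint_left.1 h hξ ((coe_mem_disk).2 hbξ)
  refine ⟨per b, fun ζ hζ => ?_, ?_⟩
  · obtain ⟨z, rfl⟩ := hcoe ζ hζ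
    exact per_dvd_mult hbs ((coe_mem_disk).1 (hsub hζ))
  -- The minimum is attained at `ζ(b, |x|^s)`, a point of `U` because it equals `ξ` or separates `ξ`
  -- from the boundary. Since `s > r`, all exponents of `b` lie below `s`. If `ξ` vanishes on `y -
  -- b`, any `s > r` will do.
  obtain ⟨s, hrs, hs⟩ : ∃ s > r, ξ.1 (X - C b) ≤ Real.exp (-s) := by
    rcases (ξ.nonneg (X - C b)).eq_or_lt with h0 | h0
    · exact ⟨r + 1, by linarith, h0 ▸ (Real.exp_pos _).le⟩
    · refine ⟨-Real.log (ξ.1 (X - C b)), ?_, by rw [neg_neg, Real.exp_log h0]⟩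
      have := (Real.log_lt_iff_lt_exp h0).2 hbξ
      linarith
  refine ⟨zetaA b s, ?_, mult_zetaA fun q hq => (hbs q hq).trans_lt hrs⟩
  by_cases h : ξ = zetaA b s
  · rwa [← h]
  obtain ⟨d, hd⟩ := BerkA1.exists_linear_lt hs h
  have hdb : puiseuxAbs k (d - b) ≤ Real.exp (-s) := by
    by_contra! hlt
    have := ξ.linear_eq (hd.trans hlt)
    linarith
  rw [← zetaA_eq hdb]
  refine mem_of_sep (isOpen_disk d s) (isClosed_insert_disk d s) hc.isPreconnected
    ((coe_mem_disk).2 hd) ?_ (subset_closure hξ) hζcl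
  rintro (h | h)
  · exact hrs.ne (zetaA_inj (OnePoint.coe_injective h)).1
  · rw [coe_mem_disk, zetaA_linear] at h
    exact ((le_max_left _ _).trans_lt h).not_gt (exp_neg_lt hrs)

end Disks

/-! ### The Farey conditions for disks and annuli -/

section Farey

variable {k : Type*} [Field k]

theorem IsGammaDomain.isConnected {Γ U : Set (BerkP1 k)} (h : IsGammaDomain Γ U) :
    IsConnected U := by
  obtain ⟨-, ξ, hξ, rfl⟩ := h
  exact isConnected_connectedComponentIn_iff.2 hξ

theorem posSemigroup_comm (a b : ℕ∞) : posSemigroup a b = posSemigroup b a := by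
  have key : ∀ a b, posSemigroup a b ⊆ posSemigroup b a := fun a b n ⟨s, t, hs, ht, h⟩ =>
    ⟨t, s, ht, hs, h.trans (add_comm _ _)⟩
  exact (key a b).antisymm (key b a)

theorem isFarey_disk_iff {U : Set (BerkP1 k)} (hU : IsOpen U) (hc : IsConnected U) {ζ : BerkP1 k}
    (hII : IsTypeII ζ) (hf : frontier U = {ζ}) : IsFarey U ↔ multSet U = genMult ζ := by
  constructor
  · rintro ⟨-, -, ⟨ξ, -, h1, h2⟩ | ⟨α, β, -, -, hne, h1, -⟩⟩
    · rw [hf, Set.singleton_eq_singleton_iff] at h1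
      rwa [h1]
    · rw [hf] at h1
      have hα : α ∈ ({ζ} : Set (BerkP1 k)) := h1 ▸ Set.mem_insert _ _
      have hβ : β ∈ ({ζ} : Set (BerkP1 k)) := h1 ▸ Set.mem_insert_of_mem _ rfl
      exact absurd (hα.trans hβ.symm) hne
  · exact fun h => ⟨hU, hc, Or.inl ⟨ζ, hII, hf, h⟩⟩

theorem isFarey_annulus_iff {U : Set (BerkP1 k)} (hU : IsOpen U) (hc : IsConnected U)
    {α β : BerkP1 k} (hα : IsTypeII α) (hβ : IsTypeII β) (hne : α ≠ β) (hf : frontier U = {α, β}) :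
    IsFarey U ↔ ∀ ξ ∈ U, max (genMult α) (genMult β) < genMult ξ := by
  constructor
  · rintro ⟨-, -, ⟨ζ, -, h1, -⟩ | ⟨α', β', -, -, -, h1, h2⟩⟩
    · rw [hf] at h1
      have hα : α ∈ ({ζ} : Set (BerkP1 k)) := h1 ▸ Set.mem_insert _ _
      have hβ : β ∈ ({ζ} : Set (BerkP1 k)) := h1 ▸ Set.mem_insert_of_mem _ rfl
      exact absurd (hα.trans hβ.symm) hne
    · rw [hf, Set.pair_eq_pair_iff] at h1
      rcases h1 with ⟨rfl, rfl⟩ | ⟨rfl, rfl⟩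
      · exact h2
      · rwa [max_comm]
  · exact fun h => ⟨hU, hc, Or.inr ⟨α, β, hα, hβ, hne, hf, h⟩⟩

/-- An infimum over a nonempty set of extended naturals is attained, so strict inequality survives.
-/
theorem ENat.lt_biInf_iff {ι : Type*} {s : Set ι} (hs : s.Nonempty) (f : ι → ℕ∞) (a : ℕ∞) :
    a < ⨅ i ∈ s, f i ↔ ∀ i ∈ s, a < f i := by
  refine ⟨fun h i hi => h.trans_le (iInf₂_le i hi), fun h => ?_⟩
  have : Nonempty s := hs.to_subtype
  rw [iInf_subtype']
  obtain ⟨i, hi⟩ := csInf_mem (Set.range_nonempty fun i : s => f i)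
  exact (h i i.2).trans_eq hi

variable [IsAlgClosed k] [CharZero k]

theorem isGammaDisk_spec {Γ U : Set (BerkP1 k)} (hII : ∀ ζ ∈ Γ, IsTypeII ζ) {ζ : BerkP1 k}
    (h : IsGammaDisk Γ U ζ) :
    (IsFarey U ↔ bMult ζ = ⨅ ξ ∈ U, mult ξ) ∧
      (IsFarey U → ∀ ξ ∈ U, bMult ζ ∣ mult ξ ∧ mult ξ ∣ bMult ξ) := by
  obtain ⟨hdom, hζ, hf⟩ := h
  have hζ' := hII ζ hζ
  have hiff := isFarey_disk_iff hdom.1 hdom.isConnected hζ' hf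
  refine ⟨?_, fun hF ξ hξ => ⟨?_, ?_⟩⟩
  · rw [hiff, bMult_eq_genMult]
    exact eq_comm
  · rw [bMult_eq_genMult, ← hiff.1 hF]
    obtain ⟨a, r, rfl⟩ := hζ'
    exact multSet_dvd hdom.1 hdom.isConnected hf hξ
  · rw [bMult_eq_genMult]
    exact mult_dvd_genMult ξ

theorem annulus_tfae_aux {U : Set (BerkP1 k)} (hU : IsOpen U) (hc : IsConnected U)
    {α β : BerkP1 k} (hf : frontier U = {α, β}) {a : Puiseux k} {r s : ℚ}
    (h : AdjacentData α β a r s) :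
    (∀ ξ ∈ U, genMult ξ ≠ ⊤ → genMult ξ ∈ posSemigroup (genMult α) (genMult β)) ∧
    (∀ ξ ∈ openInterval α β, max (genMult α) (genMult β) < genMult ξ) ∧
    (FareyAdjacent α β) := by
  have hα : α ∈ frontier U := hf ▸ Set.mem_insert _ _
  have hβ : β ∈ frontier U := hf ▸ Set.mem_insert_of_mem _ rfl
  exact ⟨fun ξ hξ => h.genMult_mem hc.isPreconnected (notMem_of_mem_frontier hU hα)
    (notMem_of_mem_frontier hU hβ) (frontier_subset_closure hα) (frontier_subset_closure hβ) hξ,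
    fun ξ hξ => h.lt_genMult_of_mem_openInterval hξ, h.fareyAdjacent⟩

theorem IsTypeII.exists_genMult_eq {ζ : BerkP1 k} (h : IsTypeII ζ) :
    ∃ n : ℕ, 0 < n ∧ genMult ζ = n := by
  obtain ⟨a, r, ha, rfl⟩ := h.exists_truncated
  exact ⟨_, Nat.lcm_pos (per_pos a) r.den_pos, genMult_zetaA ha⟩

theorem isGammaAnnulus_tfae {Γ U : Set (BerkP1 k)} (hII : ∀ ζ ∈ Γ, IsTypeII ζ) {α β : BerkP1 k}
    (h : IsGammaAnnulus Γ U α β) :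
    List.TFAE [
      IsFarey U,
      max (bMult α) (bMult β) < ⨅ ξ ∈ U, bMult ξ,
      ∀ ξ ∈ openInterval α β, max (bMult α) (bMult β) < bMult ξ,
      ∀ ξ ∈ U, genMult ξ ≠ ⊤ → genMult ξ ∈ posSemigroup (bMult α) (bMult β),
      FareyAdjacent α β ∨ FareyAdjacent β α] := by
  obtain ⟨hdom, hαΓ, hβΓ, hne, hf⟩ := h
  have hα := hII α hαΓ
  have hβ := hII β hβΓ
  have hU := hdom.1
  have hc := hdom.isConnected
  have hαf : α ∈ frontier U := hf ▸ Set.mem_insert _ _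
  have hβf : β ∈ frontier U := hf ▸ Set.mem_insert_of_mem _ rfl
  have hadj : (∃ (a : Puiseux k) (r s : ℚ), AdjacentData α β a r s ∨ AdjacentData β α a r s) →
      (∀ ξ ∈ U, genMult ξ ≠ ⊤ → genMult ξ ∈ posSemigroup (genMult α) (genMult β)) ∧
      (∀ ξ ∈ openInterval α β, max (genMult α) (genMult β) < genMult ξ) ∧
      (FareyAdjacent α β ∨ FareyAdjacent β α) := by
    rintro ⟨a, r, s, h | h⟩
    · obtain ⟨h1, h2, h3⟩ := annulus_tfae_aux hU hc hf h
      exact ⟨h1, h2, Or.inl h3⟩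
    · obtain ⟨h1, h2, h3⟩ := annulus_tfae_aux hU hc (hf.trans (Set.pair_comm α β)) h
      rw [posSemigroup_comm, max_comm, openInterval_symm]
      exact ⟨h1, h2, Or.inr h3⟩
  simp only [bMult_eq_genMult]
  rw [ENat.lt_biInf_iff hc.nonempty, isFarey_annulus_iff hU hc hα hβ hne hf]
  tfae_have 1 ↔ 2 := Iff.rfl
  -- The points separating the two ends belong to `U` because `U` is connected and accumulates at
  -- both.
  tfae_have 1 → 5 := fun H => by
    refine (hadj (exists_adjacentData hα hβ hne fun a t ht => H _ ?_)).2.2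
    rcases ht with ⟨h1, h2⟩ | ⟨h1, h2⟩
    · exact mem_of_sep (isOpen_disk a t) (isClosed_insert_disk a t) hc.isPreconnected h1 h2
        (frontier_subset_closure hαf) (frontier_subset_closure hβf)
    · exact mem_of_sep (isOpen_disk a t) (isClosed_insert_disk a t) hc.isPreconnected h1 h2
        (frontier_subset_closure hβf) (frontier_subset_closure hαf)
  -- The same separating points also lie on the open interval, so the condition on the path alone
  -- suffices.
  tfae_have 3 → 5 := fun H => by
    refine (hadj (exists_adjacentData hα hβ hne fun a t ht => H _ ?_)).2.2
    have hsep : ∀ {α β : BerkP1 k}, α ∈ disk a t →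
        β ∉ insert (zetaA a t : BerkP1 k) (disk a t) →
        (zetaA a t : BerkP1 k) ∈ openInterval α β := by
      intro α β h1 h2
      refine ⟨mem_closedInterval_of_sep (isOpen_disk a t) (isClosed_insert_disk a t) h1
        fun h => h2 (Or.inr h), ?_⟩
      rintro (h | h)
      · exact zetaA_notMem_disk a t (h ▸ h1)
      · exact h2 (Or.inl h.symm)
    rcases ht with ⟨h1, h2⟩ | ⟨h1, h2⟩
    · exact hsep h1 h2
    · rw [openInterval_symm]
      exact hsep h1 h2
  tfae_have 4 → 1 := fun H ξ hξ => by
    obtain ⟨a, ha0, ha⟩ := hα.exists_genMult_eq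
    obtain ⟨b, hb0, hb⟩ := hβ.exists_genMult_eq
    have := H ξ hξ
    rw [ha, hb] at this ⊢
    by_cases htop : genMult ξ = ⊤
    · rw [htop, max_lt_iff]
      exact ⟨ENat.natCast_lt_top _, ENat.natCast_lt_top _⟩
    · exact max_lt_of_mem_posSemigroup ha0 hb0 (this htop)
  have hdata : FareyAdjacent α β ∨ FareyAdjacent β α →
      ∃ (a : Puiseux k) (r s : ℚ), AdjacentData α β a r s ∨ AdjacentData β α a r s := by
    rintro (h | h)
    · obtain ⟨a, r, s, h⟩ := h.exists_adjacentData hα hβ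
      exact ⟨a, r, s, Or.inl h⟩
    · obtain ⟨a, r, s, h⟩ := h.exists_adjacentData hβ hα
      exact ⟨a, r, s, Or.inr h⟩
  tfae_have 5 → 4 := fun H => (hadj (hdata H)).1
  tfae_have 5 → 3 := fun H => (hadj (hdata H)).2.1
  tfae_finish

end Farey

end FareyTree

end

theorem theoremB {k : Type*} [Field k] [IsAlgClosed k] [CharZero k]
    (Γ : Set (FareyTree.BerkP1 k)) (hfin : Γ.Finite) (hII : ∀ ζ ∈ Γ, FareyTree.IsTypeII ζ)
    (U : Set (FareyTree.BerkP1 k)) :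
    (∀ ζ, FareyTree.IsGammaDisk Γ U ζ →
      (FareyTree.IsFarey U ↔ FareyTree.bMult ζ = ⨅ ξ ∈ U, FareyTree.mult ξ) ∧
      (FareyTree.IsFarey U → ∀ ξ ∈ U,
        FareyTree.bMult ζ ∣ FareyTree.mult ξ ∧ FareyTree.mult ξ ∣ FareyTree.bMult ξ)) ∧
    (∀ α β, FareyTree.IsGammaAnnulus Γ U α β →
      List.TFAE [
        FareyTree.IsFarey U,
        max (FareyTree.bMult α) (FareyTree.bMult β) < ⨅ ξ ∈ U, FareyTree.bMult ξ,
        ∀ ξ ∈ FareyTree.openInterval α β,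
          max (FareyTree.bMult α) (FareyTree.bMult β) < FareyTree.bMult ξ,
        ∀ ξ ∈ U, FareyTree.genMult ξ ≠ ⊤ →
          FareyTree.genMult ξ ∈
            FareyTree.posSemigroup (FareyTree.bMult α) (FareyTree.bMult β),
        FareyTree.FareyAdjacent α β ∨ FareyTree.FareyAdjacent β α]) :=
  ⟨fun _ h => FareyTree.isGammaDisk_spec hII h, fun _ _ h => FareyTree.isGammaAnnulus_tfae hII h⟩
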